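/- For $a=(a_0,a_1,a_2,a_3)$ with entries in a field $K$, let $S_a\subset\mathbb{P}^3_K$ be the diagonal cubic surface $a_0x_0^3+a_1x_1^3+a_2x_2^3+a_3x_3^3=0$. For $P=(a_0:\dots:a_3)\in\mathbb{P}^3(\mathbb{Q})$ put $S_P=S_a$; it is everywhere locally soluble if $S_P(\mathbb{R})\neq\emptyset$ and $S_P(\mathbb{Q}_p)\neq\emptyset$ for all primes $p$. Let $H$ be the standard multiplicative height on $\mathbb{P}^3(\mathbb{Q})$ (so $H(P)=\max_i|a_i|$ for coprime integers $a_i$). Define the local densities $$\sigma_p=\mu_p\big(\{a\in\mathbb{Z}_p^4\setminus\{0\}: S_a(\mathbb{Q}_p)\neq\emptyset\}\big),\qquad \sigma_\infty=\tfrac1{2^4}\operatorname{vol}\big(\{a\in[-1,1]^4\setminus\{0\}: S_a(\mathbb{R})\neq\emptyset\}\big),$$ where $\mu_p$ is the Haar probability measure on $\mathbb{Z}_p^4$. **Theorem.** One has $\sigma_\infty=1$, $\sigma_p=1$ for every prime $p\equiv 2\bmod 3$, $$\sigma_p=\frac{(1-1/p)^3}{(1-1/p^3)^3}\Big(1-\frac1p+\frac1{p^2}\Big)\Big(1+\frac1p+\frac1{3p^2}\Big)\Big(1+\frac3p+\frac3{p^2}\Big)$$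 for every prime $p\equiv1\bmod 3$, and, with $p=3$, $$\sigma_3=\frac{(1-1/p)^3}{(1-1/p^3)^3}\Big(1+\frac3p+\frac{46}{9p^2}+\frac7{p^3}+\frac{62}{9p^4}+\frac{19}{9p^5}+\frac1{p^6}\Big).$$ The limit $$\sigma=\lim_{B\to\infty}\frac{\#\{P\in\mathbb{P}^3(\mathbb{Q}):H(P)\le B,\ S_P\text{ everywhere locally soluble}\}}{\#\{P\in\mathbb{P}^3(\mathbb{Q}):H(P)\le B\}}$$ exists, the product below converges, and $$\sigma=\sigma_3\prod_{p\equiv1\bmod 3}\sigma_p.$$ Numerically $\sigma\approx0.8965$; precisely, $|\sigma-0.8965|<5\cdot10^{-5}$. -/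

import Mathlib

open Filter Topology MeasureTheory
open scoped LinearAlgebra.Projectivization

noncomputable section

/-- The set of `K`-points of the diagonal cubic surface
`a₀ x₀³ + a₁ x₁³ + a₂ x₂³ + a₃ x₃³ = 0` in `ℙ³`. The condition does not depend on the
representative of the projective point, see `mk_mem_diagonalCubic_iff`. -/
def diagonalCubic {K : Type*} [Field K] (a : Fin 4 → K) : Set (ℙ K (Fin 4 → K)) :=
  {x | ∑ i, a i * x.rep i ^ 3 = 0}

theorem mk_mem_diagonalCubic_iff {K : Type*} [Field K] (a x : Fin 4 → K) (hx : x ≠ 0) :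
    Projectivization.mk K x hx ∈ diagonalCubic a ↔ ∑ i, a i * x i ^ 3 = 0 := by
  obtain ⟨c, hc⟩ := Projectivization.exists_smul_eq_mk_rep K x hx
  have h : ∑ i, a i * (Projectivization.mk K x hx).rep i ^ 3
      = (c : K) ^ 3 * ∑ i, a i * x i ^ 3 := by
    rw [← hc, Finset.mul_sum]
    refine Finset.sum_congr rfl fun i _ => ?_
    simp only [Pi.smul_apply, Units.smul_def, smul_eq_mul]
    ring
  simp [diagonalCubic, h]

theorem diagonalCubic_nonempty_iff {K : Type*} [Field K] (a : Fin 4 → K) :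
    (diagonalCubic a).Nonempty ↔ ∃ x : Fin 4 → K, x ≠ 0 ∧ ∑ i, a i * x i ^ 3 = 0 := by
  constructor
  · rintro ⟨x, hx⟩
    exact ⟨x.rep, x.rep_nonzero, hx⟩
  · rintro ⟨x, h0, hx⟩
    exact ⟨Projectivization.mk K x h0, (mk_mem_diagonalCubic_iff a x h0).2 hx⟩

theorem diagonalCubic_smul {K : Type*} [Field K] (c : K) (hc : c ≠ 0) (a : Fin 4 → K) :
    diagonalCubic (fun i => c * a i) = diagonalCubic a := by
  ext x
  simp [diagonalCubic, mul_assoc, ← Finset.mul_sum, hc]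

/-- The diagonal cubic surface over `ℚ` with coefficient vector `P ∈ ℙ³(ℚ)` has a point over `ℝ`
and over `ℚ_p` for every prime `p`. -/
def EverywhereLocallySoluble (P : ℙ ℚ (Fin 4 → ℚ)) : Prop :=
  (diagonalCubic fun i => (P.rep i : ℝ)).Nonempty ∧
    ∀ (p : ℕ) [Fact p.Prime], (diagonalCubic fun i => (P.rep i : ℚ_[p])).Nonempty

theorem everywhereLocallySoluble_mk_iff (a : Fin 4 → ℚ) (ha : a ≠ 0) :
    EverywhereLocallySoluble (Projectivization.mk ℚ a ha) ↔
      (diagonalCubic fun i => (a i : ℝ)).Nonempty ∧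
        ∀ (p : ℕ) [Fact p.Prime], (diagonalCubic fun i => (a i : ℚ_[p])).Nonempty := by
  obtain ⟨c, hc⟩ := Projectivization.exists_smul_eq_mk_rep ℚ a ha
  have key : ∀ (K : Type) [Field K] [CharZero K],
      diagonalCubic (fun i => ((Projectivization.mk ℚ a ha).rep i : K))
        = diagonalCubic (fun i => (a i : K)) := by
    intro K _ _
    rw [← diagonalCubic_smul ((c : ℚ) : K) (by exact_mod_cast c.ne_zero) fun i => (a i : K), ← hc]
    congr 1
    funext i
    simp [Units.smul_def]
  unfold EverywhereLocallySoluble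
  simp only [key]

/-- The proportion of diagonal cubic surfaces over `ℚ` of height at most `B` that are everywhere
locally soluble. -/
def solubleProportion (B : ℝ) : ℝ :=
  ({P : ℙ ℚ (Fin 4 → ℚ) | P.mulHeight ≤ B ∧ EverywhereLocallySoluble P}.ncard : ℝ) /
    ({P : ℙ ℚ (Fin 4 → ℚ) | P.mulHeight ≤ B}.ncard : ℝ)

instance padicIntMeasurableSpace (p : ℕ) [Fact p.Prime] : MeasurableSpace ℤ_[p] := borel ℤ_[p]

instance padicIntBorelSpace (p : ℕ) [Fact p.Prime] : BorelSpace ℤ_[p] := ⟨rfl⟩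

/-- The Haar measure on `ℤ_p`, normalised to have total mass `1`. -/
def padicIntHaar (p : ℕ) [Fact p.Prime] : Measure ℤ_[p] := Measure.addHaarMeasure ⊤

/-- The local density at `p`: the normalised Haar measure of the set of nonzero `a ∈ ℤ_p⁴` for
which the diagonal cubic surface with coefficients `a` has a `ℚ_p`-point. -/
def padicDensity (p : ℕ) [Fact p.Prime] : ℝ :=
  (Measure.pi fun _ : Fin 4 => padicIntHaar p).real
    {a | a ≠ 0 ∧ (diagonalCubic fun i => (a i : ℚ_[p])).Nonempty}

/-- The local density at the real place. -/
def realDensity : ℝ :=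
  1 / 2 ^ 4 * (volume : Measure (Fin 4 → ℝ)).real
    {a | (a ≠ 0 ∧ (diagonalCubic a).Nonempty) ∧ ∀ i, |a i| ≤ 1}

end

/-! Local side. For nonzero coefficients, solubility over `ℚ_p` depends only on their classes modulo
cubes. Over `ℝ` everything is a cube. For `p ≡ 2 mod 3` every unit is a cube, so there are three
classes and two of the four coefficients agree up to a cube, which gives a point. For `p ≡ 1 mod 3`
and `p = 3` there are nine classes: the valuation modulo three together with a cubic character of
the unit part, which by Hensel's lemma factors through residues modulo `p`, respectively `9`. A
point amounts to a primitive zero-sum relation among `p`-adic integers in these classes, up to a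
common shift of valuation (`diagonalCubic_nonempty_iff_exists_relation`). Reading the relation
modulo `p` or `9` gives the combinatorial criteria `diagonalCubic_nonempty_iff_splitSoluble` and
`diagonalCubic_nonempty_iff_wildSoluble`. A class of valuation `r` in `{0, 1, 2}` has Haar measure
proportional to `p ^ (-r)`, so the local density is a finite weighted count of quadruples of
classes.

Global side. A point of `ℙ³(ℚ)` is a primitive integer vector up to sign, so the proportion is a
quotient of two box densities, each cut out by a `p`-adic condition at every prime. For finitely
many primes such a density is the product of the Haar measures, by the Chinese remainder theorem and
because the conditions have null boundary (`tendsto_boxDensity_padic`). All primes are reached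
through a tail estimate: failure at `p ≠ 3` forces two coefficients to be divisible by `p`, and
vectors with nonzero entries, two of which share a divisor above `M`, have density `O(1/M)`
uniformly in the box (`tendsto_boxDensity_sieve`). The factors `1 - p⁻⁴` from primitivity occur in
numerator and denominator and cancel.

Numerically, `1 - σ_p` is of order `p⁻²`, so the tail of the product is bounded by a telescoping
sum; the initial segment is evaluated in rounded integer arithmetic. -/

/-! ### Hensel's lemma for cubes -/

theorem PadicInt.exists_pow_three_eq_of_norm_lt {p : ℕ} [Fact p.Prime] (u a : ℤ_[p])
    (h : ‖a ^ 3 - u‖ < ‖3 * a ^ 2‖ ^ 2) : ∃ z : ℤ_[p], z ^ 3 = u := by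
  obtain ⟨z, hz, -⟩ := hensels_lemma (p := p) (R := ℤ_[p])
    (F := Polynomial.X ^ 3 - Polynomial.C u) (a := a)
    (by simpa [Polynomial.derivative_pow] using h)
  exact ⟨z, by simpa [sub_eq_zero] using hz⟩

theorem PadicInt.norm_three_eq_one {p : ℕ} [Fact p.Prime] (hp : p ≠ 3) : ‖(3 : ℤ_[p])‖ = 1 := by
  have := (PadicInt.norm_natCast_eq_one_iff (p := p) (n := 3)).2
    ((Nat.coprime_primes (Fact.out) Nat.prime_three).2 hp)
  simpa using this

theorem PadicInt.exists_pow_three_eq {p : ℕ} [Fact p.Prime] (hp : p ≠ 3) (u : ℤ_[p])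
    (h : ‖u - 1‖ < 1) : ∃ z : ℤ_[p], z ^ 3 = u := by
  refine PadicInt.exists_pow_three_eq_of_norm_lt u 1 ?_
  rw [one_pow, one_pow, mul_one, PadicInt.norm_three_eq_one hp, norm_sub_rev, one_pow]
  exact h

theorem PadicInt.exists_pow_three_eq_of_three (u : ℤ_[3]) (h : (9 : ℤ_[3]) ∣ u - 1) :
    ∃ z : ℤ_[3], z ^ 3 = u := by
  obtain ⟨w, hw⟩ := h
  obtain rfl : u = 1 + 9 * w := by linear_combination hw
  have h3 : ‖(3 : ℤ_[3])‖ = 1 / 3 := by simpa using PadicInt.norm_p (p := 3)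
  have ha : ‖1 + 3 * w‖ = 1 := by
    rw [← PadicInt.isUnit_iff]
    by_contra hc
    rw [PadicInt.not_isUnit_iff] at hc
    have h1 : ‖(3 * w : ℤ_[3])‖ < 1 := by
      rw [norm_mul, h3]
      linarith [PadicInt.norm_le_one w, norm_nonneg w]
    have h2 := PadicInt.norm_lt_one_add hc (show ‖-(3 * w : ℤ_[3])‖ < 1 by rwa [norm_neg])
    simp at h2
  -- Starting from `1` the error `9w` may have norm exactly `1/9`, which is not small enough. The
  -- cube of `1 + 3w` agrees with `1 + 9w` modulo `27`.
  refine PadicInt.exists_pow_three_eq_of_norm_lt _ (1 + 3 * w) ?_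
  have e : (1 + 3 * w) ^ 3 - (1 + 9 * w) = 3 ^ 3 * (w ^ 2 * (1 + w)) := by ring
  rw [e, norm_mul, norm_pow 3 3, norm_mul 3, norm_pow (1 + 3 * w), ha, h3]
  have := PadicInt.norm_le_one (w ^ 2 * (1 + w))
  rw [norm_mul, norm_pow] at this
  norm_num
  linarith

/-! ### Cubic residue characters -/

/-- A cubic character on a finite cyclic group of order divisible by three. -/
theorem exists_cubic_character_of_isCyclic (G : Type*) [CommGroup G] [Finite G] [IsCyclic G]
    (h3 : 3 ∣ Nat.card G) :
    ∃ χ : G →* Multiplicative (ZMod 3), Function.Surjective χ ∧ ∀ g, χ g = 1 → ∃ h, h ^ 3 = g := by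
  let e := zmodCyclicMulEquiv (G := G) inferInstance
  let f : Multiplicative (ZMod (Nat.card G)) →* Multiplicative (ZMod 3) :=
    AddMonoidHom.toMultiplicative (ZMod.castHom h3 (ZMod 3)).toAddMonoidHom
  refine ⟨f.comp e.symm.toMonoidHom, ?_, fun g hg => ?_⟩
  · intro y
    obtain ⟨x, hx⟩ := ZMod.castHom_surjective h3 y.toAdd
    exact ⟨e (Multiplicative.ofAdd x), by simpa [f] using congrArg Multiplicative.ofAdd hx⟩
  · have h1 : ZMod.castHom h3 (ZMod 3) (e.symm g).toAdd = 0 := hg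
    have : NeZero (Nat.card G) := ⟨Nat.card_pos.ne'⟩
    rw [← ZMod.natCast_zmod_val (e.symm g).toAdd, map_natCast, ZMod.natCast_eq_zero_iff] at h1
    obtain ⟨c, hc⟩ := h1
    refine ⟨e (Multiplicative.ofAdd (c : ZMod (Nat.card G))), ?_⟩
    rw [← map_pow, ← MulEquiv.eq_symm_apply, ← ofAdd_nsmul]
    apply Multiplicative.toAdd.injective
    rw [← ZMod.natCast_zmod_val (e.symm g).toAdd, hc]
    simp

/-- In a finite field with a surjective cubic character, trivial exactly on cubes, there are
consecutive elements in the two nontrivial classes. -/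
theorem exists_add_one_eq_of_cubic_character {F : Type*} [Field F] [Finite F]
    (χ : Fˣ →* Multiplicative (ZMod 3)) (hχ : Function.Surjective χ) :
    ∃ x y : Fˣ, (x : F) + 1 = y ∧ χ x = Multiplicative.ofAdd 1 ∧ χ y = Multiplicative.ofAdd 2 := by
  classical
  cases nonempty_fintype F
  by_contra! hcon
  have hneg : χ (-1) = 1 := by
    have h : χ (-1) ^ 3 = χ (-1) := by rw [← map_pow]; congr 1; ext; simp; norm_num
    generalize χ (-1) = z at h
    revert h; revert z; decide
  have hneg' : ∀ x, χ (-x) = χ x := fun x => by rw [← neg_one_mul, map_mul, hneg, one_mul]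
  -- The cardinalities of the `N a b` are the cyclotomic numbers of order three. Row sums and two
  -- symmetries rule out `N 1 2 = ∅`.
  let N : ZMod 3 → ZMod 3 → Finset (Fˣ × Fˣ) := fun a b =>
    Finset.univ.filter fun z => (z.1 : F) + 1 = z.2 ∧ χ z.1 = .ofAdd a ∧ χ z.2 = .ofAdd b
  let M : ZMod 3 → Finset Fˣ := fun a => Finset.univ.filter fun z => χ z = .ofAdd a
  have hM : ∀ a, (M a).card = (M 0).card := by
    intro a
    obtain ⟨g, hg⟩ := hχ (.ofAdd a)
    refine Finset.card_bij (fun x _ => x * g⁻¹) ?_ ?_ ?_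
    · intro x hx
      simp only [M, Finset.mem_filter, Finset.mem_univ, true_and] at hx ⊢
      simp [hx, hg]
    · intro x _ y _ h; simpa using h
    · intro y hy
      simp only [M, Finset.mem_filter, Finset.mem_univ, true_and] at hy
      refine ⟨y * g, ?_, by simp⟩
      simp [M, hy, hg]
  have hrow : ∀ a, ((M a).erase (-1)).card = (N a 0).card + (N a 1).card + (N a 2).card := by
    intro a
    have h1 : ((M a).erase (-1)).card = ((N a 0 ∪ N a 1) ∪ N a 2).card := by
      symm
      refine Finset.card_bij (fun z _ => z.1) ?_ ?_ ?_
      · rintro ⟨x, y⟩ hz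
        simp only [N, M, Finset.mem_union, Finset.mem_filter, Finset.mem_univ, true_and,
          Finset.mem_erase] at hz ⊢
        have h : (x : F) + 1 = y := by tauto
        refine ⟨?_, by tauto⟩
        rintro rfl
        simp at h
        exact y.ne_zero h.symm
      · rintro ⟨x, y⟩ hz ⟨x', y'⟩ hz' h
        simp only [N, Finset.mem_union, Finset.mem_filter, Finset.mem_univ, true_and] at hz hz' h
        subst h
        have h1 : (x : F) + 1 = y := by tauto
        have h2 : (x : F) + 1 = y' := by tauto
        have : y = y' := by ext; rw [← h1, h2]
        rw [this]
      · intro x hx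
        simp only [M, Finset.mem_filter, Finset.mem_univ, true_and, Finset.mem_erase] at hx
        have hx0 : (x : F) + 1 ≠ 0 := fun h => hx.1 (by ext; simpa [eq_neg_iff_add_eq_zero] using h)
        refine ⟨(x, Units.mk0 _ hx0), ?_, rfl⟩
        simp only [N, Finset.mem_union, Finset.mem_filter, Finset.mem_univ, true_and,
          Units.val_mk0, hx.2]
        generalize χ (Units.mk0 _ hx0) = z
        revert z; decide
    rw [h1, Finset.card_union_of_disjoint, Finset.card_union_of_disjoint]
    · rw [Finset.disjoint_left]
      intro z hz hz'
      simp only [N, Finset.mem_filter] at hz hz'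
      exact absurd (hz.2.2.2.symm.trans hz'.2.2.2) (by decide)
    · rw [Finset.disjoint_left]
      intro z hz hz'
      simp only [N, Finset.mem_union, Finset.mem_filter] at hz hz'
      rcases hz with hz | hz
      · exact absurd (hz.2.2.2.symm.trans hz'.2.2.2) (by decide)
      · exact absurd (hz.2.2.2.symm.trans hz'.2.2.2) (by decide)
  have hswap : ∀ a b, (N a b).card = (N b a).card := by
    intro a b
    refine Finset.card_bij (fun z _ => (-z.2, -z.1)) ?_ ?_ ?_
    · rintro ⟨x, y⟩ hz
      simp only [N, Finset.mem_filter, Finset.mem_univ, true_and, hneg'] at hz ⊢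
      refine ⟨?_, hz.2.2, hz.2.1⟩
      simp [← hz.1]
    · rintro ⟨x, y⟩ - ⟨x', y'⟩ - h
      simp only [Prod.mk.injEq, neg_inj] at h
      rw [h.1, h.2]
    · rintro ⟨x, y⟩ hz
      refine ⟨(-y, -x), ?_, by simp⟩
      simp only [N, Finset.mem_filter, Finset.mem_univ, true_and, hneg'] at hz ⊢
      refine ⟨?_, hz.2.2, hz.2.1⟩
      simp [← hz.1]
  have h11 : (N 1 1).card = (N 2 0).card := by
    refine Finset.card_bij (fun z _ => (z.1⁻¹, z.2 * z.1⁻¹)) ?_ ?_ ?_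
    · rintro ⟨x, y⟩ hz
      simp only [N, Finset.mem_filter, Finset.mem_univ, true_and] at hz ⊢
      refine ⟨?_, ?_, ?_⟩
      · rw [Units.val_mul, ← hz.1, add_mul, Units.mul_inv, one_mul, add_comm]
      · rw [map_inv, hz.2.1]; rfl
      · rw [map_mul, map_inv, hz.2.1, hz.2.2]; rfl
    · rintro ⟨x, y⟩ - ⟨x', y'⟩ - h
      simp only [Prod.mk.injEq, inv_inj] at h
      obtain ⟨rfl, h⟩ := h
      simpa using h
    · rintro ⟨x, y⟩ hz
      refine ⟨(x⁻¹, y * x⁻¹), ?_, by simp⟩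
      simp only [N, Finset.mem_filter, Finset.mem_univ, true_and] at hz ⊢
      refine ⟨?_, ?_, ?_⟩
      · rw [Units.val_mul, ← hz.1, add_mul, Units.mul_inv, one_mul, add_comm]
      · rw [map_inv, hz.2.1]; rfl
      · rw [map_mul, map_inv, hz.2.1, hz.2.2]; rfl
  have h12 : (N 1 2).card = 0 := by
    rw [Finset.card_eq_zero, Finset.filter_eq_empty_iff]
    rintro ⟨x, y⟩ - ⟨h1, h2, h3⟩
    exact hcon x y h1 h2 h3
  have e0 : ((M 0).erase (-1)).card + 1 = (M 0).card :=
    Finset.card_erase_add_one (by simp [M, hneg])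
  have e1 : ((M 1).erase (-1)).card = (M 1).card := by
    rw [Finset.erase_eq_of_notMem]
    simp only [M, Finset.mem_filter, hneg, Finset.mem_univ, true_and]
    decide
  -- If `N 1 2` is empty, row 1 and the symmetries give `|M 0| = |N 1 0| + |N 1 1| = |N 0 1| + |N 0
  -- 2|`. Row 0, which loses the element `-1`, bounds the right side by `|M 0| - 1`.
  have := hrow 0
  have := hrow 1
  have := hM 1
  have := hswap 1 0
  have := hswap 0 2
  omega

/-- If the residue of a unit `u` has trivial character it is a cube, and its cube root lifts to a
unit `w`. Then `u / w³` reduces to `1` and is a cube by `hcube`. The ring `R` is `ℤ/p` or `ℤ/9` in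
the applications. -/
theorem PadicInt.exists_cubic_character {p : ℕ} [Fact p.Prime] {R : Type*} [CommRing R]
    [Nontrivial R] [Finite Rˣ] [IsCyclic Rˣ] (φ : ℤ_[p] →+* R) (hφ : Function.Surjective φ)
    (h3 : 3 ∣ Nat.card Rˣ) (hcube : ∀ u : ℤ_[p], φ u = 1 → ∃ z : ℤ_[p], z ^ 3 = u) :
    ∃ χ : Rˣ →* Multiplicative (ZMod 3), Function.Surjective χ ∧
      Function.Surjective (χ.comp (Units.map φ.toMonoidHom)) ∧
      ∀ u, χ.comp (Units.map φ.toMonoidHom) u = 1 → ∃ z : ℤ_[p]ˣ, z ^ 3 = u := by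
  obtain ⟨χ, hχ, hker⟩ := exists_cubic_character_of_isCyclic Rˣ h3
  have : IsLocalHom φ := hφ.isLocalHom φ
  have hu : Function.Surjective (Units.map φ.toMonoidHom) :=
    IsLocalRing.surjective_units_map_of_local_ringHom φ hφ inferInstance
  refine ⟨χ, hχ, hχ.comp hu, fun u h => ?_⟩
  obtain ⟨g, hg⟩ := hker _ h
  obtain ⟨w, rfl⟩ := hu g
  obtain ⟨z, hz⟩ := hcube ((u * (w ^ 3)⁻¹ : ℤ_[p]ˣ) : ℤ_[p]) (by
    have : Units.map φ.toMonoidHom (u * (w ^ 3)⁻¹) = 1 := by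
      rw [map_mul, map_inv, map_pow, hg, mul_inv_cancel]
    exact congrArg Units.val this)
  have hzu : IsUnit z := by
    refine isUnit_of_dvd_unit (dvd_pow_self z three_ne_zero) ?_
    rw [hz]; exact Units.isUnit _
  refine ⟨hzu.unit * w, ?_⟩
  rw [mul_pow, ← eq_mul_inv_iff_mul_eq]
  ext
  rw [Units.val_pow_eq_pow_val, IsUnit.unit_spec, hz]

/-- The cubic residue character at a prime that is one modulo three. -/
theorem PadicInt.exists_cubic_character_of_mod_three_eq_one {p : ℕ} [Fact p.Prime]
    (hp : p % 3 = 1) :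
    ∃ ρ : ℤ_[p]ˣ →* Multiplicative (ZMod 3), Function.Surjective ρ ∧
      (∀ u, ρ u = 1 → ∃ z : ℤ_[p]ˣ, z ^ 3 = u) ∧
      (∀ u v : ℤ_[p]ˣ, PadicInt.toZMod (u : ℤ_[p]) = PadicInt.toZMod (v : ℤ_[p]) → ρ u = ρ v) ∧
      ∃ x y : ℤ_[p]ˣ, (1 : ℤ_[p]) + x + y = 0 ∧ ρ x = .ofAdd 1 ∧ ρ y = .ofAdd 2 := by
  have hp3 : p ≠ 3 := by rintro rfl; simp at hp
  obtain ⟨χ, hχ, hs, hk⟩ := PadicInt.exists_cubic_character (p := p) PadicInt.toZMod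
    (ZMod.ringHom_surjective _) (by
      rw [Nat.card_eq_fintype_card, ZMod.card_units p]; omega) (fun u hu => by
        refine PadicInt.exists_pow_three_eq hp3 u ?_
        rw [← PadicInt.mem_nonunits, ← IsLocalRing.mem_maximalIdeal, ← PadicInt.ker_toZMod,
          RingHom.mem_ker, map_sub, hu, map_one, sub_self])
  have hfac : ∀ u v : ℤ_[p]ˣ, PadicInt.toZMod (u : ℤ_[p]) = PadicInt.toZMod (v : ℤ_[p]) →
      χ.comp (Units.map (PadicInt.toZMod (p := p)).toMonoidHom) u =
      χ.comp (Units.map (PadicInt.toZMod (p := p)).toMonoidHom) v := fun u v h => by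
    simp only [MonoidHom.comp_apply]
    congr 1
    ext
    exact h
  refine ⟨_, hs, hk, hfac, ?_⟩
  obtain ⟨x, y, hxy, hx, hy⟩ := exists_add_one_eq_of_cubic_character χ hχ
  -- Lift `x` to `X` and take `-(1 + X)` as the second unit. It reduces to `-y`, and the sign is
  -- harmless because `-1` is a cube.
  obtain ⟨X, hX⟩ := ZMod.ringHom_surjective (PadicInt.toZMod (p := p)) (x : ZMod p)
  have hunit : ∀ w : ℤ_[p], PadicInt.toZMod w ≠ 0 → IsUnit w := by
    intro w hw
    by_contra h
    rw [← mem_nonunits_iff, ← IsLocalRing.mem_maximalIdeal, ← PadicInt.ker_toZMod] at h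
    exact hw h
  have hXu : IsUnit X := hunit X (by rw [hX]; exact x.ne_zero)
  have hY : PadicInt.toZMod (-(1 + X)) = ((-y : (ZMod p)ˣ) : ZMod p) := by
    rw [map_neg, map_add, map_one, hX, add_comm, hxy, Units.val_neg]
  have hYu : IsUnit (-(1 + X)) := hunit _ (by rw [hY]; exact Units.ne_zero _)
  refine ⟨hXu.unit, hYu.unit, by simp, ?_, ?_⟩
  · rw [← hx, MonoidHom.comp_apply]
    congr 1
    ext
    exact hX
  · have hneg : χ (-1) = 1 := by
      have h : χ (-1) ^ 3 = χ (-1) := by rw [← map_pow]; congr 1; ext; simp; norm_num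
      generalize χ (-1) = z at h
      revert h; revert z; decide
    rw [← hy, MonoidHom.comp_apply, ← one_mul (χ y), ← hneg, ← map_mul, neg_one_mul]
    congr 1
    ext
    exact hY

/-- The cubic residue character at the prime three. -/
theorem PadicInt.exists_cubic_character_three :
    ∃ ρ : ℤ_[3]ˣ →* Multiplicative (ZMod 3), Function.Surjective ρ ∧
      (∀ u, ρ u = 1 → ∃ z : ℤ_[3]ˣ, z ^ 3 = u) ∧
      (∀ u v : ℤ_[3]ˣ, PadicInt.toZModPow 2 (u : ℤ_[3]) = PadicInt.toZModPow 2 (v : ℤ_[3]) →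
        ρ u = ρ v) := by
  have : Fact (1 < 3 ^ 2) := ⟨by norm_num⟩
  have : IsCyclic (ZMod (3 ^ 2))ˣ :=
    ZMod.isCyclic_units_of_prime_pow 3 Nat.prime_three (by norm_num) 2
  obtain ⟨χ, hχ, hs, hk⟩ := PadicInt.exists_cubic_character (p := 3) (PadicInt.toZModPow 2)
    (ZMod.ringHom_surjective _) (by
      rw [Nat.card_eq_fintype_card, ZMod.card_units_eq_totient]
      decide) (fun u hu => by
        refine PadicInt.exists_pow_three_eq_of_three u ?_
        have : u - 1 ∈ RingHom.ker (PadicInt.toZModPow (p := 3) 2) := by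
          rw [RingHom.mem_ker, map_sub, hu, map_one, sub_self]
        rw [PadicInt.ker_toZModPow, Ideal.mem_span_singleton] at this
        norm_num at this
        exact this)
  refine ⟨_, hs, hk, fun u v h => ?_⟩
  simp only [MonoidHom.comp_apply]
  congr 1
  ext
  exact h

/-! ### Classes of `p`-adic numbers modulo cubes -/

section CubeClass

variable {p : ℕ} [Fact p.Prime]

theorem Padic.exists_unit_mul_zpow (x : ℚ_[p]) (hx : x ≠ 0) :
    ∃ u : ℤ_[p]ˣ, x = (u : ℤ_[p]) * (p : ℚ_[p]) ^ x.valuation := by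
  have hp : (p : ℚ_[p]) ≠ 0 := by exact_mod_cast (Fact.out : p.Prime).ne_zero
  have hn : ‖x * (p : ℚ_[p]) ^ (-x.valuation)‖ = 1 := by
    rw [norm_mul, Padic.norm_p_zpow, Padic.norm_eq_zpow_neg_valuation hx, neg_neg,
      ← zpow_add₀ (by exact_mod_cast (Fact.out : p.Prime).ne_zero), neg_add_cancel, zpow_zero]
  refine ⟨PadicInt.mkUnits hn, ?_⟩
  rw [PadicInt.mkUnits_eq, mul_assoc, ← zpow_add₀ hp, neg_add_cancel, zpow_zero, mul_one]

open Classical in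
/-- The class modulo cubes of a nonzero `p`-adic number, in terms of a cubic character `ρ` of the
units: the valuation modulo three and the value of `ρ` on the unit part. -/
noncomputable def cubeClass (ρ : ℤ_[p]ˣ →* Multiplicative (ZMod 3)) (x : ℚ_[p]) :
    ZMod 3 × ZMod 3 :=
  if h : x = 0 then 0 else
    ((x.valuation : ZMod 3), (ρ (Padic.exists_unit_mul_zpow x h).choose).toAdd)

variable (ρ : ℤ_[p]ˣ →* Multiplicative (ZMod 3))

/-- Valuation and unit part are unique, so the unit chosen in the definition must be `u`. All
computations with `cubeClass` rest on this. -/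
theorem cubeClass_unit_mul_zpow (u : ℤ_[p]ˣ) (n : ℤ) :
    cubeClass ρ ((u : ℤ_[p]) * (p : ℚ_[p]) ^ n) = ((n : ZMod 3), (ρ u).toAdd) := by
  have hp : (p : ℚ_[p]) ≠ 0 := by exact_mod_cast (Fact.out : p.Prime).ne_zero
  have hu : ((u : ℤ_[p]) : ℚ_[p]) ≠ 0 := by simp
  have h0 : ((u : ℤ_[p]) : ℚ_[p]) * (p : ℚ_[p]) ^ n ≠ 0 := mul_ne_zero hu (zpow_ne_zero _ hp)
  have hv : (((u : ℤ_[p]) : ℚ_[p]) * (p : ℚ_[p]) ^ n).valuation = n := by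
    have hu0 : ((u : ℤ_[p]) : ℚ_[p]).valuation = 0 := by
      have := Padic.norm_eq_zpow_neg_valuation hu
      rw [PadicInt.padic_norm_e_of_padicInt, PadicInt.norm_units] at this
      have h1 : (1 : ℝ) < p := by exact_mod_cast (Fact.out : p.Prime).one_lt
      replace this := (zpow_zero (p : ℝ)).trans this
      have := zpow_right_injective₀ (by linarith) h1.ne' this
      omega
    rw [Padic.valuation_mul hu (zpow_ne_zero _ hp), hu0, Padic.valuation_zpow, Padic.valuation_p]
    simp
  rw [cubeClass, dif_neg h0]
  have hs := (Padic.exists_unit_mul_zpow _ h0).choose_spec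
  generalize (Padic.exists_unit_mul_zpow _ h0).choose = w at hs
  rw [hv] at hs ⊢
  have : u = w := by
    ext
    exact PadicInt.ext (mul_right_cancel₀ (zpow_ne_zero n hp) hs)
  rw [this]

theorem cubeClass_unit (u : ℤ_[p]ˣ) : cubeClass ρ ((u : ℤ_[p]) : ℚ_[p]) = (0, (ρ u).toAdd) := by
  simpa using cubeClass_unit_mul_zpow ρ u 0

theorem cubeClass_zpow (n : ℤ) : cubeClass ρ ((p : ℚ_[p]) ^ n) = ((n : ZMod 3), 0) := by
  simpa using cubeClass_unit_mul_zpow ρ 1 n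

theorem cubeClass_mul {x y : ℚ_[p]} (hx : x ≠ 0) (hy : y ≠ 0) :
    cubeClass ρ (x * y) = cubeClass ρ x + cubeClass ρ y := by
  have hp : (p : ℚ_[p]) ≠ 0 := by exact_mod_cast (Fact.out : p.Prime).ne_zero
  obtain ⟨u, hu⟩ := Padic.exists_unit_mul_zpow x hx
  obtain ⟨v, hv⟩ := Padic.exists_unit_mul_zpow y hy
  generalize x.valuation = m at hu
  generalize y.valuation = n at hv
  have : x * y = ((u * v : ℤ_[p]ˣ) : ℤ_[p]) * (p : ℚ_[p]) ^ (m + n) := by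
    rw [hu, hv, zpow_add₀ hp]
    push_cast
    ring
  rw [this, cubeClass_unit_mul_zpow, hu, hv, cubeClass_unit_mul_zpow, cubeClass_unit_mul_zpow]
  simp

theorem cubeClass_pow_three {x : ℚ_[p]} (hx : x ≠ 0) : cubeClass ρ (x ^ 3) = 0 := by
  rw [pow_succ, pow_two, cubeClass_mul ρ (mul_ne_zero hx hx) hx, cubeClass_mul ρ hx hx]
  generalize cubeClass ρ x = z
  revert z; decide

theorem cubeClass_neg {x : ℚ_[p]} (hx : x ≠ 0) : cubeClass ρ (-x) = cubeClass ρ x := by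
  have h : cubeClass ρ (-1) = 0 := by
    have := cubeClass_pow_three ρ (x := (-1 : ℚ_[p])) (by simp)
    rwa [show (-1 : ℚ_[p]) ^ 3 = -1 by norm_num] at this
  rw [← neg_one_mul, cubeClass_mul ρ (by simp) hx, h, zero_add]

variable {ρ}

/-- The valuations differ by a multiple `3k` and the quotient of the unit parts lies in the kernel
of `ρ`, hence is a cube. With `cubeClass_eq_of_eq_mul_pow_three` this makes `cubeClass` a complete
invariant modulo cubes. -/
theorem exists_eq_mul_pow_three_of_cubeClass_eq
    (hρ : ∀ u, ρ u = 1 → ∃ z : ℤ_[p]ˣ, z ^ 3 = u) {x y : ℚ_[p]} (hx : x ≠ 0) (hy : y ≠ 0)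
    (h : cubeClass ρ x = cubeClass ρ y) : ∃ c : ℚ_[p], c ≠ 0 ∧ y = x * c ^ 3 := by
  have hp : (p : ℚ_[p]) ≠ 0 := by exact_mod_cast (Fact.out : p.Prime).ne_zero
  obtain ⟨u, hu⟩ := Padic.exists_unit_mul_zpow x hx
  obtain ⟨v, hv⟩ := Padic.exists_unit_mul_zpow y hy
  generalize x.valuation = m at hu
  generalize y.valuation = n at hv
  rw [hu, hv, cubeClass_unit_mul_zpow, cubeClass_unit_mul_zpow, Prod.mk.injEq] at h
  obtain ⟨k, hk⟩ := (ZMod.intCast_eq_intCast_iff_dvd_sub m n 3).1 h.1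
  obtain ⟨z, hz⟩ := hρ (v * u⁻¹) (by
    rw [map_mul, map_inv, mul_inv_eq_one]
    exact Multiplicative.toAdd.injective h.2.symm)
  refine ⟨(z : ℤ_[p]) * (p : ℚ_[p]) ^ k, mul_ne_zero (by simp) (zpow_ne_zero _ hp), ?_⟩
  have hz' : ((z : ℤ_[p]) : ℚ_[p]) ^ 3 * (u : ℤ_[p]) = (v : ℤ_[p]) := by
    rw [← PadicInt.coe_pow, ← PadicInt.coe_mul, ← Units.val_pow_eq_pow_val, hz, ← Units.val_mul,
      inv_mul_cancel_right]
  obtain rfl : n = m + 3 * k := by push_cast at hk; omega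
  rw [hu, hv, mul_pow, ← hz', ← zpow_natCast (_ ^ k), ← zpow_mul, zpow_add₀ hp,
    mul_comm k, Nat.cast_ofNat]
  ring

theorem cubeClass_eq_of_eq_mul_pow_three {x y c : ℚ_[p]} (hx : x ≠ 0) (hc : c ≠ 0)
    (h : y = x * c ^ 3) : cubeClass ρ y = cubeClass ρ x := by
  rw [h, cubeClass_mul ρ hx (pow_ne_zero _ hc), cubeClass_pow_three ρ hc, add_zero]

/-- Nonzero `p`-adic numbers that are close to each other agree up to cubes. -/
theorem Padic.exists_eq_mul_pow_three_of_norm_sub_le {x y : ℚ_[p]} (hx : x ≠ 0)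
    (h : ‖y - x‖ ≤ ‖x‖ * (p : ℝ) ^ (-2 : ℤ)) : ∃ c : ℚ_[p], c ≠ 0 ∧ y = x * c ^ 3 := by
  have hp1 : (1 : ℝ) < p := by exact_mod_cast (Fact.out : p.Prime).one_lt
  have hx' : 0 < ‖x‖ := norm_pos_iff.2 hx
  have h1 : ‖y / x - 1‖ ≤ (p : ℝ) ^ (-2 : ℤ) := by
    rw [div_sub_one hx, norm_div, div_le_iff₀ hx', mul_comm]
    exact h
  have hlt : (p : ℝ) ^ (-2 : ℤ) < 1 := zpow_lt_one_of_neg₀ hp1 (by norm_num)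
  have h2 : ‖y / x‖ = 1 := by
    have := Padic.norm_eq_of_norm_add_lt_right (p := p) (z1 := y / x) (z2 := -1)
      (by rw [← sub_eq_add_neg, norm_neg, norm_one]; linarith)
    rwa [norm_neg, norm_one] at this
  let u : ℤ_[p] := ⟨y / x, h2.le⟩
  have hu : ‖u - 1‖ ≤ (p : ℝ) ^ (-2 : ℤ) := h1
  obtain ⟨z, hz⟩ : ∃ z : ℤ_[p], z ^ 3 = u := by
    -- The exponent `-2` is dictated by `p = 3`, where congruence to `1` modulo `9` is used; at
    -- other primes congruence modulo `p` is enough.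
    by_cases hp : p = 3
    · subst hp
      refine PadicInt.exists_pow_three_eq_of_three u ?_
      have := (PadicInt.norm_le_pow_iff_mem_span_pow (u - 1) 2).1 hu
      rw [Ideal.mem_span_singleton] at this
      norm_num at this
      exact this
    · exact PadicInt.exists_pow_three_eq hp u (by linarith)
  have hz' : (z : ℚ_[p]) ^ 3 = y / x := by rw [← PadicInt.coe_pow, hz]
  refine ⟨z, ?_, ?_⟩
  · intro h0
    rw [h0, zero_pow three_ne_zero] at hz'
    rw [← hz', norm_zero] at h2
    exact zero_ne_one h2
  · rw [hz']; field_simp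

end CubeClass

/-! ### Solubility in terms of classes modulo cubes -/

section Criteria

variable {p : ℕ} [Fact p.Prime] {ρ : ℤ_[p]ˣ →* Multiplicative (ZMod 3)}

theorem diagonalCubic_nonempty_of_eq_mul_pow_three {K : Type*} [Field K] (a : Fin 4 → K)
    {i j : Fin 4} (hij : i ≠ j) (c : K) (h : a j = a i * c ^ 3) : (diagonalCubic a).Nonempty := by
  rw [diagonalCubic_nonempty_iff]
  refine ⟨fun l => if l = i then c else if l = j then -1 else 0, fun h0 => ?_, ?_⟩
  · have := congrFun h0 j
    simp [hij.symm] at this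
  · rw [Fintype.sum_eq_add i j hij]
    · simp only [if_true, if_neg hij.symm, h]
      ring
    · rintro l ⟨hl1, hl2⟩
      simp [hl1, hl2]

theorem diagonalCubic_nonempty_of_eq_zero {K : Type*} [Field K] (a : Fin 4 → K)
    {i : Fin 4} (h : a i = 0) : (diagonalCubic a).Nonempty := by
  rw [diagonalCubic_nonempty_iff]
  refine ⟨Pi.single i 1, fun h0 => ?_, ?_⟩
  · have := congrFun h0 i
    simp at this
  · rw [Fintype.sum_eq_single i]
    · simp [h]
    · intro l hl
      simp [hl]

theorem diagonalCubic_nonempty_of_cubeClass_eq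
    (hρ : ∀ u, ρ u = 1 → ∃ z : ℤ_[p]ˣ, z ^ 3 = u) (a : Fin 4 → ℚ_[p]) (ha : ∀ i, a i ≠ 0)
    {i j : Fin 4} (hij : i ≠ j) (h : cubeClass ρ (a i) = cubeClass ρ (a j)) :
    (diagonalCubic a).Nonempty := by
  obtain ⟨c, -, hc⟩ := exists_eq_mul_pow_three_of_cubeClass_eq hρ (ha i) (ha j) h
  exact diagonalCubic_nonempty_of_eq_mul_pow_three a hij c hc

theorem diagonalCubic_nonempty_congr {K : Type*} [Field K] (a b c : Fin 4 → K)
    (hc : ∀ i, c i ≠ 0) (h : ∀ i, b i = a i * c i ^ 3) :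
    (diagonalCubic a).Nonempty ↔ (diagonalCubic b).Nonempty := by
  rw [diagonalCubic_nonempty_iff, diagonalCubic_nonempty_iff]
  constructor
  · rintro ⟨x, hx, hs⟩
    refine ⟨fun i => x i / c i, fun h0 => hx (funext fun i => ?_), ?_⟩
    · simpa [hc i] using congrFun h0 i
    · rw [← hs]
      refine Finset.sum_congr rfl fun i _ => ?_
      rw [h i]
      have := hc i
      field_simp
  · rintro ⟨x, hx, hs⟩
    refine ⟨fun i => x i * c i, fun h0 => hx (funext fun i => ?_), ?_⟩
    · simpa [hc i] using congrFun h0 i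
    · rw [← hs]
      refine Finset.sum_congr rfl fun i _ => ?_
      rw [h i]
      ring

/-- A diagonal cubic has a `p`-adic point if and only if there is a primitive relation between
`p`-adic integers lying, up to a common shift of the valuation, in the classes modulo cubes of the
coefficients. -/
theorem diagonalCubic_nonempty_iff_exists_relation
    (hρ : ∀ u, ρ u = 1 → ∃ z : ℤ_[p]ˣ, z ^ 3 = u) (a : Fin 4 → ℚ_[p]) (ha : ∀ i, a i ≠ 0) :
    (diagonalCubic a).Nonempty ↔ ∃ (t : Fin 4 → ℤ_[p]) (m : ZMod 3), ∑ i, t i = 0 ∧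
      (∃ i, IsUnit (t i)) ∧
      ∀ i, t i ≠ 0 → cubeClass ρ (a i) = cubeClass ρ (t i) + (m, 0) := by
  have hp : (p : ℚ_[p]) ≠ 0 := by exact_mod_cast (Fact.out : p.Prime).ne_zero
  rw [diagonalCubic_nonempty_iff]
  constructor
  · rintro ⟨x, hx, hs⟩
    -- Dividing the four terms by the power of `p` in the largest one makes all of them integral and
    -- that one a unit. The shift `m` is its valuation modulo three.
    obtain ⟨i₀, hi₀⟩ := Finite.exists_max fun i => ‖a i * x i ^ 3‖
    have hy0 : a i₀ * x i₀ ^ 3 ≠ 0 := by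
      intro h0
      refine hx (funext fun i => ?_)
      have := hi₀ i
      rw [h0, norm_zero, norm_le_zero_iff, mul_eq_zero] at this
      simpa [ha i] using this
    set v := (a i₀ * x i₀ ^ 3).valuation with hv
    have hc0 : (p : ℚ_[p]) ^ v ≠ 0 := zpow_ne_zero _ hp
    have hnc : ‖(p : ℚ_[p]) ^ v‖ = ‖a i₀ * x i₀ ^ 3‖ := by
      rw [Padic.norm_p_zpow, Padic.norm_eq_zpow_neg_valuation hy0]
    have hle : ∀ i, ‖a i * x i ^ 3 / (p : ℚ_[p]) ^ v‖ ≤ 1 := fun i => by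
      rw [norm_div, hnc]
      exact div_le_one_of_le₀ (hi₀ i) (norm_nonneg _)
    obtain ⟨t, ht⟩ : ∃ t : Fin 4 → ℤ_[p], ∀ i, (t i : ℚ_[p]) = a i * x i ^ 3 / (p : ℚ_[p]) ^ v :=
      ⟨fun i => ⟨_, hle i⟩, fun i => rfl⟩
    refine ⟨t, v, ?_, ⟨i₀, ?_⟩, fun i hi => ?_⟩
    · apply PadicInt.ext
      rw [PadicInt.coe_sum, PadicInt.coe_zero, Finset.sum_congr rfl fun i _ => ht i,
        ← Finset.sum_div, hs, zero_div]
    · rw [PadicInt.isUnit_iff, PadicInt.norm_def, ht, norm_div, hnc]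
      exact div_self (norm_ne_zero_iff.2 hy0)
    · have hi' : a i * x i ^ 3 / (p : ℚ_[p]) ^ v ≠ 0 := by
        rw [← ht]; exact PadicInt.coe_ne_zero.2 hi
      have hxi : x i ≠ 0 := by
        rintro h; simp [h] at hi'
      rw [ht, ← cubeClass_zpow ρ v, ← cubeClass_mul ρ hi' hc0, div_mul_cancel₀ _ hc0]
      exact (cubeClass_eq_of_eq_mul_pow_three (ha i) hxi rfl).symm
  · rintro ⟨t, m, hs, ⟨i₀, hi₀⟩, ht⟩
    have hc0 : (p : ℚ_[p]) ^ m.val ≠ 0 := pow_ne_zero _ hp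
    have hcl : cubeClass ρ ((p : ℚ_[p]) ^ m.val) = (m, 0) := by
      have := cubeClass_zpow ρ (p := p) m.val
      rw [zpow_natCast] at this
      rw [this]
      simp
    -- After multiplication by `p ^ m` each nonzero entry lies in the class of `a i`, so it is `a i`
    -- times a cube; a zero entry takes `c = 0`.
    have : ∀ i, ∃ c : ℚ_[p], (t i : ℚ_[p]) * (p : ℚ_[p]) ^ m.val = a i * c ^ 3 := by
      intro i
      by_cases h0 : t i = 0
      · exact ⟨0, by simp [h0]⟩
      have h0' : (t i : ℚ_[p]) ≠ 0 := PadicInt.coe_ne_zero.2 h0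
      obtain ⟨c, -, hc⟩ := exists_eq_mul_pow_three_of_cubeClass_eq hρ (ha i)
        (mul_ne_zero h0' hc0) (by rw [cubeClass_mul ρ h0' hc0, hcl, ht i h0])
      exact ⟨c, hc⟩
    choose c hc using this
    refine ⟨c, fun h0 => ?_, ?_⟩
    · have := hc i₀
      rw [h0] at this
      have h1 : (t i₀ : ℚ_[p]) = 0 := by simpa [hc0] using this
      rw [PadicInt.coe_eq_zero.1 h1] at hi₀
      exact not_isUnit_zero hi₀
    · rw [← Finset.sum_congr rfl fun i _ => hc i, ← Finset.sum_mul, ← PadicInt.coe_sum, hs]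
      simp

/-- The solubility condition on the classes modulo cubes at primes that are one modulo three. -/
def SplitSoluble (c : Fin 4 → ZMod 3 × ZMod 3) : Prop :=
  (∃ i j, i ≠ j ∧ c i = c j) ∨
    ∃ i j k, i ≠ j ∧ i ≠ k ∧ j ≠ k ∧ (c i).1 = (c j).1 ∧ (c i).1 = (c k).1

/-- The solubility condition on the classes modulo cubes at the prime three. -/
def WildSoluble (c : Fin 4 → ZMod 3 × ZMod 3) : Prop :=
  (∃ i j, i ≠ j ∧ c i = c j) ∨ ∃ i j k, i ≠ j ∧ (c i).1 = (c j).1 ∧ (c k).1 = (c i).1 + 1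

/-- A primitive relation reduced modulo `p` has at least two nonzero residues. Three of them give
three coefficients of equal valuation class; exactly two are negatives of each other and, `-1` being
a cube, lie in the same class. Conversely, three coefficients of equal valuation class and pairwise
distinct classes realise all three values of the character, so the relation `1 + x + y = 0` from
`hrel` fits them. -/
theorem diagonalCubic_nonempty_iff_splitSoluble
    (hρ : ∀ u, ρ u = 1 → ∃ z : ℤ_[p]ˣ, z ^ 3 = u)
    (hmod : ∀ u v : ℤ_[p]ˣ, PadicInt.toZMod (u : ℤ_[p]) = PadicInt.toZMod (v : ℤ_[p]) →
      ρ u = ρ v)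
    (hrel : ∃ x y : ℤ_[p]ˣ, (1 : ℤ_[p]) + x + y = 0 ∧ ρ x = .ofAdd 1 ∧ ρ y = .ofAdd 2)
    (a : Fin 4 → ℚ_[p]) (ha : ∀ i, a i ≠ 0) :
    (diagonalCubic a).Nonempty ↔ SplitSoluble fun i => cubeClass ρ (a i) := by
  constructor
  · rw [diagonalCubic_nonempty_iff_exists_relation hρ a ha]
    rintro ⟨t, m, hs, ⟨i, hi⟩, ht⟩
    have hunit : ∀ l, PadicInt.toZMod (t l) ≠ 0 → IsUnit (t l) := by
      intro l hl
      by_contra h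
      rw [← mem_nonunits_iff, ← IsLocalRing.mem_maximalIdeal, ← PadicInt.ker_toZMod] at h
      exact hl h
    have hcl : ∀ l (h : IsUnit (t l)), cubeClass ρ (a l) = (m, (ρ h.unit).toAdd) := by
      intro l h
      have := cubeClass_unit ρ h.unit
      rw [ht l h.ne_zero, show (t l : ℚ_[p]) = ((h.unit : ℤ_[p]) : ℚ_[p]) from rfl, this]
      simp
    have hs' : ∑ l, PadicInt.toZMod (t l) = 0 := by rw [← map_sum, hs, map_zero]
    obtain ⟨j, hij, hj⟩ : ∃ j, j ≠ i ∧ PadicInt.toZMod (t j) ≠ 0 := by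
      by_contra! h
      rw [Fintype.sum_eq_single i h] at hs'
      exact (hi.map PadicInt.toZMod).ne_zero hs'
    have hj := hunit j hj
    by_cases hk : ∃ k, k ≠ i ∧ k ≠ j ∧ PadicInt.toZMod (t k) ≠ 0
    · obtain ⟨k, hki, hkj, hk⟩ := hk
      have hk := hunit k hk
      exact Or.inr ⟨i, j, k, hij.symm, hki.symm, hkj.symm, by simp [hcl i hi, hcl j hj],
        by simp [hcl i hi, hcl k hk]⟩
    · push Not at hk
      rw [Fintype.sum_eq_add i j hij.symm fun k hk' => hk k hk'.1 hk'.2] at hs'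
      refine Or.inl ⟨i, j, hij.symm, ?_⟩
      have h1 : ρ hi.unit = ρ (-hj.unit) := hmod _ _ (by
        rw [Units.val_neg, map_neg, IsUnit.unit_spec, IsUnit.unit_spec]
        exact eq_neg_of_add_eq_zero_left hs')
      have h2 : ρ (-hj.unit) = ρ hj.unit := by
        have := cubeClass_neg ρ (x := ((hj.unit : ℤ_[p]) : ℚ_[p])) (by simpa using hj.ne_zero)
        rw [← PadicInt.coe_neg, ← Units.val_neg, cubeClass_unit, cubeClass_unit] at this
        exact Multiplicative.toAdd.injective (Prod.mk.inj this).2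
      simp only [hcl i hi, hcl j hj, h1, h2]
  · by_cases hpair : ∃ i j, i ≠ j ∧ cubeClass ρ (a i) = cubeClass ρ (a j)
    · obtain ⟨i, j, hij, h⟩ := hpair
      exact fun _ => diagonalCubic_nonempty_of_cubeClass_eq hρ a ha hij h
    rintro (h | ⟨i, j, k, hij, hik, hjk, h1, h2⟩)
    · exact absurd h hpair
    push Not at hpair
    rw [diagonalCubic_nonempty_iff_exists_relation hρ a ha]
    obtain ⟨x, y, hxy, hx, hy⟩ := hrel
    let f : ZMod 3 → ℤ_[p]ˣ := fun z => if z = 0 then 1 else if z = 1 then x else y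
    have hf : ∀ z, (ρ (f z)).toAdd = z := by
      intro z
      have : z = 0 ∨ z = 1 ∨ z = 2 := by revert z; decide
      rcases this with rfl | rfl | rfl
      · simp [f]
      · simp [f, hx]
      · have h2 : (2 : ZMod 3) ≠ 0 ∧ (2 : ZMod 3) ≠ 1 := by decide
        simp [f, hy, h2]
    have hsum : ∀ b c d : ZMod 3, b ≠ c → b ≠ d → c ≠ d →
        (f b : ℤ_[p]) + f c + f d = 0 := by
      have h3 : ∀ z : ZMod 3, z = 0 ∨ z = 1 ∨ z = 2 := by decide
      have e : (f 0 : ℤ_[p]) + f 1 + f 2 = 0 := by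
        have h2 : (2 : ZMod 3) ≠ 0 ∧ (2 : ZMod 3) ≠ 1 := by decide
        simpa [f, h2] using hxy
      intro b c d hbc hbd hcd
      rcases h3 b with rfl | rfl | rfl <;> rcases h3 c with rfl | rfl | rfl <;>
        rcases h3 d with rfl | rfl | rfl <;>
        first
        | exact absurd rfl hbc
        | exact absurd rfl hbd
        | exact absurd rfl hcd
        | linear_combination e
    have hne : ∀ l l', l ≠ l' → (cubeClass ρ (a l)).1 = (cubeClass ρ (a l')).1 →
        (cubeClass ρ (a l)).2 ≠ (cubeClass ρ (a l')).2 :=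
      fun l l' hl h h' => hpair l l' hl (Prod.ext h h')
    refine ⟨fun l => if l = i ∨ l = j ∨ l = k then (f (cubeClass ρ (a l)).2 : ℤ_[p]) else 0,
      (cubeClass ρ (a i)).1, ?_, ⟨i, by simp⟩, fun l hl => ?_⟩
    · rw [← Finset.sum_subset (Finset.subset_univ {i, j, k})]
      · rw [Finset.sum_insert (by simp [hij, hik]), Finset.sum_insert (by simp [hjk]),
          Finset.sum_singleton]
        simp only [true_or, or_true, if_true]
        rw [← add_assoc]
        exact hsum _ _ _ (hne _ _ hij h1) (hne _ _ hik h2) (hne _ _ hjk (h1 ▸ h2))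
      · intro l _ hl
        simp only [Finset.mem_insert, Finset.mem_singleton] at hl
        simp [hl]
    · have hl' : l = i ∨ l = j ∨ l = k := by
        by_contra h
        simp [h] at hl
      simp only [if_pos hl', cubeClass_unit, hf]
      rcases hl' with rfl | rfl | rfl
      · ext <;> simp
      · ext <;> simp [h1]
      · ext <;> simp [h2]

/-- Cubing is bijective on `(ℤ/p)ˣ`, whose order is prime to three, so by Hensel every unit is a
cube and the trivial character may serve as `ρ`. The class is then the valuation modulo three, and
four coefficients cannot have distinct ones. -/
theorem diagonalCubic_nonempty_of_mod_three_eq_two (hp : p % 3 = 2) (a : Fin 4 → ℚ_[p]) :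
    (diagonalCubic a).Nonempty := by
  by_cases ha : ∀ i, a i ≠ 0
  swap
  · push Not at ha
    obtain ⟨i, hi⟩ := ha
    exact diagonalCubic_nonempty_of_eq_zero a hi
  have hρ : ∀ u, (1 : ℤ_[p]ˣ →* Multiplicative (ZMod 3)) u = 1 → ∃ z : ℤ_[p]ˣ, z ^ 3 = u := by
    intro u _
    have hcop : (Nat.card (ZMod p)ˣ).Coprime 3 := by
      rw [Nat.card_eq_fintype_card, ZMod.card_units p, Nat.coprime_comm,
        Nat.Prime.coprime_iff_not_dvd Nat.prime_three]
      omega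
    have hs : Function.Surjective (Units.map (PadicInt.toZMod (p := p)).toMonoidHom) := by
      have hφ := ZMod.ringHom_surjective (PadicInt.toZMod (p := p))
      have : IsLocalHom (PadicInt.toZMod (p := p)) := hφ.isLocalHom _
      exact IsLocalRing.surjective_units_map_of_local_ringHom _ hφ inferInstance
    obtain ⟨g, hg⟩ := (powCoprime hcop).surjective (Units.map (PadicInt.toZMod (p := p)) u)
    obtain ⟨w, rfl⟩ := hs g
    have hg : Units.map (PadicInt.toZMod (p := p)).toMonoidHom (u * (w ^ 3)⁻¹) = 1 := by
      rw [map_mul, map_inv, map_pow, mul_inv_eq_one]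
      exact hg.symm
    obtain ⟨z, hz⟩ := PadicInt.exists_pow_three_eq (by rintro rfl; simp at hp)
      ((u * (w ^ 3)⁻¹ : ℤ_[p]ˣ) : ℤ_[p]) (by
        rw [← PadicInt.mem_nonunits, ← IsLocalRing.mem_maximalIdeal, ← PadicInt.ker_toZMod,
          RingHom.mem_ker, map_sub, map_one, sub_eq_zero]
        exact congrArg Units.val hg)
    have hzu : IsUnit z := by
      refine isUnit_of_dvd_unit (dvd_pow_self z three_ne_zero) ?_
      rw [hz]; exact Units.isUnit _
    refine ⟨hzu.unit * w, ?_⟩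
    rw [mul_pow, ← eq_mul_inv_iff_mul_eq]
    ext
    rw [Units.val_pow_eq_pow_val, IsUnit.unit_spec, hz]
  obtain ⟨i, j, hij, h⟩ := Fintype.exists_ne_map_eq_of_card_lt
    (fun i => (cubeClass (1 : ℤ_[p]ˣ →* Multiplicative (ZMod 3)) (a i)).1) (by simp)
  refine diagonalCubic_nonempty_of_cubeClass_eq hρ a ha hij (Prod.ext h ?_)
  rw [cubeClass, cubeClass, dif_neg (ha i), dif_neg (ha j)]
  rfl

end Criteria

/-! ### The solubility criterion at three -/

/-- The elements with `a ^ 6 = 1` are the units. One choice of sign makes `a ± b` divisible by `3`;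
as `a ≠ ±b` it is then `±3` modulo `9`, and `3c` is `±3` for every unit `c`. -/
theorem ZMod.nine_exists_signs : ∀ a b c : ZMod 9, a ^ 6 = 1 → b ^ 6 = 1 → c ^ 6 = 1 →
    a ≠ b → a ≠ -b →
    ∃ e d : Bool, a + (if e then b else -b) + 3 * (if d then c else -c) = 0 := by decide +kernel

set_option synthInstance.maxHeartbeats 400000 in
set_option synthInstance.maxSize 2000 in
theorem ZMod.nine_relation_aux : ∀ a b c : ZMod 9,
    (a = 0 ∨ a ^ 6 = 1) → (b = 0 ∨ b ^ 6 = 1) → (c = 0 ∨ c ^ 6 = 1) →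
    (-(a + b + c) = 0 ∨ (-(a + b + c)) ^ 6 = 1) → ¬ (a = 0 ∧ b = 0 ∧ c = 0) →
    (a ≠ 0 ∧ (a = b ∨ a = -b)) ∨ (a ≠ 0 ∧ (a = c ∨ a = -c)) ∨ (b ≠ 0 ∧ (b = c ∨ b = -c)) ∨
    (a ≠ 0 ∧ (a = -(a + b + c) ∨ a = - -(a + b + c))) ∨
    (b ≠ 0 ∧ (b = -(a + b + c) ∨ b = - -(a + b + c))) ∨
    (c ≠ 0 ∧ (c = -(a + b + c) ∨ c = - -(a + b + c))) := by decide +kernel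

/-- Up to sign the units modulo `9` are `1, 2, 4`, so four units repeat by the pigeonhole principle.
Three units `±1, ±2, ±4` can only sum to a multiple of `3` as `±(1 - 2 + 4) = ±3`, which is not `0`
modulo `9`. Two units summing to zero are negatives of each other, and one alone cannot vanish. -/
theorem ZMod.nine_relation (s : Fin 4 → ZMod 9) (hs : ∑ i, s i = 0) (h : ∀ i, s i = 0 ∨ s i ^ 6 = 1)
    (h0 : ∃ i, s i ≠ 0) : ∃ i j, i ≠ j ∧ s i ≠ 0 ∧ (s i = s j ∨ s i = -s j) := by
  rw [Fin.sum_univ_four] at hs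
  have e : s 3 = -(s 0 + s 1 + s 2) := by linear_combination hs
  have := ZMod.nine_relation_aux (s 0) (s 1) (s 2) (h 0) (h 1) (h 2) (e ▸ h 3) (by
    rintro ⟨h1, h2, h3⟩
    obtain ⟨i, hi⟩ := h0
    have h4 : s 3 = 0 := by rw [e, h1, h2, h3]; simp
    fin_cases i
    · exact hi h1
    · exact hi h2
    · exact hi h3
    · exact hi h4)
  rw [← e] at this
  rcases this with h | h | h | h | h | h
  exacts [⟨0, 1, by decide, h⟩, ⟨0, 2, by decide, h⟩, ⟨1, 2, by decide, h⟩, ⟨0, 3, by decide, h⟩,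
    ⟨1, 3, by decide, h⟩, ⟨2, 3, by decide, h⟩]

/-- A primitive relation contains at least two units. If an entry has valuation exactly one, it
supplies the index `k` of the second alternative. Otherwise all entries are `0` or units modulo `9`,
and `ZMod.nine_relation` yields two that agree up to sign, hence in class. Conversely, if no two
classes agree, `ZMod.nine_exists_signs` gives a relation modulo `9`, which is then made exact. -/
theorem diagonalCubic_nonempty_iff_wildSoluble {ρ : ℤ_[3]ˣ →* Multiplicative (ZMod 3)}
    (hsurj : Function.Surjective ρ)
    (hρ : ∀ u, ρ u = 1 → ∃ z : ℤ_[3]ˣ, z ^ 3 = u)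
    (hmod : ∀ u v : ℤ_[3]ˣ, PadicInt.toZModPow 2 (u : ℤ_[3]) = PadicInt.toZModPow 2 (v : ℤ_[3]) →
      ρ u = ρ v)
    (a : Fin 4 → ℚ_[3]) (ha : ∀ i, a i ≠ 0) :
    (diagonalCubic a).Nonempty ↔ WildSoluble fun i => cubeClass ρ (a i) := by
  have hneg : ∀ u, ρ (-u) = ρ u := by
    intro u
    have := cubeClass_neg ρ (x := ((u : ℤ_[3]) : ℚ_[3])) (by simp)
    rw [← PadicInt.coe_neg, ← Units.val_neg, cubeClass_unit, cubeClass_unit] at this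
    exact Multiplicative.toAdd.injective (Prod.mk.inj this).2
  have : Nontrivial (ZMod 9) := ⟨0, 1, by decide⟩
  let φ : ℤ_[3] →+* ZMod 9 := PadicInt.toZModPow 2
  have hker : ∀ x, φ x = 0 ↔ (3 : ℤ_[3]) ^ 2 ∣ x := by
    intro x
    have := PadicInt.ker_toZModPow (p := 3) 2
    rw [← Ideal.mem_span_singleton]
    exact (SetLike.ext_iff.1 this x)
  have hmod : ∀ u v : ℤ_[3]ˣ, φ u = φ v → ρ u = ρ v := hmod
  have hnu : ∀ x : ℤ_[3], ¬ IsUnit x ↔ (3 : ℤ_[3]) ∣ x := fun x => by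
    rw [PadicInt.not_isUnit_iff, PadicInt.norm_lt_one_iff_dvd]; rfl
  have h6 : ∀ x : ZMod 9, IsUnit x → x ^ 6 = 1 := by
    rintro _ ⟨u, rfl⟩
    have := ZMod.pow_totient u
    rw [show Nat.totient 9 = 6 by decide] at this
    simpa using congrArg Units.val this
  have h36 : (3 : ℚ_[3]) ≠ 0 := by norm_num
  constructor
  · rw [diagonalCubic_nonempty_iff_exists_relation hρ a ha]
    rintro ⟨t, m, hs, ⟨i, hi⟩, ht⟩
    have hcl : ∀ l (h : IsUnit (t l)), cubeClass ρ (a l) = (m, (ρ h.unit).toAdd) := by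
      intro l h
      have := cubeClass_unit ρ h.unit
      rw [ht l h.ne_zero, show (t l : ℚ_[3]) = ((h.unit : ℤ_[3]) : ℚ_[3]) from rfl, this]
      simp
    obtain ⟨j, hij, hj⟩ : ∃ j, j ≠ i ∧ IsUnit (t j) := by
      by_contra! h
      have h1 : ∑ l ∈ Finset.univ.erase i, t l + t i = 0 := by
        rw [Finset.sum_erase_add _ _ (Finset.mem_univ i), hs]
      refine (hnu (t i)).2 ?_ hi
      rw [← (dvd_add_right (Finset.dvd_sum fun l hl => (hnu _).1 (h l (Finset.ne_of_mem_erase hl)))),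
        h1]
      exact dvd_zero _
    by_cases hk : ∃ k, ¬ IsUnit (t k) ∧ φ (t k) ≠ 0
    · obtain ⟨k, hk1, hk2⟩ := hk
      refine Or.inr ⟨i, j, k, hij.symm, by simp only [hcl i hi, hcl j hj], ?_⟩
      obtain ⟨w, hw⟩ := (hnu _).1 hk1
      have hwu : IsUnit w := by
        by_contra h
        refine hk2 ((hker _).2 ?_)
        rw [hw, pow_two]
        exact mul_dvd_mul_left 3 ((hnu w).1 h)
      have hk0 : t k ≠ 0 := by rintro h; rw [h, map_zero] at hk2; exact hk2 rfl
      have e : (t k : ℚ_[3]) = ((hwu.unit : ℤ_[3]) : ℚ_[3]) * ((3 : ℕ) : ℚ_[3]) ^ (1 : ℤ) := by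
        rw [hw, IsUnit.unit_spec, PadicInt.coe_mul, mul_comm, zpow_one]
        rfl
      simp only [hcl i hi, ht k hk0, e, cubeClass_unit_mul_zpow]
      simp [add_comm]
    · push Not at hk
      have hz : ∀ l, φ (t l) ≠ 0 → IsUnit (t l) := fun l hl => by
        by_contra h; exact hl (hk l h)
      obtain ⟨i', j', hij', hi', h⟩ := ZMod.nine_relation (fun l => φ (t l))
        (by rw [← map_sum, hs, map_zero]) (fun l => by
          by_cases h : IsUnit (t l)
          · exact Or.inr (h6 _ (h.map φ))
          · exact Or.inl (hk l h)) ⟨i, (hi.map φ).ne_zero⟩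
      have hj' : φ (t j') ≠ 0 := by
        rcases h with h | h
        · rwa [← h]
        · intro h0; rw [h, h0, neg_zero] at hi'; exact hi' rfl
      have hiu := hz _ hi'
      have hju := hz _ hj'
      refine Or.inl ⟨i', j', hij', ?_⟩
      simp only [hcl i' hiu, hcl j' hju, Prod.mk.injEq, true_and]
      rcases h with h | h
      · rw [hmod hiu.unit hju.unit h]
      · rw [hmod hiu.unit (-hju.unit) (by
          rw [Units.val_neg, map_neg]; exact h), hneg]
  · by_cases hpair : ∃ i j, i ≠ j ∧ cubeClass ρ (a i) = cubeClass ρ (a j)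
    · obtain ⟨i, j, hij, h⟩ := hpair
      exact fun _ => diagonalCubic_nonempty_of_cubeClass_eq hρ a ha hij h
    rintro (h | ⟨i, j, k, hij, h1, h2⟩)
    · exact absurd h hpair
    push Not at hpair
    have hki : k ≠ i := by
      rintro rfl; simp at h2
    have hkj : k ≠ j := by
      rintro rfl; rw [h1] at h2; simp at h2
    rw [diagonalCubic_nonempty_iff_exists_relation hρ a ha]
    choose g hg using fun z : ZMod 3 => hsurj (.ofAdd z)
    let u : Fin 4 → ℤ_[3]ˣ := fun l => g (cubeClass ρ (a l)).2
    have hu : ∀ l, (ρ (u l)).toAdd = (cubeClass ρ (a l)).2 := fun l => by simp [u, hg]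
    have hne : ρ (u i) ≠ ρ (u j) := by
      intro h
      refine hpair i j hij (Prod.ext h1 ?_)
      rw [← hu, ← hu, h]
    obtain ⟨e, d, hed⟩ := ZMod.nine_exists_signs (φ (u i)) (φ (u j)) (φ (u k))
      (h6 _ ((u i).isUnit.map φ)) (h6 _ ((u j).isUnit.map φ)) (h6 _ ((u k).isUnit.map φ))
      (fun h => hne (hmod _ _ h))
      (fun h => hne (by
        rw [← hneg (u j)]
        exact hmod _ _ (by rw [h, Units.val_neg, map_neg])))
    obtain ⟨v, hv1, hv2⟩ : ∃ v : ℤ_[3]ˣ, ρ v = ρ (u j) ∧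
        φ v = if e then φ (u j) else -φ (u j) := by
      cases e
      · exact ⟨-u j, hneg _, by simp⟩
      · exact ⟨u j, rfl, by simp⟩
    obtain ⟨w, hw1, hw2⟩ : ∃ w : ℤ_[3]ˣ, ρ w = ρ (u k) ∧
        φ w = if d then φ (u k) else -φ (u k) := by
      cases d
      · exact ⟨-u k, hneg _, by simp⟩
      · exact ⟨u k, rfl, by simp⟩
    rw [← hv2, ← hw2] at hed
    -- The relation holds only modulo `9`. Replacing `u i` by `-(v + 3w)` makes it exact without
    -- changing the class, because `ρ` depends only on the residue modulo `9`.
    have hx : φ (-(v + 3 * w)) = φ (u i) := by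
      rw [map_neg, map_add, map_mul]
      have : φ 3 = 3 := map_ofNat φ 3
      rw [this]
      linear_combination -hed
    have hxu : IsUnit (-((v : ℤ_[3]) + 3 * w)) := by
      by_contra h
      have h3 := (hnu _).1 h
      rw [dvd_neg, ← (dvd_add_left (a := (3 : ℤ_[3])) (Dvd.intro (w : ℤ_[3]) rfl))] at h3
      rw [add_assoc] at h3
      have h4 : (3 : ℤ_[3]) ∣ v := by
        have := dvd_sub h3 (Dvd.intro ((w : ℤ_[3]) + w) (by ring : (3 : ℤ_[3]) * (w + w) = 3 * w + 3 * w))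
        simpa using this
      exact (hnu _).2 h4 v.isUnit
    have hxρ : ρ hxu.unit = ρ (u i) := hmod _ _ hx
    refine ⟨fun l => if l = i then -((v : ℤ_[3]) + 3 * w) else if l = j then v else
      if l = k then 3 * w else 0, (cubeClass ρ (a i)).1, ?_, ⟨i, by simpa using hxu⟩,
      fun l hl => ?_⟩
    · rw [← Finset.sum_subset (Finset.subset_univ {i, j, k})]
      · rw [Finset.sum_insert (by simp [hij, hki.symm]), Finset.sum_insert (by simp [hkj.symm]),
          Finset.sum_singleton]
        simp only [if_true, if_neg hij.symm, if_neg hki, if_neg hkj]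
        ring
      · intro l _ hl
        simp only [Finset.mem_insert, Finset.mem_singleton, not_or] at hl
        simp [hl]
    · by_cases hli : l = i
      · subst hli
        simp only [if_true]
        rw [show -((v : ℤ_[3]) + 3 * w) = (hxu.unit : ℤ_[3]) from rfl, cubeClass_unit, hxρ, hu]
        ext <;> simp
      by_cases hlj : l = j
      · subst hlj
        simp only [if_true, if_neg hli]
        rw [cubeClass_unit, hv1, hu]
        ext <;> simp [h1]
      by_cases hlk : l = k
      · subst hlk
        simp only [if_true, if_neg hli, if_neg hlj]
        have e : ((3 * (w : ℤ_[3]) : ℤ_[3]) : ℚ_[3]) = (w : ℤ_[3]) * ((3 : ℕ) : ℚ_[3]) ^ (1 : ℤ) := by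
          rw [PadicInt.coe_mul, mul_comm, zpow_one]
          rfl
        rw [e, cubeClass_unit_mul_zpow, hw1, hu]
        ext
        · simp [h2, add_comm]
        · simp
      · simp [hli, hlj, hlk] at hl

/-! ### Haar measure on `ℤ_p` and `ℤ_p⁴` -/

section HaarScaling

variable {G : Type*} [AddCommGroup G] [TopologicalSpace G] [IsTopologicalAddGroup G]
  [CompactSpace G] [T2Space G] [SecondCountableTopology G] [MeasurableSpace G] [BorelSpace G]

/-- The pullback of `μ` along `ψ` is translation invariant, hence a multiple of `μ` by uniqueness of
Haar measure; the factor is read off on the whole group. Since `ψ` is a closed embedding, `A` need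
not be measurable. -/
theorem measure_image_of_injective_addMonoidHom (μ : Measure G) [μ.IsAddHaarMeasure]
    [IsProbabilityMeasure μ] (ψ : G →+ G) (hc : Continuous ψ) (hi : Function.Injective ψ)
    (A : Set G) : μ (ψ '' A) = μ (Set.range ψ) * μ A := by
  have he : MeasurableEmbedding ψ := (hc.isClosedEmbedding hi).measurableEmbedding
  have hinv : (μ.comap ψ).IsAddLeftInvariant := by
    refine ⟨fun g => Measure.ext fun s hs => ?_⟩
    rw [Measure.map_apply (measurable_const_add g) hs, he.comap_apply, he.comap_apply,
      ← measure_preimage_add μ (ψ g) (ψ '' s)]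
    congr 1
    ext x
    simp only [Set.mem_image, Set.mem_preimage]
    constructor
    · rintro ⟨y, hy, rfl⟩
      exact ⟨g + y, hy, map_add ψ g y⟩
    · rintro ⟨y, hy, hyx⟩
      refine ⟨y - g, by simpa using hy, ?_⟩
      rw [map_sub, hyx, add_sub_cancel_left]
  have hfin : IsFiniteMeasure (μ.comap ψ) := ⟨by
    rw [he.comap_apply]; exact measure_lt_top _ _⟩
  have h := Measure.isAddLeftInvariant_eq_smul (μ.comap ψ) μ
  have h1 := he.comap_apply μ A
  have h2 := he.comap_apply μ Set.univ
  rw [h, Measure.smul_apply] at h1 h2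
  rw [measure_univ, Set.image_univ] at h2
  rw [← h1, ← h2]
  simp [ENNReal.smul_def]

omit [CompactSpace G] [T2Space G] [SecondCountableTopology G] in
-- Each fibre is a translate of the kernel, whose index is the order of `H`.
theorem measure_preimage_singleton_of_surjective {H : Type*} [AddGroup H] [Finite H]
    (μ : Measure G) [μ.IsAddHaarMeasure] [IsProbabilityMeasure μ] (f : G →+ H)
    (hf : Function.Surjective f) (hm : MeasurableSet (f ⁻¹' {0})) (h : H) :
    μ (f ⁻¹' {h}) = (Nat.card H : ENNReal)⁻¹ := by
  obtain ⟨g, rfl⟩ := hf h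
  have h1 : f ⁻¹' {f g} = (fun x => -g + x) ⁻¹' (f ⁻¹' {0}) := by
    ext x
    simp only [Set.mem_preimage, Set.mem_singleton_iff, map_add, map_neg, neg_add_eq_zero]
    exact eq_comm
  rw [h1, measure_preimage_add]
  have hker : (f.ker : Set G) = f ⁻¹' {0} := rfl
  have hidx : f.ker.index = Nat.card H := by
    rw [AddSubgroup.index_ker, AddMonoidHom.range_eq_top.2 hf]
    exact Nat.card_congr (Equiv.Set.univ H)
  have : f.ker.FiniteIndex := ⟨by rw [hidx]; exact Nat.card_pos.ne'⟩
  have h2 := f.ker.index_mul_measure hm μ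
  rw [hidx, hker, measure_univ] at h2
  exact ENNReal.eq_inv_of_mul_eq_one_left (by rw [mul_comm]; exact h2)

end HaarScaling

section PadicHaar

variable {p : ℕ} [Fact p.Prime]

instance padicIntHaar_isAddHaarMeasure : (padicIntHaar p).IsAddHaarMeasure := by
  unfold padicIntHaar; infer_instance

instance padicIntHaar_isProbabilityMeasure : IsProbabilityMeasure (padicIntHaar p) :=
  ⟨by
    have := Measure.addHaarMeasure_self (K₀ := (⊤ : TopologicalSpace.PositiveCompacts ℤ_[p]))
    simpa [padicIntHaar] using this⟩

theorem PadicInt.continuous_toZModPow (k : ℕ) :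
    @Continuous _ _ _ ⊥ (PadicInt.toZModPow k : ℤ_[p] → ZMod (p ^ k)) := by
  let _ : TopologicalSpace (ZMod (p ^ k)) := ⊥
  have : DiscreteTopology (ZMod (p ^ k)) := ⟨rfl⟩
  refine IsLocallyConstant.continuous ((IsLocallyConstant.iff_exists_open _).2 fun x => ?_)
  refine ⟨Metric.ball x ((p : ℝ) ^ (-(k : ℤ) + 1)), Metric.isOpen_ball, ?_, fun y hy => ?_⟩
  · exact Metric.mem_ball_self (zpow_pos (by exact_mod_cast (Fact.out : p.Prime).pos) _)
  · rw [Metric.mem_ball, dist_eq_norm, ← PadicInt.norm_le_pow_iff_norm_lt_pow_add_one,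
      PadicInt.norm_le_pow_iff_mem_span_pow, ← PadicInt.ker_toZModPow, RingHom.mem_ker, map_sub,
      sub_eq_zero] at hy
    exact hy

theorem PadicInt.isClopen_preimage_toZModPow (k : ℕ) (s : Set (ZMod (p ^ k))) :
    IsClopen ((PadicInt.toZModPow k : ℤ_[p] → ZMod (p ^ k)) ⁻¹' s) := by
  let _ : TopologicalSpace (ZMod (p ^ k)) := ⊥
  have : DiscreteTopology (ZMod (p ^ k)) := ⟨rfl⟩
  exact (isClopen_discrete s).preimage (PadicInt.continuous_toZModPow k)

/-- Reduction modulo `p ^ k` of vectors of `p`-adic integers. -/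
noncomputable def PadicInt.vecToZModPow (p : ℕ) [Fact p.Prime] (k : ℕ) :
    (Fin 4 → ℤ_[p]) →+ (Fin 4 → ZMod (p ^ k)) where
  toFun a i := PadicInt.toZModPow k (a i)
  map_zero' := by ext; simp
  map_add' _ _ := by ext; simp

theorem PadicInt.vecToZModPow_surjective (k : ℕ) :
    Function.Surjective (PadicInt.vecToZModPow p k) := by
  intro r
  choose a ha using fun i => ZMod.ringHom_surjective (PadicInt.toZModPow (p := p) k) (r i)
  exact ⟨a, funext ha⟩

theorem PadicInt.isClopen_preimage_vecToZModPow (k : ℕ) (s : Set (Fin 4 → ZMod (p ^ k))) :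
    IsClopen (PadicInt.vecToZModPow p k ⁻¹' s) := by
  let _ : TopologicalSpace (ZMod (p ^ k)) := ⊥
  have : DiscreteTopology (ZMod (p ^ k)) := ⟨rfl⟩
  have : Continuous (PadicInt.vecToZModPow p k) := continuous_pi fun i =>
    (PadicInt.continuous_toZModPow k).comp (continuous_apply i)
  exact (isClopen_discrete s).preimage this

/-- The Haar probability measure on `ℤ_p⁴`. -/
noncomputable abbrev padicVecHaar (p : ℕ) [Fact p.Prime] : Measure (Fin 4 → ℤ_[p]) :=
  Measure.pi fun _ => padicIntHaar p

theorem padicVecHaar_preimage_singleton (k : ℕ) (r : Fin 4 → ZMod (p ^ k)) :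
    padicVecHaar p (PadicInt.vecToZModPow p k ⁻¹' {r}) = ((p : ENNReal) ^ (4 * k))⁻¹ := by
  have : NeZero (p ^ k) := ⟨pow_ne_zero _ (Fact.out : p.Prime).ne_zero⟩
  rw [measure_preimage_singleton_of_surjective _ _ (PadicInt.vecToZModPow_surjective k)
    (PadicInt.isClopen_preimage_vecToZModPow k {0}).isOpen.measurableSet]
  simp [pow_mul, pow_right_comm _ 4 k]

theorem PadicInt.range_p_mul : Set.range (fun x : ℤ_[p] => p * x) = {x | (p : ℤ_[p]) ∣ x} := by
  ext x
  exact ⟨fun ⟨y, hy⟩ => ⟨y, hy.symm⟩, fun ⟨y, hy⟩ => ⟨y, hy.symm⟩⟩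

theorem padicIntHaar_dvd : padicIntHaar p {x | (p : ℤ_[p]) ∣ x} = (p : ENNReal)⁻¹ := by
  have := measure_preimage_singleton_of_surjective (padicIntHaar p)
    (PadicInt.toZModPow (p := p) 1).toAddMonoidHom (ZMod.ringHom_surjective _)
    (PadicInt.isClopen_preimage_toZModPow 1 {0}).isOpen.measurableSet 0
  rw [Nat.card_zmod] at this
  refine Eq.trans ?_ (this.trans (by rw [pow_one]))
  congr 1
  ext x
  have h := SetLike.ext_iff.1 (PadicInt.ker_toZModPow (p := p) 1) x
  rw [Ideal.mem_span_singleton, pow_one (p : ℤ_[p])] at h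
  exact h.symm

theorem padicIntHaar_image_p_mul (A : Set ℤ_[p]) :
    padicIntHaar p ((fun x => p * x) '' A) = (p : ENNReal)⁻¹ * padicIntHaar p A := by
  have := measure_image_of_injective_addMonoidHom (padicIntHaar p)
    (AddMonoidHom.mulLeft (p : ℤ_[p])) (continuous_const_mul _)
    (mul_right_injective₀ (by exact_mod_cast (Fact.out : p.Prime).ne_zero)) A
  rw [← padicIntHaar_dvd, ← PadicInt.range_p_mul]
  exact this

theorem padicIntHaar_image_unit_mul (u : ℤ_[p]ˣ) (A : Set ℤ_[p]) :
    padicIntHaar p ((fun x => u * x) '' A) = padicIntHaar p A := by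
  have := measure_image_of_injective_addMonoidHom (padicIntHaar p)
    (AddMonoidHom.mulLeft (u : ℤ_[p])) (continuous_const_mul _)
    (mul_right_injective₀ u.ne_zero) A
  have hs : Set.range (AddMonoidHom.mulLeft (u : ℤ_[p])) = Set.univ :=
    Set.range_eq_univ.2 fun y => ⟨(u⁻¹ : ℤ_[p]ˣ) * y, by simp⟩
  rw [hs, measure_univ, one_mul] at this
  exact this

theorem padicVecHaar_dvd :
    padicVecHaar p {a | ∀ i, (p : ℤ_[p]) ∣ a i} = ((p : ENNReal) ^ 4)⁻¹ := by
  have : {a : Fin 4 → ℤ_[p] | ∀ i, (p : ℤ_[p]) ∣ a i} =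
      Set.univ.pi fun _ => {x | (p : ℤ_[p]) ∣ x} := by ext; simp
  rw [this, Measure.pi_pi]
  simp [padicIntHaar_dvd, ENNReal.inv_pow]

theorem padicVecHaar_image_p_smul (A : Set (Fin 4 → ℤ_[p])) :
    padicVecHaar p ((fun a => (p : ℤ_[p]) • a) '' A) =
      ((p : ENNReal) ^ 4)⁻¹ * padicVecHaar p A := by
  have hp : (p : ℤ_[p]) ≠ 0 := by exact_mod_cast (Fact.out : p.Prime).ne_zero
  have := measure_image_of_injective_addMonoidHom (padicVecHaar p)
    (DistribSMul.toAddMonoidHom (Fin 4 → ℤ_[p]) (p : ℤ_[p])) (continuous_const_smul _)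
    (fun a b h => funext fun i => mul_left_cancel₀ hp (congrFun h i)) A
  refine this.trans ?_
  rw [← padicVecHaar_dvd]
  congr 2
  ext a
  symm
  constructor
  · intro h
    choose b hb using h
    exact ⟨b, funext fun i => (hb i).symm⟩
  · rintro ⟨b, rfl⟩ i
    exact ⟨b i, rfl⟩

/-- Multiplication by `p` fixes the point `0` and scales measure by `1/p`, so its finite mass
vanishes. -/
theorem padicIntHaar_singleton_zero : padicIntHaar p {0} = 0 := by
  have h := padicIntHaar_image_p_mul (p := p) {0}
  rw [Set.image_singleton, mul_zero] at h
  by_contra h0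
  have h1 : (p : ENNReal)⁻¹ = 1 := by
    have h2 : padicIntHaar p {0} * (p : ENNReal)⁻¹ = padicIntHaar p {0} * 1 := by
      rw [mul_comm, mul_one]; exact h.symm
    exact (ENNReal.mul_right_inj h0 (measure_ne_top _ _)).1 h2
  rw [ENNReal.inv_eq_one] at h1
  exact (Fact.out : p.Prime).one_lt.ne' (by exact_mod_cast h1)

theorem padicVecHaar_exists_eq_zero : padicVecHaar p {a | ∃ i, a i = 0} = 0 := by
  have : {a : Fin 4 → ℤ_[p] | ∃ i, a i = 0} = ⋃ i, Function.eval i ⁻¹' {0} := by ext; simp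
  rw [this, measure_iUnion_null_iff]
  intro i
  exact (Measure.quasiMeasurePreserving_eval (fun _ : Fin 4 => padicIntHaar p)
    i).preimage_null padicIntHaar_singleton_zero

end PadicHaar

/-! ### Measures of the classes modulo cubes -/

section ClassMeasure

variable {p : ℕ} [Fact p.Prime]

/-- The nonzero `p`-adic integers in a given class modulo cubes. -/
def cubeClassSet (ρ : ℤ_[p]ˣ →* Multiplicative (ZMod 3)) (c : ZMod 3 × ZMod 3) : Set ℤ_[p] :=
  {x | x ≠ 0 ∧ cubeClass ρ (x : ℚ_[p]) = c}

variable {ρ : ℤ_[p]ˣ →* Multiplicative (ZMod 3)}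

theorem PadicInt.eventually_exists_eq_mul_pow_three {x : ℤ_[p]} (hx : x ≠ 0) :
    ∀ᶠ y : ℤ_[p] in 𝓝 x, ∃ c : ℚ_[p], c ≠ 0 ∧ (y : ℚ_[p]) = x * c ^ 3 := by
  have hpos : 0 < ‖x‖ * (p : ℝ) ^ (-2 : ℤ) :=
    mul_pos (norm_pos_iff.2 hx) (zpow_pos (by exact_mod_cast (Fact.out : p.Prime).pos) _)
  filter_upwards [Metric.ball_mem_nhds x hpos] with y hy
  refine Padic.exists_eq_mul_pow_three_of_norm_sub_le (PadicInt.coe_ne_zero.2 hx) ?_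
  rw [Metric.mem_ball, dist_eq_norm] at hy
  exact hy.le

theorem isOpen_cubeClassSet (c : ZMod 3 × ZMod 3) : IsOpen (cubeClassSet ρ c) := by
  rw [isOpen_iff_mem_nhds]
  rintro x ⟨hx, hc⟩
  filter_upwards [PadicInt.eventually_exists_eq_mul_pow_three hx] with y ⟨d, hd, hy⟩
  have hx' : (x : ℚ_[p]) ≠ 0 := PadicInt.coe_ne_zero.2 hx
  refine ⟨PadicInt.coe_ne_zero.1 (hy ▸ mul_ne_zero hx' (pow_ne_zero _ hd)), ?_⟩
  rw [cubeClass_eq_of_eq_mul_pow_three hx' hd hy, hc]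

theorem image_unit_mul_cubeClassSet (u : ℤ_[p]ˣ) (c : ZMod 3 × ZMod 3) :
    (fun x : ℤ_[p] => u * x) '' cubeClassSet ρ c = cubeClassSet ρ (c + (0, (ρ u).toAdd)) := by
  have key : ∀ x : ℤ_[p], x ≠ 0 → cubeClass ρ ((u * x : ℤ_[p]) : ℚ_[p]) =
      cubeClass ρ (x : ℚ_[p]) + (0, (ρ u).toAdd) := fun x hx => by
    rw [PadicInt.coe_mul, cubeClass_mul ρ (by simp) (PadicInt.coe_ne_zero.2 hx), cubeClass_unit,
      add_comm]
  ext y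
  constructor
  · rintro ⟨x, ⟨hx, rfl⟩, rfl⟩
    exact ⟨mul_ne_zero u.ne_zero hx, key x hx⟩
  · rintro ⟨hy, hc⟩
    have hx : ((u⁻¹ : ℤ_[p]ˣ) : ℤ_[p]) * y ≠ 0 := mul_ne_zero (Units.ne_zero _) hy
    refine ⟨(u⁻¹ : ℤ_[p]ˣ) * y, ⟨hx, ?_⟩, by simp⟩
    have := key _ hx
    rw [Units.mul_inv_cancel_left, hc] at this
    exact (add_right_cancel this).symm

/-- The hypothesis excludes valuation class `2`: its image would have to fill class `0`, which
contains units. -/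
theorem image_p_mul_cubeClassSet (c : ZMod 3 × ZMod 3) (h : c.1 + 1 ≠ 0) :
    (fun x => (p : ℤ_[p]) * x) '' cubeClassSet ρ c = cubeClassSet ρ (c + (1, 0)) := by
  have hp : (p : ℤ_[p]) ≠ 0 := by exact_mod_cast (Fact.out : p.Prime).ne_zero
  have hcp : cubeClass ρ ((p : ℤ_[p]) : ℚ_[p]) = (1, 0) := by
    simpa using cubeClass_zpow ρ (p := p) 1
  have key : ∀ x : ℤ_[p], x ≠ 0 → cubeClass ρ ((p * x : ℤ_[p]) : ℚ_[p]) =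
      cubeClass ρ (x : ℚ_[p]) + (1, 0) := fun x hx => by
    rw [PadicInt.coe_mul, cubeClass_mul ρ (PadicInt.coe_ne_zero.2 hp) (PadicInt.coe_ne_zero.2 hx),
      hcp, add_comm]
  ext y
  constructor
  · rintro ⟨x, ⟨hx, rfl⟩, rfl⟩
    exact ⟨mul_ne_zero hp hx, key x hx⟩
  · rintro ⟨hy, hc⟩
    have hnu : ¬ IsUnit y := by
      rintro hu
      have := cubeClass_unit ρ hu.unit
      rw [IsUnit.unit_spec, hc] at this
      exact h (congrArg Prod.fst this)
    rw [PadicInt.not_isUnit_iff, PadicInt.norm_lt_one_iff_dvd] at hnu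
    obtain ⟨x, rfl⟩ := hnu
    have hx : x ≠ 0 := right_ne_zero_of_mul hy
    refine ⟨x, ⟨hx, ?_⟩, rfl⟩
    have := key x hx
    rw [hc] at this
    exact (add_right_cancel this).symm

/-- Multiplication by units permutes the values of `ρ` and preserves measure; multiplication by `p`
carries valuation class `0` to `1` and `1` to `2`, scaling by `1/p`. The nine classes exhaust `ℤ_p`
up to the null set `{0}`, which fixes the constant. -/
theorem padicIntHaar_real_cubeClassSet (hρ : Function.Surjective ρ) (c : ZMod 3 × ZMod 3) :
    (padicIntHaar p).real (cubeClassSet ρ c) =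
      (1 / (p : ℝ)) ^ c.1.val / (3 * (1 + 1 / (p : ℝ) + 1 / (p : ℝ) ^ 2)) := by
  set w : ZMod 3 × ZMod 3 → ℝ := fun c => (padicIntHaar p).real (cubeClassSet ρ c) with hw
  have hp0 : (0 : ℝ) < p := by exact_mod_cast (Fact.out : p.Prime).pos
  have h1 : ∀ r s, w (r, s) = w (r, 0) := by
    intro r s
    obtain ⟨u, hu⟩ := hρ (.ofAdd s)
    have := image_unit_mul_cubeClassSet (ρ := ρ) u (r, 0)
    simp only [hw, Measure.real]
    rw [← padicIntHaar_image_unit_mul u (cubeClassSet ρ (r, 0)), this, hu]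
    simp
  have h2 : ∀ r, r + 1 ≠ 0 → w (r + 1, 0) = 1 / p * w (r, 0) := by
    intro r hr
    have := image_p_mul_cubeClassSet (ρ := ρ) (r, 0) hr
    simp only [hw, Measure.real]
    rw [show ((r + 1, 0) : ZMod 3 × ZMod 3) = (r, 0) + (1, 0) by simp, ← this,
      padicIntHaar_image_p_mul, ENNReal.toReal_mul]
    simp
  have hsum : ∑ c, w c = 1 := by
    have hU : (⋃ c, cubeClassSet ρ c) = {0}ᶜ := by
      ext x
      simp [cubeClassSet]
    have h0 : (padicIntHaar p).real {0}ᶜ = 1 := by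
      rw [measureReal_compl (measurableSet_singleton 0)]
      simp [Measure.real, padicIntHaar_singleton_zero]
    rw [← h0, ← hU, measureReal_iUnion_fintype]
    · intro c d hcd
      rw [Function.onFun, Set.disjoint_left]
      rintro x ⟨-, h⟩ ⟨-, h'⟩
      exact hcd (h.symm.trans h')
    · exact fun c => (isOpen_cubeClassSet c).measurableSet
  have h3 : w (1, 0) = 1 / p * w (0, 0) := by simpa using h2 0 (by decide)
  have h4 : w (2, 0) = 1 / p * w (1, 0) := by
    have := h2 1 (by decide)
    rwa [show (1 : ZMod 3) + 1 = 2 by decide] at this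
  have hs : 3 * (w (0, 0) + w (1, 0) + w (2, 0)) = 1 := by
    rw [← hsum, Fintype.sum_prod_type]
    simp only [h1, Finset.sum_const, Finset.card_univ, ZMod.card]
    have hz : ∑ i : ZMod 3, w (i, 0) = w (0, 0) + w (1, 0) + w (2, 0) := Fin.sum_univ_three _
    rw [← Finset.smul_sum, hz, nsmul_eq_mul, Nat.cast_ofNat]
  have h00 : w (0, 0) = 1 / (3 * (1 + 1 / (p : ℝ) + 1 / (p : ℝ) ^ 2)) := by
    rw [h4, h3] at hs
    rw [eq_div_iff (by positivity)]
    linear_combination hs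
  change w c = _
  obtain ⟨r, s⟩ := c
  rw [h1]
  have hr : r = 0 ∨ r = 1 ∨ r = 2 := by revert r; decide
  rcases hr with rfl | rfl | rfl
  · rw [h00]; simp
  · rw [h3, h00, show ((1 : ZMod 3), s).1.val = 1 from rfl, pow_one]; ring
  · rw [h4, h3, h00, show ((2 : ZMod 3), s).1.val = 2 from rfl]; ring

/-- The coefficient vectors in `ℤ_p⁴` whose diagonal cubic surface has a `p`-adic point. -/
def solubleSet (p : ℕ) [Fact p.Prime] : Set (Fin 4 → ℤ_[p]) :=
  {a | (diagonalCubic fun i => (a i : ℚ_[p])).Nonempty}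

theorem padicDensity_eq : padicDensity p = (padicVecHaar p).real (solubleSet p) := by
  unfold padicDensity
  refine measureReal_congr ?_
  have h : ∀ᵐ a ∂padicVecHaar p, ¬ ∃ i, a i = 0 :=
    measure_eq_zero_iff_ae_notMem.1 padicVecHaar_exists_eq_zero
  filter_upwards [h] with a ha
  refine propext ⟨fun h => h.2, fun h => ⟨?_, h⟩⟩
  rintro rfl
  exact ha ⟨0, rfl⟩

open Classical in
theorem padicDensity_eq_sum (hρ : Function.Surjective ρ) (S : (Fin 4 → ZMod 3 × ZMod 3) → Prop)
    (hS : ∀ a : Fin 4 → ℚ_[p], (∀ i, a i ≠ 0) →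
      ((diagonalCubic a).Nonempty ↔ S fun i => cubeClass ρ (a i))) :
    padicDensity p = (∑ c with S c, (1 / (p : ℝ)) ^ (∑ i, (c i).1.val)) /
      (3 * (1 + 1 / (p : ℝ) + 1 / (p : ℝ) ^ 2)) ^ 4 := by
  rw [padicDensity_eq]
  let U : (Fin 4 → ZMod 3 × ZMod 3) → Set (Fin 4 → ℤ_[p]) :=
    fun c => Set.univ.pi fun i => cubeClassSet ρ (c i)
  have hU : ∀ c, (padicVecHaar p).real (U c) =
      (1 / (p : ℝ)) ^ (∑ i, (c i).1.val) / (3 * (1 + 1 / (p : ℝ) + 1 / (p : ℝ) ^ 2)) ^ 4 := by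
    intro c
    rw [Measure.real, Measure.pi_pi, ENNReal.toReal_prod]
    change ∏ i, (padicIntHaar p).real (cubeClassSet ρ (c i)) = _
    rw [Finset.prod_congr rfl fun i _ => padicIntHaar_real_cubeClassSet hρ (c i),
      Finset.prod_div_distrib, Finset.prod_pow_eq_pow_sum]
    simp
  have hae : (padicVecHaar p).real (solubleSet p) =
      (padicVecHaar p).real (⋃ c ∈ Finset.univ.filter S, U c) := by
    refine measureReal_congr ?_
    have h : ∀ᵐ a ∂padicVecHaar p, ¬ ∃ i, a i = 0 :=
      measure_eq_zero_iff_ae_notMem.1 padicVecHaar_exists_eq_zero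
    filter_upwards [h] with a ha
    push Not at ha
    have := hS (fun i => (a i : ℚ_[p])) fun i => PadicInt.coe_ne_zero.2 (ha i)
    refine propext (this.trans ?_)
    change _ ↔ a ∈ ⋃ c ∈ Finset.univ.filter S, U c
    simp only [Set.mem_iUnion, Finset.mem_filter, Finset.mem_univ, true_and, U, Set.mem_pi,
      Set.mem_univ, forall_true_left, exists_prop]
    constructor
    · intro h
      exact ⟨_, h, fun i => ⟨ha i, rfl⟩⟩
    · rintro ⟨c, hc, h⟩
      convert hc using 2 with i
      exact (h i).2
  rw [hae, measureReal_biUnion_finset, Finset.sum_congr rfl fun c _ => hU c, Finset.sum_div]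
  · intro c _ d _ hcd
    rw [Function.onFun, Set.disjoint_left]
    intro a h h'
    exact hcd (funext fun i => (h i trivial).2.symm.trans (h' i trivial).2)
  · exact fun c _ => MeasurableSet.univ_pi fun i => (isOpen_cubeClassSet _).measurableSet

theorem padicDensity_of_mod_three_eq_two (hp : p % 3 = 2) : padicDensity p = 1 := by
  rw [padicDensity_eq]
  have : solubleSet p = Set.univ :=
    Set.eq_univ_of_forall fun a => diagonalCubic_nonempty_of_mod_three_eq_two hp _
  rw [this, probReal_univ]

end ClassMeasure

/-! ### Counting insoluble quadruples and the local densities -/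

/-- Four classes modulo cubes fail `SplitSoluble`. -/
def splitInsoluble (a b c d : ZMod 3 × ZMod 3) : Bool :=
  a ≠ b && a ≠ c && a ≠ d && b ≠ c && b ≠ d && c ≠ d &&
    !(a.1 = b.1 && a.1 = c.1) && !(a.1 = b.1 && a.1 = d.1) && !(a.1 = c.1 && a.1 = d.1) &&
    !(b.1 = c.1 && b.1 = d.1)

/-- Four classes modulo cubes fail `WildSoluble`. -/
def wildInsoluble (a b c d : ZMod 3 × ZMod 3) : Bool :=
  let f := fun x y z w : ZMod 3 => x = y && (z = x + 1 || w = x + 1)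
  a ≠ b && a ≠ c && a ≠ d && b ≠ c && b ≠ d && c ≠ d &&
    !(f a.1 b.1 c.1 d.1) && !(f a.1 c.1 b.1 d.1) && !(f a.1 d.1 b.1 c.1) &&
    !(f b.1 c.1 a.1 d.1) && !(f b.1 d.1 a.1 c.1) && !(f c.1 d.1 a.1 b.1)

theorem splitInsoluble_iff (c : Fin 4 → ZMod 3 × ZMod 3) :
    splitInsoluble (c 0) (c 1) (c 2) (c 3) = true ↔ ¬ SplitSoluble c := by
  unfold SplitSoluble
  push Not
  constructor
  · intro h
    simp only [splitInsoluble, Bool.and_eq_true, decide_eq_true_eq, Bool.not_eq_true',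
      Bool.and_eq_false_imp, decide_eq_false_iff_not, ne_eq] at h
    constructor
    · intro i j hij
      fin_cases i <;> fin_cases j <;> first | exact absurd rfl hij | grind
    · intro i j k hij hik hjk
      fin_cases i <;> fin_cases j <;> first | exact absurd rfl hij |
        fin_cases k <;> first | exact absurd rfl hik | exact absurd rfl hjk | grind
  · rintro ⟨h1, h2⟩
    simp only [splitInsoluble, Bool.and_eq_true, decide_eq_true_eq, Bool.not_eq_true',
      Bool.and_eq_false_imp, decide_eq_false_iff_not]
    refine ⟨⟨⟨⟨⟨⟨⟨⟨⟨?_, ?_⟩, ?_⟩, ?_⟩, ?_⟩, ?_⟩, ?_⟩, ?_⟩, ?_⟩, ?_⟩ <;>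
    first | exact h1 _ _ (by decide) | exact h2 _ _ _ (by decide) (by decide) (by decide)

theorem wildInsoluble_iff (c : Fin 4 → ZMod 3 × ZMod 3) :
    wildInsoluble (c 0) (c 1) (c 2) (c 3) = true ↔ ¬ WildSoluble c := by
  have h3 : ∀ z : ZMod 3, z ≠ z + 1 := by decide
  unfold WildSoluble
  push Not
  constructor
  · intro h
    simp only [wildInsoluble, Bool.and_eq_true, decide_eq_true_eq, Bool.not_eq_true',
      Bool.and_eq_false_imp, decide_eq_false_iff_not, ne_eq, Bool.or_eq_false_iff] at h
    constructor
    · intro i j hij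
      fin_cases i <;> fin_cases j <;> first | exact absurd rfl hij | grind
    · intro i j k hij
      fin_cases i <;> fin_cases j <;> first | exact absurd rfl hij |
        fin_cases k <;> grind
  · rintro ⟨h1, h2⟩
    simp only [wildInsoluble, Bool.and_eq_true, decide_eq_true_eq, Bool.not_eq_true',
      Bool.and_eq_false_imp, decide_eq_false_iff_not, Bool.or_eq_false_iff]
    refine ⟨⟨⟨⟨⟨⟨⟨⟨⟨⟨⟨?_, ?_⟩, ?_⟩, ?_⟩, ?_⟩, ?_⟩, ?_⟩, ?_⟩, ?_⟩, ?_⟩, ?_⟩, ?_⟩ <;>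
    first | exact h1 _ _ (by decide) |
      exact fun h => ⟨h2 _ _ _ (by decide) h, h2 _ _ _ (by decide) h⟩

/-- The number of quadruples of classes satisfying `B` with given sum of the valuations. -/
def insolubleCount (B : ZMod 3 × ZMod 3 → ZMod 3 × ZMod 3 → ZMod 3 × ZMod 3 → ZMod 3 × ZMod 3 → Bool)
    (m : ℕ) : ℕ :=
  ∑ a : ZMod 3 × ZMod 3, ∑ b : ZMod 3 × ZMod 3, ∑ c : ZMod 3 × ZMod 3, ∑ d : ZMod 3 × ZMod 3,
    bif B a b c d && (a.1.val + (b.1.val + (c.1.val + d.1.val))).beq m then 1 else 0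

/-- The four classes are distinct and no valuation occurs three times. The pattern `r, r, s, s`
occurs `6 · 6 · 6 = 216` times, in degree `2r + 2s`; the pattern `r, r, s, t` occurs `12 · 6 · 9 =
648` times, in degree `r + 3`. -/
theorem insolubleCount_split : ∀ m : Fin 9, insolubleCount splitInsoluble m =
    ![0, 0, 216, 648, 864, 648, 216, 0, 0] m := by decide +kernel

/-- Only the pattern `r, r, r, r - 1` survives: every other pattern with distinct classes has a
repeated valuation whose successor modulo three occurs too. It arises `4 · 6 · 3 = 72` times for
each `r`, in degrees `2, 3, 7`. -/
theorem insolubleCount_wild : ∀ m : Fin 9, insolubleCount wildInsoluble m =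
    ![0, 0, 72, 72, 0, 0, 0, 72, 0] m := by decide +kernel

/-- Functions on `Fin 4` as nested pairs. -/
def finFourArrowEquiv (α : Type*) : (Fin 4 → α) ≃ α × α × α × α where
  toFun c := (c 0, c 1, c 2, c 3)
  invFun z := ![z.1, z.2.1, z.2.2.1, z.2.2.2]
  left_inv c := by ext i; fin_cases i <;> rfl
  right_inv _ := rfl

open Classical in
theorem sum_pow_eq_sub_insolubleCount (S : (Fin 4 → ZMod 3 × ZMod 3) → Prop)
    (B : ZMod 3 × ZMod 3 → ZMod 3 × ZMod 3 → ZMod 3 × ZMod 3 → ZMod 3 × ZMod 3 → Bool)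
    (hB : ∀ c, B (c 0) (c 1) (c 2) (c 3) = true ↔ ¬ S c) (t : ℝ) :
    ∑ c with S c, t ^ (∑ i, (c i).1.val) = (3 * (1 + t + t ^ 2)) ^ 4 -
      ∑ m : Fin 9, (insolubleCount B m : ℝ) * t ^ (m : ℕ) := by
  have hall : ∑ c : Fin 4 → ZMod 3 × ZMod 3, t ^ (∑ i, (c i).1.val) =
      (3 * (1 + t + t ^ 2)) ^ 4 := by
    have h1 : ∑ z : ZMod 3 × ZMod 3, t ^ z.1.val = 3 * (1 + t + t ^ 2) := by
      have hz : ∑ i : ZMod 3, t ^ i.val = t ^ 0 + t ^ 1 + t ^ 2 := Fin.sum_univ_three _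
      rw [Fintype.sum_prod_type]
      simp only [Finset.sum_const, Finset.card_univ, ZMod.card, nsmul_eq_mul, Nat.cast_ofNat]
      rw [← Finset.mul_sum, hz]
      ring
    simp only [← Finset.prod_pow_eq_pow_sum]
    have h2 := Finset.prod_univ_sum (fun _ : Fin 4 => (Finset.univ : Finset (ZMod 3 × ZMod 3)))
      (fun _ z => t ^ z.1.val)
    rw [Fintype.piFinset_univ] at h2
    rw [← h2, h1]
    simp
  have hbad : ∑ c : Fin 4 → ZMod 3 × ZMod 3 with ¬ S c, t ^ (∑ i, (c i).1.val) =
      ∑ m : Fin 9, (insolubleCount B m : ℝ) * t ^ (m : ℕ) := by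
    rw [Finset.sum_filter]
    simp only [← hB, Fin.sum_univ_four]
    refine (Fintype.sum_equiv (finFourArrowEquiv (ZMod 3 × ZMod 3)) _ (fun z =>
      if B z.1 z.2.1 z.2.2.1 z.2.2.2 = true then
        t ^ (z.1.1.val + z.2.1.1.val + z.2.2.1.1.val + z.2.2.2.1.val) else 0)
      fun c => if_congr Iff.rfl rfl rfl).trans ?_
    simp only [Fintype.sum_prod_type (α₁ := ZMod 3 × ZMod 3), insolubleCount, Nat.cast_sum,
      Finset.sum_mul]
    symm
    -- The sum over `m` is moved past the four classes; for a fixed quadruple only its own degree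
    -- `s` contributes.
    rw [Finset.sum_comm]
    refine Finset.sum_congr rfl fun a _ => ?_
    rw [Finset.sum_comm]
    refine Finset.sum_congr rfl fun b _ => ?_
    rw [Finset.sum_comm]
    refine Finset.sum_congr rfl fun c _ => ?_
    rw [Finset.sum_comm]
    refine Finset.sum_congr rfl fun d _ => ?_
    set s := a.1.val + b.1.val + c.1.val + d.1.val with hs
    have hs9 : s < 9 := by
      have := ZMod.val_lt a.1
      have := ZMod.val_lt b.1
      have := ZMod.val_lt c.1
      have := ZMod.val_lt d.1
      omega
    rw [Finset.sum_eq_single (⟨s, hs9⟩ : Fin 9)]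
    · have : (a.1.val + (b.1.val + (c.1.val + d.1.val))).beq s = true :=
        Nat.beq_eq ▸ (by omega)
      cases hBv : B a b c d <;> simp [this]
    · intro m _ hm
      have : (a.1.val + (b.1.val + (c.1.val + d.1.val))).beq m = false := by
        by_contra h
        rw [Bool.not_eq_false, Nat.beq_eq] at h
        exact hm (Fin.ext (by simp only; omega))
      simp [this]
    · simp
  rw [← hbad, ← hall, eq_sub_iff_add_eq]
  exact Finset.sum_filter_add_sum_filter_not _ _ _

theorem padicDensity_of_mod_three_eq_one {p : ℕ} [Fact p.Prime] (hp : p % 3 = 1) :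
    padicDensity p =
      (1 - 1 / (p : ℝ)) ^ 3 / (1 - 1 / (p : ℝ) ^ 3) ^ 3
        * (1 - 1 / (p : ℝ) + 1 / (p : ℝ) ^ 2)
        * (1 + 1 / (p : ℝ) + 1 / (3 * (p : ℝ) ^ 2))
        * (1 + 3 / (p : ℝ) + 3 / (p : ℝ) ^ 2) := by
  obtain ⟨ρ, hs, hk, hm, hr⟩ := PadicInt.exists_cubic_character_of_mod_three_eq_one hp
  rw [padicDensity_eq_sum hs SplitSoluble fun a ha =>
    diagonalCubic_nonempty_iff_splitSoluble hk hm hr a ha,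
    sum_pow_eq_sub_insolubleCount _ _ splitInsoluble_iff]
  simp only [insolubleCount_split]
  have hp1 : (1 : ℝ) < p := by exact_mod_cast (Fact.out : p.Prime).one_lt
  have e1 : ∀ n : ℕ, 1 / (p : ℝ) ^ n = (1 / p) ^ n := fun n => by rw [one_div_pow]
  have e2 : 1 / (3 * (p : ℝ) ^ 2) = (1 / p) ^ 2 / 3 := by rw [one_div_pow]; field_simp
  have e3 : 3 / (p : ℝ) = 3 * (1 / p) := by ring
  have e4 : 3 / (p : ℝ) ^ 2 = 3 * (1 / p) ^ 2 := by rw [one_div_pow]; ring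
  rw [e2, e3, e4, e1, e1]
  have ht0 : 0 < 1 / (p : ℝ) := by positivity
  have ht1 : 1 / (p : ℝ) < 1 := by rw [div_lt_one (by linarith)]; exact hp1
  generalize 1 / (p : ℝ) = t at ht0 ht1
  have hne : 1 - t ≠ 0 := by linarith
  have hne2 : 1 + t + t ^ 2 ≠ 0 := by positivity
  rw [show 1 - t ^ 3 = (1 - t) * (1 + t + t ^ 2) by ring]
  simp [Fin.sum_univ_succ]
  field_simp
  ring

theorem padicDensity_three :
    padicDensity 3 =
      (1 - 1 / (3 : ℝ)) ^ 3 / (1 - 1 / (3 : ℝ) ^ 3) ^ 3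
        * (1 + 3 / (3 : ℝ) + 46 / (9 * (3 : ℝ) ^ 2) + 7 / (3 : ℝ) ^ 3
          + 62 / (9 * (3 : ℝ) ^ 4) + 19 / (9 * (3 : ℝ) ^ 5) + 1 / (3 : ℝ) ^ 6) := by
  obtain ⟨ρ, hs, hk, hm⟩ := PadicInt.exists_cubic_character_three
  rw [padicDensity_eq_sum hs WildSoluble fun a ha =>
    diagonalCubic_nonempty_iff_wildSoluble hs hk hm a ha,
    sum_pow_eq_sub_insolubleCount _ _ wildInsoluble_iff]
  simp only [insolubleCount_wild]
  simp [Fin.sum_univ_succ]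
  norm_num

/-! ### The real place -/

theorem exists_real_pow_three_eq (y : ℝ) : ∃ c : ℝ, c ^ 3 = y := by
  rcases le_total 0 y with h | h
  · exact ⟨_, Real.rpow_inv_natCast_pow h three_ne_zero⟩
  · obtain ⟨c, hc⟩ : ∃ c : ℝ, c ^ 3 = -y :=
      ⟨_, Real.rpow_inv_natCast_pow (by linarith) three_ne_zero⟩
    exact ⟨-c, by rw [Odd.neg_pow (by decide), hc, neg_neg]⟩

theorem diagonalCubic_real_nonempty (a : Fin 4 → ℝ) : (diagonalCubic a).Nonempty := by
  by_cases h0 : a 0 = 0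
  · exact diagonalCubic_nonempty_of_eq_zero a h0
  obtain ⟨c, hc⟩ := exists_real_pow_three_eq (a 1 / a 0)
  refine diagonalCubic_nonempty_of_eq_mul_pow_three a (i := 0) (j := 1) (by decide) c ?_
  rw [hc]; field_simp

theorem realDensity_eq_one : realDensity = 1 := by
  have h1 : (volume : Measure (Fin 4 → ℝ)).real
      {a | (a ≠ 0 ∧ (diagonalCubic a).Nonempty) ∧ ∀ i, |a i| ≤ 1} =
      (volume : Measure (Fin 4 → ℝ)).real (Set.Icc (fun _ => -1) fun _ => 1) := by
    refine measureReal_congr ?_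
    have h0 : ∀ᵐ a : Fin 4 → ℝ, a ∉ ({0} : Set (Fin 4 → ℝ)) :=
      measure_eq_zero_iff_ae_notMem.1 (measure_singleton _)
    filter_upwards [h0] with a ha
    refine propext ⟨fun ⟨_, h⟩ => ⟨fun i => (abs_le.1 (h i)).1, fun i => (abs_le.1 (h i)).2⟩,
      fun ⟨h2, h3⟩ => ⟨⟨ha, diagonalCubic_real_nonempty a⟩, fun i => abs_le.2 ⟨h2 i, h3 i⟩⟩⟩
  rw [realDensity, h1, Measure.real, Real.volume_Icc_pi_toReal (fun _ => by norm_num)]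
  norm_num

/-! ### Box densities of congruence conditions -/

/-- A two-parameter squeeze: for fixed `k` the bounds may stay apart as `N` grows, and only their
limits close up as `k` does. -/
theorem tendsto_of_forall_le_of_le {f : ℕ → ℝ} {l u : ℕ → ℕ → ℝ} {L U : ℕ → ℝ} {x : ℝ}
    (hl : ∀ k N, l k N ≤ f N) (hu : ∀ k N, f N ≤ u k N)
    (hl' : ∀ k, Tendsto (l k) atTop (𝓝 (L k))) (hu' : ∀ k, Tendsto (u k) atTop (𝓝 (U k)))
    (hL : Tendsto L atTop (𝓝 x)) (hU : Tendsto U atTop (𝓝 x)) : Tendsto f atTop (𝓝 x) := by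
  rw [tendsto_order]
  constructor
  · intro a ha
    obtain ⟨k, hk⟩ := (hL.eventually_const_lt ha).exists
    filter_upwards [(hl' k).eventually_const_lt hk] with N hN
    exact hN.trans_le (hl k N)
  · intro a ha
    obtain ⟨k, hk⟩ := (hU.eventually_lt_const ha).exists
    filter_upwards [(hu' k).eventually_lt_const hk] with N hN
    exact (hu k N).trans_lt hN

/-- The integer vectors of length four with entries of absolute value at most `N`. -/
noncomputable def intBox (N : ℕ) : Finset (Fin 4 → ℤ) := Fintype.piFinset fun _ => Finset.Icc (-N : ℤ) N

theorem mem_intBox {N : ℕ} {a : Fin 4 → ℤ} : a ∈ intBox N ↔ ∀ i, |a i| ≤ N := by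
  simp [intBox, abs_le]

open Classical in
/-- The proportion of the integer vectors in a box that lie in a given set. -/
noncomputable def boxDensity (A : Set (Fin 4 → ℤ)) (N : ℕ) : ℝ :=
  ((intBox N).filter (· ∈ A)).card / (2 * N + 1) ^ 4

theorem boxDensity_mono {A B : Set (Fin 4 → ℤ)} (h : A ⊆ B) (N : ℕ) :
    boxDensity A N ≤ boxDensity B N := by
  classical
  unfold boxDensity
  gcongr

theorem abs_card_Icc_filter_sub_le (Q : ℕ) [NeZero Q] (r : ZMod Q) (N : ℕ) :
    |(((Finset.Icc (-N : ℤ) N).filter fun n : ℤ => (n : ZMod Q) = r).card : ℝ) -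
      (2 * N + 1) / Q| ≤ 1 := by
  have hQ : (0 : ℤ) < Q := by exact_mod_cast (NeZero.pos Q)
  have h := Int.Ioc_filter_modEq_card (-N - 1) N hQ r.val
  have e : (Finset.Icc (-N : ℤ) N).filter (fun n : ℤ => (n : ZMod Q) = r) =
      (Finset.Ioc (-N - 1 : ℤ) N).filter fun n => n ≡ r.val [ZMOD Q] := by
    ext n
    simp only [Finset.mem_filter, Finset.mem_Icc, Finset.mem_Ioc,
      ← ZMod.intCast_eq_intCast_iff, Int.cast_natCast, ZMod.natCast_zmod_val]
    constructor <;> rintro ⟨⟨h1, h2⟩, h3⟩ <;> exact ⟨⟨by omega, h2⟩, h3⟩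
  rw [← e] at h
  set c := ((Finset.Icc (-N : ℤ) N).filter fun n : ℤ => (n : ZMod Q) = r).card
  have hQ' : (0 : ℚ) < Q := by exact_mod_cast hQ
  have h1 := Int.floor_le (((N : ℤ) - (r.val : ℤ) : ℚ) / ((Q : ℤ) : ℚ))
  have h2 := Int.lt_floor_add_one (((N : ℤ) - (r.val : ℤ) : ℚ) / ((Q : ℤ) : ℚ))
  have h3 := Int.floor_le ((((-N - 1 : ℤ) : ℚ) - (r.val : ℤ)) / ((Q : ℤ) : ℚ))
  have h4 := Int.lt_floor_add_one ((((-N - 1 : ℤ) : ℚ) - (r.val : ℤ)) / ((Q : ℤ) : ℚ))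
  set x := ⌊((N : ℤ) - (r.val : ℤ) : ℚ) / ((Q : ℤ) : ℚ)⌋
  set y := ⌊(((-N - 1 : ℤ) : ℚ) - (r.val : ℤ)) / ((Q : ℤ) : ℚ)⌋
  have hxy : y ≤ x := by
    refine Int.floor_le_floor ?_
    push_cast
    gcongr
    have : (0 : ℚ) ≤ N := Nat.cast_nonneg N
    linarith
  rw [max_eq_left (by linarith)] at h
  have hc : (c : ℚ) = x - y := by exact_mod_cast h
  have key : |(c : ℚ) - (2 * N + 1) / Q| ≤ 1 := by
    have e2 : (((N : ℤ) - (r.val : ℤ) : ℚ) / ((Q : ℤ) : ℚ)) -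
        ((((-N - 1 : ℤ) : ℚ) - (r.val : ℤ)) / ((Q : ℤ) : ℚ)) = (2 * N + 1) / Q := by
      push_cast
      rw [← sub_div]
      congr 1
      ring
    rw [hc, ← e2, abs_le]
    constructor <;> linarith
  have := (Rat.cast_le (K := ℝ)).2 key
  push_cast at this
  exact this

theorem tendsto_inv_two_mul_add_one : Tendsto (fun N : ℕ => 1 / (2 * (N : ℝ) + 1)) atTop (𝓝 0) := by
  refine tendsto_const_nhds.div_atTop (tendsto_atTop_add_const_right _ _ ?_)
  exact (tendsto_natCast_atTop_atTop (R := ℝ)).const_mul_atTop two_pos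

theorem tendsto_card_Icc_filter_div (Q : ℕ) [NeZero Q] (r : ZMod Q) :
    Tendsto (fun N : ℕ => (((Finset.Icc (-N : ℤ) N).filter fun n : ℤ => (n : ZMod Q) = r).card : ℝ)
      / (2 * N + 1)) atTop (𝓝 (1 / Q)) := by
  rw [tendsto_iff_norm_sub_tendsto_zero]
  refine squeeze_zero (fun _ => norm_nonneg _) (fun N => ?_) tendsto_inv_two_mul_add_one
  have h := abs_card_Icc_filter_sub_le Q r N
  have hpos : (0 : ℝ) < 2 * N + 1 := by positivity
  rw [Real.norm_eq_abs, le_div_iff₀ hpos]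
  refine le_trans (le_of_eq ?_) h
  rw [← abs_of_pos hpos, ← abs_mul, abs_of_pos hpos]
  congr 1
  field_simp

open Classical in
theorem tendsto_boxDensity_mod (Q : ℕ) [NeZero Q] (R : Set (Fin 4 → ZMod Q)) :
    Tendsto (boxDensity {a | (fun i => (a i : ZMod Q)) ∈ R}) atTop
      (𝓝 ((Nat.card R : ℝ) / (Q : ℝ) ^ 4)) := by
  have h1 : ∀ N, boxDensity {a | (fun i => (a i : ZMod Q)) ∈ R} N =
      ∑ r : R, ∏ i, (((Finset.Icc (-N : ℤ) N).filter fun n : ℤ => (n : ZMod Q) = r.1 i).card : ℝ)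
        / (2 * N + 1) := by
    intro N
    have h2 : (intBox N).filter (· ∈ {a : Fin 4 → ℤ | (fun i => (a i : ZMod Q)) ∈ R}) =
        Finset.univ.biUnion fun r : R => Fintype.piFinset fun i =>
          (Finset.Icc (-N : ℤ) N).filter fun n : ℤ => (n : ZMod Q) = r.1 i := by
      ext a
      simp only [Finset.mem_filter, intBox, Fintype.mem_piFinset, Finset.mem_biUnion,
        Finset.mem_univ, true_and, Subtype.exists]
      constructor
      · rintro ⟨h, hR⟩
        exact ⟨_, hR, fun i => ⟨h i, rfl⟩⟩
      · rintro ⟨r, hr, h⟩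
        refine ⟨fun i => (h i).1, ?_⟩
        have : r = fun i => (a i : ZMod Q) := funext fun i => (h i).2.symm
        change (fun i => (a i : ZMod Q)) ∈ R
        rwa [← this]
    rw [boxDensity, h2, Finset.card_biUnion, Nat.cast_sum, Finset.sum_div]
    · refine Finset.sum_congr rfl fun r _ => ?_
      rw [Fintype.card_piFinset, Finset.prod_div_distrib]
      simp
    · intro r _ s _ hrs
      rw [Function.onFun, Finset.disjoint_left]
      intro a ha hb
      simp only [Fintype.mem_piFinset, Finset.mem_filter] at ha hb
      exact hrs (Subtype.ext (funext fun i => (ha i).2.symm.trans (hb i).2))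
  rw [funext h1]
  have h3 : (Nat.card R : ℝ) / (Q : ℝ) ^ 4 = ∑ r : R, ∏ i : Fin 4, (1 / (Q : ℝ)) := by
    simp [div_eq_mul_inv]
  rw [h3]
  exact tendsto_finsetSum _ fun r _ => tendsto_finsetProd _ fun i _ =>
    tendsto_card_Icc_filter_div Q (r.1 i)

/-- The Chinese remainder theorem merges the conditions into one modulo `∏ q i`, and the number of
admissible residues is multiplicative. -/
theorem tendsto_boxDensity_forall_mod {ι : Type*} [Fintype ι] (q : ι → ℕ) [∀ i, NeZero (q i)]
    (hq : Pairwise (Function.onFun Nat.Coprime q)) (R : ∀ i, Set (Fin 4 → ZMod (q i))) :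
    Tendsto (boxDensity {a | ∀ i, (fun j => (a j : ZMod (q i))) ∈ R i}) atTop
      (𝓝 (∏ i, (Nat.card (R i) : ℝ) / (q i : ℝ) ^ 4)) := by
  have hQ : NeZero (∏ i, q i) := ⟨Finset.prod_ne_zero_iff.2 fun i _ => NeZero.ne _⟩
  let e := ZMod.prodEquivPi q hq
  let E : (Fin 4 → ZMod (∏ i, q i)) ≃ ∀ i, Fin 4 → ZMod (q i) :=
    (Equiv.arrowCongr (Equiv.refl _) e.toEquiv).trans (Equiv.piComm _)
  have h := tendsto_boxDensity_mod (∏ i, q i) {r | ∀ i, E r i ∈ R i}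
  have hset : {a : Fin 4 → ℤ | (fun i => (a i : ZMod (∏ i, q i))) ∈ {r | ∀ i, E r i ∈ R i}} =
      {a | ∀ i, (fun j => (a j : ZMod (q i))) ∈ R i} := by
    ext a
    have : ∀ i, E (fun j => (a j : ZMod (∏ i, q i))) i = fun j => (a j : ZMod (q i)) := by
      intro i
      funext j
      change e (a j : ZMod (∏ i, q i)) i = _
      rw [map_intCast]
      rfl
    simp only [Set.mem_ofPred_eq, this]
  have hcard : Nat.card {r | ∀ i, E r i ∈ R i} = ∏ i, Nat.card (R i) := by
    rw [← Nat.card_pi]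
    refine Nat.card_congr ((Equiv.subtypeEquiv E fun r => Iff.rfl).trans
      (Equiv.subtypePiEquivPi (p := fun i x => x ∈ R i)))
  rw [hset, hcard] at h
  convert h using 2
  rw [Finset.prod_div_distrib, Finset.prod_pow]
  push_cast
  rfl

/-! ### Approximating `p`-adic sets by residue conditions -/

section LevelSets

variable {p : ℕ} [Fact p.Prime]

instance neZero_prime_pow (k : ℕ) : NeZero (p ^ k) :=
  ⟨pow_ne_zero _ (Fact.out : p.Prime).ne_zero⟩

theorem padicVecHaar_real_preimage (k : ℕ) (R : Set (Fin 4 → ZMod (p ^ k))) :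
    (padicVecHaar p).real (PadicInt.vecToZModPow p k ⁻¹' R) =
      (Nat.card R : ℝ) / ((p ^ k : ℕ) : ℝ) ^ 4 := by
  classical
  have h : PadicInt.vecToZModPow p k ⁻¹' R =
      ⋃ r ∈ R.toFinset, PadicInt.vecToZModPow p k ⁻¹' {r} := by
    ext a; simp
  rw [h, measureReal_biUnion_finset]
  · have : ∀ r, (padicVecHaar p).real (PadicInt.vecToZModPow p k ⁻¹' {r}) =
        1 / ((p ^ k : ℕ) : ℝ) ^ 4 := fun r => by
      rw [Measure.real, padicVecHaar_preimage_singleton]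
      simp [pow_mul, pow_right_comm _ 4 k]
    simp only [this, Finset.sum_const, Set.toFinset_card, nsmul_eq_mul, Nat.card_eq_fintype_card]
    ring
  · intro r _ s _ hrs
    rw [Function.onFun, Set.disjoint_left]
    intro a ha hb
    exact hrs (ha.symm.trans hb)
  · exact fun r _ => (PadicInt.isClopen_preimage_vecToZModPow k {r}).isOpen.measurableSet

/-- The residue vectors modulo `p ^ k` all of whose lifts lie in `T`. -/
def innerResidues (p : ℕ) [Fact p.Prime] (T : Set (Fin 4 → ℤ_[p])) (k : ℕ) :
    Set (Fin 4 → ZMod (p ^ k)) :=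
  {r | PadicInt.vecToZModPow p k ⁻¹' {r} ⊆ T}

theorem PadicInt.vecToZModPow_eq_iff {k : ℕ} {a b : Fin 4 → ℤ_[p]} :
    PadicInt.vecToZModPow p k a = PadicInt.vecToZModPow p k b ↔
      ‖a - b‖ ≤ (p : ℝ) ^ (-k : ℤ) := by
  rw [pi_norm_le_iff_of_nonneg (zpow_nonneg (Nat.cast_nonneg _) _), funext_iff]
  refine forall_congr' fun i => ?_
  rw [Pi.sub_apply, PadicInt.norm_le_pow_iff_mem_span_pow, ← PadicInt.ker_toZModPow,
    RingHom.mem_ker, map_sub, sub_eq_zero]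
  rfl

/-- The residue balls contained in `T` grow with `k` and exhaust exactly the interior of `T`, so
continuity from below applies. -/
theorem tendsto_padicVecHaar_innerResidues (T : Set (Fin 4 → ℤ_[p])) :
    Tendsto (fun k => (padicVecHaar p).real (PadicInt.vecToZModPow p k ⁻¹' innerResidues p T k))
      atTop (𝓝 ((padicVecHaar p).real (interior T))) := by
  have hp1 : (1 : ℝ) < p := by exact_mod_cast (Fact.out : p.Prime).one_lt
  have hmono : Monotone fun k => PadicInt.vecToZModPow p k ⁻¹' innerResidues p T k := by
    intro k l hkl a ha b hb
    refine ha ?_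
    rw [Set.mem_preimage, Set.mem_singleton_iff, PadicInt.vecToZModPow_eq_iff] at hb ⊢
    refine hb.trans (zpow_le_zpow_right₀ hp1.le ?_)
    omega
  have hU : ⋃ k, PadicInt.vecToZModPow p k ⁻¹' innerResidues p T k = interior T := by
    ext a
    rw [Set.mem_iUnion]
    constructor
    · rintro ⟨k, hk⟩
      exact mem_interior.2 ⟨_, hk, (PadicInt.isClopen_preimage_vecToZModPow k _).isOpen, rfl⟩
    · intro ha
      obtain ⟨ε, hε, hball⟩ := Metric.mem_nhds_iff.1 (mem_interior_iff_mem_nhds.1 ha)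
      obtain ⟨k, hk⟩ := PadicInt.exists_pow_neg_lt p hε
      refine ⟨k, fun b hb => hball ?_⟩
      rw [Set.mem_preimage, Set.mem_singleton_iff, PadicInt.vecToZModPow_eq_iff] at hb
      rw [Metric.mem_ball, dist_eq_norm]
      exact hb.trans_lt hk
  rw [← hU]
  exact (ENNReal.tendsto_toReal (measure_ne_top _ _)).comp (tendsto_measure_iUnion_atTop hmono)

/-- The complementary statement: the residue balls meeting `T` shrink to its closure. -/
theorem tendsto_padicVecHaar_outerResidues (T : Set (Fin 4 → ℤ_[p])) :
    Tendsto (fun k => (padicVecHaar p).real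
      (PadicInt.vecToZModPow p k ⁻¹' (innerResidues p Tᶜ k)ᶜ)) atTop
      (𝓝 ((padicVecHaar p).real (closure T))) := by
  have h1 : ∀ k, (padicVecHaar p).real (PadicInt.vecToZModPow p k ⁻¹' (innerResidues p Tᶜ k)ᶜ) =
      1 - (padicVecHaar p).real (PadicInt.vecToZModPow p k ⁻¹' innerResidues p Tᶜ k) := fun k => by
    rw [Set.preimage_compl, probReal_compl_eq_one_sub
      (PadicInt.isClopen_preimage_vecToZModPow k _).isOpen.measurableSet]
  have h2 : (padicVecHaar p).real (closure T) =
      1 - (padicVecHaar p).real (interior Tᶜ) := by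
    rw [interior_compl, probReal_compl_eq_one_sub isClosed_closure.measurableSet]
    ring
  rw [h2, funext h1]
  exact (tendsto_padicVecHaar_innerResidues Tᶜ).const_sub 1

theorem padicVecHaar_real_interior {T : Set (Fin 4 → ℤ_[p])}
    (hT : padicVecHaar p (frontier T) = 0) :
    (padicVecHaar p).real (interior T) = (padicVecHaar p).real T :=
  measureReal_congr (interior_ae_eq_of_null_frontier hT)

theorem padicVecHaar_real_closure {T : Set (Fin 4 → ℤ_[p])}
    (hT : padicVecHaar p (frontier T) = 0) :
    (padicVecHaar p).real (closure T) = (padicVecHaar p).real T :=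
  measureReal_congr (closure_ae_eq_of_null_frontier hT)

end LevelSets

instance Nat.Primes.fact (p : Nat.Primes) : Fact (p : ℕ).Prime := ⟨p.2⟩

/-- Integer vectors equidistribute with respect to finitely many `p`-adic conditions. -/
theorem tendsto_boxDensity_padic (S : Finset Nat.Primes)
    (T : ∀ p : Nat.Primes, Set (Fin 4 → ℤ_[(p : ℕ)]))
    (hT : ∀ p ∈ S, padicVecHaar p (frontier (T p)) = 0) :
    Tendsto (boxDensity {a | ∀ p ∈ S, (fun i => (a i : ℤ_[(p : ℕ)])) ∈ T p}) atTop
      (𝓝 (∏ p ∈ S, (padicVecHaar p).real (T p))) := by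
  have hper : ∀ (k : ℕ) (R : ∀ p : Nat.Primes, Set (Fin 4 → ZMod ((p : ℕ) ^ k))),
      Tendsto (boxDensity {a | ∀ p ∈ S, (fun i => (a i : ℤ_[(p : ℕ)])) ∈
        PadicInt.vecToZModPow p k ⁻¹' R p}) atTop
        (𝓝 (∏ p ∈ S, (padicVecHaar p).real (PadicInt.vecToZModPow p k ⁻¹' R p))) := by
    intro k R
    have h := tendsto_boxDensity_forall_mod (fun p : S => ((p : Nat.Primes) : ℕ) ^ k)
      (fun p q hpq => Nat.Coprime.pow _ _ ((Nat.coprime_primes p.1.2 q.1.2).2 fun h =>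
        hpq (Subtype.ext (Subtype.ext h)))) (fun p => R p)
    have hset : {a : Fin 4 → ℤ | ∀ p ∈ S, (fun i => (a i : ℤ_[(p : ℕ)])) ∈
        PadicInt.vecToZModPow p k ⁻¹' R p} =
        {a | ∀ p : S, (fun j => (a j : ZMod (((p : Nat.Primes) : ℕ) ^ k))) ∈ R p} := by
      ext a
      have : ∀ p : Nat.Primes, PadicInt.vecToZModPow p k (fun i => (a i : ℤ_[(p : ℕ)])) =
          fun j => (a j : ZMod ((p : ℕ) ^ k)) := fun p => by
        funext j
        exact map_intCast (PadicInt.toZModPow (p := p) k) (a j)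
      simp only [Set.mem_ofPred_eq, Set.mem_preimage, this, Subtype.forall]
    rw [hset]
    convert h using 2
    rw [← Finset.prod_coe_sort]
    exact Finset.prod_congr rfl fun p _ => padicVecHaar_real_preimage k (R p)
  -- Each condition is squeezed between the balls inside `T p` and the balls meeting `T p`. Their
  -- measures tend to those of the interior and the closure, which agree as the frontier is null.
  refine tendsto_of_forall_le_of_le
    (l := fun k => boxDensity {a | ∀ p ∈ S, (fun i => (a i : ℤ_[(p : ℕ)])) ∈
      PadicInt.vecToZModPow p k ⁻¹' innerResidues p (T p) k})
    (u := fun k => boxDensity {a | ∀ p ∈ S, (fun i => (a i : ℤ_[(p : ℕ)])) ∈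
      PadicInt.vecToZModPow p k ⁻¹' (innerResidues p (T p)ᶜ k)ᶜ})
    (fun k N => boxDensity_mono ?_ N) (fun k N => boxDensity_mono ?_ N)
    (fun k => hper k fun p => innerResidues p (T p) k)
    (fun k => hper k fun p => (innerResidues p (T p)ᶜ k)ᶜ)
    (tendsto_finsetProd _ fun p hp => ?_) (tendsto_finsetProd _ fun p hp => ?_)
  · intro a ha p hp
    exact ha p hp rfl
  · intro a ha p hp h
    exact h rfl (ha p hp)
  · rw [← padicVecHaar_real_interior (hT p hp)]
    exact tendsto_padicVecHaar_innerResidues _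
  · rw [← padicVecHaar_real_closure (hT p hp)]
    exact tendsto_padicVecHaar_outerResidues _

/-! ### The local conditions: solubility and primitivity -/

section LocalConditions

variable {p : ℕ} [Fact p.Prime]

/-- Near a vector with nonzero entries each coefficient changes only by a nonzero cube, so
solubility is locally constant there. The frontier thus lies in the null set of vectors with a zero
entry. -/
theorem padicVecHaar_frontier_solubleSet : padicVecHaar p (frontier (solubleSet p)) = 0 := by
  refine measure_mono_null (fun a ha => ?_) padicVecHaar_exists_eq_zero
  by_contra h0
  simp only [Set.mem_ofPred_eq, not_exists] at h0
  have hev : ∀ᶠ b in 𝓝 a, (b ∈ solubleSet p ↔ a ∈ solubleSet p) := by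
    have : ∀ᶠ b in 𝓝 a, ∀ i, ∃ c : ℚ_[p], c ≠ 0 ∧ (b i : ℚ_[p]) = a i * c ^ 3 :=
      Filter.eventually_all.2 fun i => (continuous_apply i).continuousAt.eventually
        (PadicInt.eventually_exists_eq_mul_pow_three (h0 i))
    filter_upwards [this] with b hb
    choose c hc hb using hb
    exact (diagonalCubic_nonempty_congr _ _ c hc hb).symm
  rw [frontier_eq_closure_inter_closure] at ha
  by_cases hmem : a ∈ solubleSet p
  · obtain ⟨b, hb1, hb2⟩ := (mem_closure_iff_frequently.1 ha.2).and_eventually hev |>.exists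
    exact hb1 (hb2.2 hmem)
  · obtain ⟨b, hb1, hb2⟩ := (mem_closure_iff_frequently.1 ha.1).and_eventually hev |>.exists
    exact hmem (hb2.1 hb1)

/-- The vectors in `ℤ_p⁴` that are not divisible by `p`. -/
def primitiveSet (p : ℕ) [Fact p.Prime] : Set (Fin 4 → ℤ_[p]) := {a | ¬ ∀ i, (p : ℤ_[p]) ∣ a i}

theorem isClopen_primitiveSet : IsClopen (primitiveSet p) := by
  have : primitiveSet p = PadicInt.vecToZModPow p 1 ⁻¹' {0}ᶜ := by
    ext a
    refine not_congr ?_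
    change _ ↔ PadicInt.vecToZModPow p 1 a = 0
    rw [funext_iff]
    refine forall_congr' fun i => ?_
    have h := SetLike.ext_iff.1 (PadicInt.ker_toZModPow (p := p) 1) (a i)
    rw [Ideal.mem_span_singleton, pow_one (p : ℤ_[p])] at h
    exact h.symm
  rw [this]
  exact PadicInt.isClopen_preimage_vecToZModPow 1 _

theorem padicVecHaar_frontier_primitiveSet : padicVecHaar p (frontier (primitiveSet p)) = 0 := by
  rw [isClopen_primitiveSet.frontier_eq, measure_empty]

theorem padicVecHaar_frontier_primitiveSet_inter_solubleSet :
    padicVecHaar p (frontier (primitiveSet p ∩ solubleSet p)) = 0 := by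
  refine measure_mono_null (frontier_inter_subset _ _) (measure_union_null ?_ ?_)
  · exact measure_mono_null Set.inter_subset_left padicVecHaar_frontier_primitiveSet
  · exact measure_mono_null Set.inter_subset_right padicVecHaar_frontier_solubleSet

theorem padicVecHaar_real_primitiveSet :
    (padicVecHaar p).real (primitiveSet p) = 1 - 1 / (p : ℝ) ^ 4 := by
  have : primitiveSet p = {a | ∀ i, (p : ℤ_[p]) ∣ a i}ᶜ := rfl
  have h1 : MeasurableSet {a : Fin 4 → ℤ_[p] | ∀ i, (p : ℤ_[p]) ∣ a i} := by
    rw [← compl_compl {a : Fin 4 → ℤ_[p] | ∀ i, (p : ℤ_[p]) ∣ a i}, ← this]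
    exact isClopen_primitiveSet.compl.isOpen.measurableSet
  rw [this, probReal_compl_eq_one_sub h1, Measure.real, padicVecHaar_dvd]
  simp

/-- Solubility is invariant under scaling, so the soluble vectors divisible by `p` are `p` times the
soluble set and carry a fraction `p⁻⁴` of its measure. -/
theorem padicVecHaar_real_primitiveSet_inter_solubleSet :
    (padicVecHaar p).real (primitiveSet p ∩ solubleSet p) =
      (1 - 1 / (p : ℝ) ^ 4) * padicDensity p := by
  have hp : (p : ℚ_[p]) ≠ 0 := by exact_mod_cast (Fact.out : p.Prime).ne_zero
  have hdiff : solubleSet p \ primitiveSet p = (fun a => (p : ℤ_[p]) • a) '' solubleSet p := by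
    have key : ∀ b : Fin 4 → ℤ_[p], (p : ℤ_[p]) • b ∈ solubleSet p ↔ b ∈ solubleSet p := by
      intro b
      have := diagonalCubic_smul (p : ℚ_[p]) hp fun i => (b i : ℚ_[p])
      change (diagonalCubic fun i => (((p : ℤ_[p]) • b) i : ℚ_[p])).Nonempty ↔
        (diagonalCubic fun i => (b i : ℚ_[p])).Nonempty
      rw [← this]
      simp
    ext a
    constructor
    · rintro ⟨h1, h2⟩
      rw [primitiveSet, Set.mem_ofPred_eq, not_not] at h2
      choose b hb using h2
      obtain rfl : a = (p : ℤ_[p]) • b := funext hb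
      exact ⟨b, (key b).1 h1, rfl⟩
    · rintro ⟨b, hb, rfl⟩
      exact ⟨(key b).2 hb, fun h => h fun i => ⟨b i, rfl⟩⟩
  have h := measureReal_inter_add_sdiff (μ := padicVecHaar p) (s := solubleSet p)
    (isClopen_primitiveSet (p := p)).isOpen.measurableSet
  have himg : (padicVecHaar p).real ((fun a => (p : ℤ_[p]) • a) '' solubleSet p) =
      1 / (p : ℝ) ^ 4 * (padicVecHaar p).real (solubleSet p) := by
    rw [Measure.real, padicVecHaar_image_p_smul, ENNReal.toReal_mul]
    simp [Measure.real]
  rw [hdiff, himg, Set.inter_comm] at h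
  rw [padicDensity_eq]
  linear_combination h

/-- At a prime other than three, a diagonal cubic with nonzero `p`-integral coefficients can only be
insoluble if two of the coefficients are divisible by `p`. -/
theorem exists_dvd_dvd_of_notMem_solubleSet (hp : p ≠ 3) (a : Fin 4 → ℤ_[p]) (ha : ∀ i, a i ≠ 0)
    (h : a ∉ solubleSet p) : ∃ i j, i ≠ j ∧ (p : ℤ_[p]) ∣ a i ∧ (p : ℤ_[p]) ∣ a j := by
  by_contra! hcon
  refine h ?_
  have hmod : p % 3 = 1 ∨ p % 3 = 2 := by
    have : ¬ 3 ∣ p := fun h3 => hp ((Nat.prime_dvd_prime_iff_eq Nat.prime_three Fact.out).1 h3).symm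
    omega
  rcases hmod with hmod | hmod
  · obtain ⟨ρ, hs, hk, hm, hr⟩ := PadicInt.exists_cubic_character_of_mod_three_eq_one hmod
    refine (diagonalCubic_nonempty_iff_splitSoluble hk hm hr _
      fun i => PadicInt.coe_ne_zero.2 (ha i)).2 (Or.inr ?_)
    have hcl : ∀ i, ¬ (p : ℤ_[p]) ∣ a i → (cubeClass ρ (a i)).1 = 0 := by
      intro i hi
      rw [← PadicInt.norm_lt_one_iff_dvd, ← PadicInt.not_isUnit_iff, not_not] at hi
      have := cubeClass_unit ρ hi.unit
      rw [IsUnit.unit_spec] at this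
      rw [this]
    -- All entries but possibly one are units, and three units have the same valuation class, the
    -- second alternative of `SplitSoluble`.
    obtain ⟨l, hl⟩ : ∃ l, ∀ i, i ≠ l → ¬ (p : ℤ_[p]) ∣ a i := by
      by_cases h0 : ∃ l, (p : ℤ_[p]) ∣ a l
      · obtain ⟨l, hl⟩ := h0
        exact ⟨l, fun i hi => hcon l i hi.symm hl⟩
      · push Not at h0
        exact ⟨0, fun i _ => h0 i⟩
    have : ∀ l : Fin 4, ∃ i j k, i ≠ j ∧ i ≠ k ∧ j ≠ k ∧ i ≠ l ∧ j ≠ l ∧ k ≠ l := by decide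
    obtain ⟨i, j, k, hij, hik, hjk, hi, hj, hk⟩ := this l
    refine ⟨i, j, k, hij, hik, hjk, ?_, ?_⟩
    · simp only [hcl i (hl i hi), hcl j (hl j hj)]
    · simp only [hcl i (hl i hi), hcl k (hl k hk)]
  · exact diagonalCubic_nonempty_of_mod_three_eq_two hmod _

end LocalConditions

/-! ### The sieve over all primes -/

theorem boxDensity_union_le (A B : Set (Fin 4 → ℤ)) (N : ℕ) :
    boxDensity (A ∪ B) N ≤ boxDensity A N + boxDensity B N := by
  classical
  unfold boxDensity
  rw [← add_div]
  gcongr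
  rw [← Nat.cast_add]
  refine Nat.cast_le.2 (le_trans (Finset.card_le_card ?_) (Finset.card_union_le _ _))
  intro a ha
  simp only [Finset.mem_filter, Finset.mem_union, Set.mem_union] at ha ⊢
  tauto

theorem boxDensity_exists_eq_zero_le (N : ℕ) :
    boxDensity {a | ∃ i, a i = 0} N ≤ 4 * (1 / (2 * N + 1)) := by
  classical
  have hpos : (0 : ℝ) < 2 * N + 1 := by positivity
  obtain ⟨A, hA⟩ : ∃ A : Set (Fin 4 → ℤ), A = {a | ∃ i, a i = 0} := ⟨_, rfl⟩
  rw [← hA]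
  have hsub : (intBox N).filter (· ∈ A) ⊆
      Finset.univ.biUnion fun i : Fin 4 => Fintype.piFinset fun l =>
        if l = i then {0} else Finset.Icc (-N : ℤ) N := by
    intro a ha
    rw [Finset.mem_filter, intBox, Fintype.mem_piFinset] at ha
    obtain ⟨ha, hi⟩ := ha
    obtain ⟨i, hi⟩ : ∃ i, a i = 0 := by rwa [hA] at hi
    refine Finset.mem_biUnion.2 ⟨i, Finset.mem_univ _, Fintype.mem_piFinset.2 fun l => ?_⟩
    split_ifs with hl
    · rw [hl, hi]; exact Finset.mem_singleton_self _
    · exact ha l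
  have hcard : ((intBox N).filter (· ∈ A)).card ≤
      4 * (2 * N + 1) ^ 3 := by
    refine (Finset.card_le_card hsub).trans (Finset.card_biUnion_le.trans (le_of_eq ?_))
    have : ∀ i : Fin 4, (Fintype.piFinset fun l : Fin 4 =>
        if l = i then ({0} : Finset ℤ) else Finset.Icc (-N : ℤ) N).card = (2 * N + 1) ^ 3 := by
      intro i
      have hIcc : (Finset.Icc (-N : ℤ) N).card = 2 * N + 1 := by rw [Int.card_Icc]; omega
      rw [Fintype.card_piFinset]
      simp only [apply_ite Finset.card, Finset.card_singleton, hIcc]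
      rw [Finset.prod_ite, Finset.prod_const, Finset.prod_const, one_pow, one_mul]
      congr 1
      revert i; decide
    simp only [this, Finset.sum_const, Finset.card_univ, Fintype.card_fin, smul_eq_mul]
  rw [boxDensity, div_le_iff₀ (by positivity)]
  calc (((intBox N).filter (· ∈ A)).card : ℝ)
      ≤ ((4 * (2 * N + 1) ^ 3 : ℕ) : ℝ) := Nat.cast_le.2 hcard
    _ = 4 * (1 / (2 * N + 1)) * (2 * N + 1) ^ 4 := by
      push_cast
      field_simp

theorem card_Icc_filter_dvd_le (d : ℕ) (hd : 0 < d) (N : ℕ) :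
    ((Finset.Icc (-N : ℤ) N).filter fun n => n ≠ 0 ∧ (d : ℤ) ∣ n).card ≤ 2 * (N / d) := by
  have hsub : (Finset.Icc (-N : ℤ) N).filter (fun n => n ≠ 0 ∧ (d : ℤ) ∣ n) ⊆
      ((Finset.Icc (-(N / d : ℕ) : ℤ) (N / d : ℕ)).erase 0).image fun m => (d : ℤ) * m := by
    intro n hn
    simp only [Finset.mem_filter, Finset.mem_Icc] at hn
    obtain ⟨⟨h1, h2⟩, h0, m, rfl⟩ := hn
    refine Finset.mem_image.2 ⟨m, Finset.mem_erase.2 ⟨right_ne_zero_of_mul h0, ?_⟩, rfl⟩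
    have hd' : (0 : ℤ) < d := by exact_mod_cast hd
    have hN : (d : ℤ) * ((N / d : ℕ) : ℤ) + ((N % d : ℕ) : ℤ) = N := by
      exact_mod_cast Nat.div_add_mod N d
    have hlt : ((N % d : ℕ) : ℤ) < d := by exact_mod_cast Nat.mod_lt N hd
    rw [Finset.mem_Icc]
    constructor
    · by_contra! h
      nlinarith
    · by_contra! h
      nlinarith
  refine (Finset.card_le_card hsub).trans (Finset.card_image_le.trans ?_)
  rw [Finset.card_erase_of_mem (Finset.mem_Icc.2 ⟨by simp only [neg_nonpos]; exact Int.natCast_nonneg _,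
    Int.natCast_nonneg _⟩), Int.card_Icc]
  generalize N / d = q
  omega

/-- The integer vectors with nonzero entries two of which have a common divisor exceeding `M`. -/
def commonDivisorSet (M : ℕ) : Set (Fin 4 → ℤ) :=
  {a | (∀ i, a i ≠ 0) ∧ ∃ d : ℕ, M < d ∧ ∃ i j, i ≠ j ∧ (d : ℤ) ∣ a i ∧ (d : ℤ) ∣ a j}

/-- For each `d` and each of the 12 ordered pairs of positions the density is at most `d⁻²`, and the
sum of `d⁻²` over `d > M` is at most `1/M`. Nonzero entries matter twice: they force `d ≤ N`, and
they leave at most `2⌊N/d⌋` multiples, with no additive error. The bound is uniform in `N`. -/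
theorem boxDensity_commonDivisorSet_le (M : ℕ) (hM : M ≠ 0) (N : ℕ) :
    boxDensity (commonDivisorSet M) N ≤ 12 * (M : ℝ)⁻¹ := by
  classical
  have hpos : (0 : ℝ) < 2 * N + 1 := by positivity
  let V : ℕ → Finset ℤ := fun d => (Finset.Icc (-N : ℤ) N).filter fun n => n ≠ 0 ∧ (d : ℤ) ∣ n
  have hsub : (intBox N).filter (· ∈ commonDivisorSet M) ⊆
      (Finset.Ioc M N).biUnion fun d => (Finset.univ : Finset (Fin 4)).offDiag.biUnion fun z =>
        Fintype.piFinset fun l => if l = z.1 ∨ l = z.2 then V d else Finset.Icc (-N : ℤ) N := by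
    intro a ha
    rw [Finset.mem_filter, intBox, Fintype.mem_piFinset] at ha
    obtain ⟨ha, h0, d, hMd, i, j, hij, hi, hj⟩ := ha
    have hdN : d ≤ N := by
      have h1 := Int.le_of_dvd (abs_pos.2 (h0 i)) ((dvd_abs _ _).2 hi)
      have h2 := ha i
      rw [Finset.mem_Icc, ← abs_le] at h2
      exact_mod_cast h1.trans h2
    refine Finset.mem_biUnion.2 ⟨d, Finset.mem_Ioc.2 ⟨hMd, hdN⟩, Finset.mem_biUnion.2
      ⟨(i, j), by simpa using hij, Fintype.mem_piFinset.2 fun l => ?_⟩⟩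
    split_ifs with hl
    · refine Finset.mem_filter.2 ⟨ha l, h0 l, ?_⟩
      rcases hl with rfl | rfl
      exacts [hi, hj]
    · exact ha l
  have hV : ∀ d ∈ Finset.Ioc M N, ((V d).card : ℝ) ≤ (2 * N + 1) * (d : ℝ)⁻¹ := by
    intro d hd
    rw [Finset.mem_Ioc] at hd
    have hd0 : (0 : ℝ) < d := by exact_mod_cast (by omega : 0 < d)
    have h1 := card_Icc_filter_dvd_le d (by omega) N
    have h2 : ((V d).card : ℝ) ≤ 2 * ((N / d : ℕ) : ℝ) := by exact_mod_cast h1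
    have h3 : ((N / d : ℕ) : ℝ) ≤ N / d := Nat.cast_div_le
    calc ((V d).card : ℝ) ≤ 2 * ((N : ℝ) / d) := by linarith
      _ = 2 * N * (d : ℝ)⁻¹ := by ring
      _ ≤ _ := by gcongr; linarith
  have hpi : ∀ d ∈ Finset.Ioc M N, ∀ z ∈ (Finset.univ : Finset (Fin 4)).offDiag,
      ((Fintype.piFinset fun l => if l = z.1 ∨ l = z.2 then V d else
        Finset.Icc (-N : ℤ) N).card : ℝ) ≤ (2 * N + 1) ^ 4 * ((d : ℝ) ^ 2)⁻¹ := by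
    rintro d hd ⟨i, j⟩ hz
    have hij : i ≠ j := by simpa using hz
    have hIcc : (Finset.Icc (-N : ℤ) N).card = 2 * N + 1 := by rw [Int.card_Icc]; omega
    have h2 : ∀ i j : Fin 4, i ≠ j → (Finset.univ.filter fun l => l = i ∨ l = j).card = 2 ∧
        (Finset.univ.filter fun l => ¬ (l = i ∨ l = j)).card = 2 := by decide
    rw [Fintype.card_piFinset]
    simp only [apply_ite Finset.card, hIcc]
    rw [Finset.prod_ite, Finset.prod_const, Finset.prod_const, (h2 i j hij).1, (h2 i j hij).2]
    push_cast
    calc ((V d).card : ℝ) ^ 2 * (2 * N + 1) ^ 2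
        ≤ ((2 * N + 1) * (d : ℝ)⁻¹) ^ 2 * (2 * N + 1) ^ 2 := by gcongr; exact hV d hd
      _ = _ := by ring
  have hsum : ∑ d ∈ Finset.Ioc M N, ((d : ℝ) ^ 2)⁻¹ ≤ (M : ℝ)⁻¹ := by
    rcases le_total M N with h | h
    · have := sum_Ioc_inv_sq_le_sub (α := ℝ) hM h
      have h0 : (0 : ℝ) ≤ (N : ℝ)⁻¹ := by positivity
      linarith
    · rw [Finset.Ioc_eq_empty (by omega)]
      simp
  rw [boxDensity, div_le_iff₀ (by positivity)]
  calc (((intBox N).filter (· ∈ commonDivisorSet M)).card : ℝ)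
      ≤ ∑ d ∈ Finset.Ioc M N, ∑ z ∈ (Finset.univ : Finset (Fin 4)).offDiag,
        ((Fintype.piFinset fun l => if l = z.1 ∨ l = z.2 then V d else
          Finset.Icc (-N : ℤ) N).card : ℝ) := by
        have h1 := (Finset.card_le_card hsub).trans (Finset.card_biUnion_le.trans
          (Finset.sum_le_sum fun d _ => Finset.card_biUnion_le))
        exact_mod_cast h1
    _ ≤ ∑ d ∈ Finset.Ioc M N, ∑ z ∈ (Finset.univ : Finset (Fin 4)).offDiag,
        (2 * N + 1 : ℝ) ^ 4 * ((d : ℝ) ^ 2)⁻¹ :=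
        Finset.sum_le_sum fun d hd => Finset.sum_le_sum fun z hz => hpi d hd z hz
    _ = 12 * (∑ d ∈ Finset.Ioc M N, ((d : ℝ) ^ 2)⁻¹) * (2 * N + 1) ^ 4 := by
        have : (Finset.univ : Finset (Fin 4)).offDiag.card = 12 := by decide
        simp only [Finset.sum_const, this, nsmul_eq_mul, ← Finset.mul_sum]
        push_cast
        ring
    _ ≤ _ := by gcongr

/-- The primes up to `M`. -/
def primesUpTo (M : ℕ) : Finset Nat.Primes := (Finset.range (M + 1)).subtype Nat.Prime

theorem mem_primesUpTo {M : ℕ} {p : Nat.Primes} : p ∈ primesUpTo M ↔ (p : ℕ) ≤ M := by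
  exact Finset.mem_subtype.trans (by rw [Finset.mem_range, Nat.lt_succ_iff])

/-- The density of the integer vectors satisfying a `p`-adic condition for every prime `p`, if a
violation of the condition at a large prime `p` forces two entries to be divisible by `p`. -/
theorem tendsto_boxDensity_sieve (T : ∀ p : Nat.Primes, Set (Fin 4 → ℤ_[(p : ℕ)]))
    (hT : ∀ p : Nat.Primes, padicVecHaar p (frontier (T p)) = 0)
    (htail : ∀ p : Nat.Primes, (p : ℕ) ≠ 3 → ∀ a : Fin 4 → ℤ, (∀ i, a i ≠ 0) →
      (fun i => (a i : ℤ_[(p : ℕ)])) ∉ T p →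
      ∃ i j, i ≠ j ∧ ((p : ℕ) : ℤ) ∣ a i ∧ ((p : ℕ) : ℤ) ∣ a j)
    {x : ℝ} (hx : Tendsto (fun M : ℕ => ∏ p ∈ primesUpTo M, (padicVecHaar p).real (T p)) atTop (𝓝 x)) :
    Tendsto (boxDensity {a | ∀ p : Nat.Primes, (fun i => (a i : ℤ_[(p : ℕ)])) ∈ T p}) atTop (𝓝 x) := by
  let X : ℕ → Set (Fin 4 → ℤ) := fun M =>
    {a | ∀ p ∈ primesUpTo M, (fun i => (a i : ℤ_[(p : ℕ)])) ∈ T p}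
  have hX : ∀ M, Tendsto (boxDensity (X M)) atTop
      (𝓝 (∏ p ∈ primesUpTo M, (padicVecHaar p).real (T p))) :=
    fun M => tendsto_boxDensity_padic _ T fun p _ => hT p
  have hx3 := (tendsto_add_atTop_iff_nat 3).2 hx
  refine tendsto_of_forall_le_of_le
    (l := fun k N => boxDensity (X (k + 3)) N - 12 * ((k + 3 : ℕ) : ℝ)⁻¹ - 4 * (1 / (2 * N + 1)))
    (u := fun k N => boxDensity (X (k + 3)) N)
    (L := fun k => (∏ p ∈ primesUpTo (k + 3), (padicVecHaar p).real (T p)) -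
      12 * ((k + 3 : ℕ) : ℝ)⁻¹ - 4 * 0) ?_ ?_ ?_ (fun k => hX (k + 3)) ?_ hx3
  · intro k N
    -- The shift by `3` keeps the prime three, which `htail` does not cover, among the primes
    -- treated exactly.
    have hsub : X (k + 3) ⊆ ({a | ∀ p : Nat.Primes, (fun i => (a i : ℤ_[(p : ℕ)])) ∈ T p} ∪
        commonDivisorSet (k + 3)) ∪ {a | ∃ i, a i = 0} := by
      intro a ha
      by_cases h0 : ∃ i, a i = 0
      · exact Or.inr h0
      push Not at h0
      refine Or.inl ?_
      by_cases hall : ∀ p : Nat.Primes, (fun i => (a i : ℤ_[(p : ℕ)])) ∈ T p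
      · exact Or.inl hall
      push Not at hall
      obtain ⟨p, hp⟩ := hall
      have hpM : k + 3 < (p : ℕ) := by
        by_contra h
        exact hp (ha p (mem_primesUpTo.2 (by omega)))
      exact Or.inr ⟨h0, p, hpM, htail p (by omega) a h0 hp⟩
    have h1 := boxDensity_mono hsub N
    have h2 := boxDensity_union_le ({a | ∀ p : Nat.Primes, (fun i => (a i : ℤ_[(p : ℕ)])) ∈ T p} ∪
        commonDivisorSet (k + 3)) {a | ∃ i, a i = 0} N
    have h3 := boxDensity_union_le {a | ∀ p : Nat.Primes, (fun i => (a i : ℤ_[(p : ℕ)])) ∈ T p}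
      (commonDivisorSet (k + 3)) N
    have h4 := boxDensity_commonDivisorSet_le (k + 3) (by omega) N
    have h5 := boxDensity_exists_eq_zero_le N
    linarith
  · exact fun k N => boxDensity_mono (by intro a ha p _; exact ha p) N
  · exact fun k => ((hX (k + 3)).sub_const _).sub (tendsto_inv_two_mul_add_one.const_mul 4)
  · have h0 : Tendsto (fun k : ℕ => ((k + 3 : ℕ) : ℝ)⁻¹) atTop (𝓝 0) :=
      (tendsto_add_atTop_iff_nat 3).2 tendsto_inv_atTop_nhds_zero_nat
    simpa using (hx3.sub (h0.const_mul 12)).sub_const (4 * (0 : ℝ))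

/-! ### Rational points and primitive integer vectors -/

theorem intVec_cast_ne_zero {a : Fin 4 → ℤ} (ha : Finset.univ.gcd a = 1) :
    (fun i => (a i : ℚ)) ≠ 0 := by
  intro h
  have h0 : a = 0 := funext fun i => by simpa using congrFun h i
  rw [h0, Finset.gcd_eq_zero_iff.2 (by simp)] at ha
  exact zero_ne_one ha

/-- Two primitive integer vectors give the same rational point if and only if they agree up to
sign. -/
theorem mk_eq_mk_iff_of_gcd_eq_one {a b : Fin 4 → ℤ} (ha : Finset.univ.gcd a = 1)
    (hb : Finset.univ.gcd b = 1) :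
    Projectivization.mk ℚ _ (intVec_cast_ne_zero (a := a) ha) =
      Projectivization.mk ℚ _ (intVec_cast_ne_zero (a := b) hb) ↔ b = a ∨ b = -a := by
  rw [Projectivization.mk_eq_mk_iff']
  constructor
  · rintro ⟨c, hc⟩
    have h1 : ∀ i, c.num * b i = c.den * a i := by
      intro i
      have := congrFun hc i
      simp only [Pi.smul_apply, smul_eq_mul] at this
      have hd : (c.den : ℚ) ≠ 0 := by exact_mod_cast c.den_ne_zero
      rw [← Rat.num_div_den c] at this
      field_simp at this
      have h2 : (c.num : ℚ) * b i = c.den * a i := by linear_combination this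
      exact_mod_cast h2
    -- Comparing the gcds of the two sides of `h1`, with `a` and `b` primitive, shows that numerator
    -- and denominator of `c` agree up to sign.
    have h2 : normalize c.num = normalize (c.den : ℤ) := by
      have e1 := Finset.gcd_mul_left (s := Finset.univ) (f := b) (a := c.num)
      have e2 := Finset.gcd_mul_left (s := Finset.univ) (f := a) (a := (c.den : ℤ))
      rw [hb, mul_one] at e1
      rw [ha, mul_one] at e2
      rw [← e1, ← e2]
      simp only [h1]
    have hd0 : (c.den : ℤ) ≠ 0 := by exact_mod_cast c.den_ne_zero
    rcases Int.associated_iff.1 (normalize_eq_normalize_iff_associated.1 h2) with h | h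
    · refine Or.inl (funext fun i => ?_)
      have := h1 i
      rw [h] at this
      exact mul_left_cancel₀ hd0 this
    · refine Or.inr (funext fun i => ?_)
      have := h1 i
      rw [h] at this
      refine mul_left_cancel₀ hd0 ?_
      rw [Pi.neg_apply]
      linear_combination -this
  · rintro (rfl | rfl)
    · exact ⟨1, by simp⟩
    · exact ⟨-1, by ext; simp⟩

theorem exists_primitive_mk_eq (P : ℙ ℚ (Fin 4 → ℚ)) : ∃ (a : Fin 4 → ℤ)
    (ha : Finset.univ.gcd a = 1), Projectivization.mk ℚ _ (intVec_cast_ne_zero ha) = P := by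
  obtain ⟨d, hd⟩ := IsLocalization.exist_integer_multiples_of_finite (nonZeroDivisors ℤ) P.rep
  choose b hb using hd
  obtain ⟨a, hba, ha⟩ := Finset.extract_gcd (s := Finset.univ) b Finset.univ_nonempty
  refine ⟨a, ha, ?_⟩
  have hd0 : ((d : ℤ) : ℚ) ≠ 0 := by
    exact_mod_cast nonZeroDivisors.coe_ne_zero d
  have h1 : ∀ i, ((d : ℤ) : ℚ) * P.rep i = (Finset.univ.gcd b : ℤ) * (a i : ℚ) := by
    intro i
    have h := hb i
    rw [hba i (Finset.mem_univ i)] at h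
    simpa [Submonoid.smul_def] using h.symm
  have hg : ((Finset.univ.gcd b : ℤ) : ℚ) ≠ 0 := by
    intro h0
    refine P.rep_nonzero (funext fun i => ?_)
    have := h1 i
    rw [h0, zero_mul] at this
    simpa [hd0] using this
  conv_rhs => rw [← P.mk_rep]
  rw [Projectivization.mk_eq_mk_iff']
  refine ⟨d / (Finset.univ.gcd b : ℤ), funext fun i => ?_⟩
  have := h1 i
  rw [Pi.smul_apply, smul_eq_mul]
  field_simp
  linear_combination this

theorem mulHeight_mk_le_iff {a : Fin 4 → ℤ} (ha : Finset.univ.gcd a = 1) {B : ℝ} (hB : 0 ≤ B) :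
    (Projectivization.mk ℚ _ (intVec_cast_ne_zero ha)).mulHeight ≤ B ↔ a ∈ intBox ⌊B⌋₊ := by
  have h := Rat.mulHeight_eq_max_abs_of_gcd_eq_one ha
  rw [Projectivization.mulHeight_mk]
  change Height.mulHeight (((↑) : ℤ → ℚ) ∘ a) ≤ B ↔ _
  rw [h, mem_intBox]
  have h1 : ((⨆ i, |a i| : ℤ) : ℝ) ≤ B ↔ (⨆ i, |a i|) ≤ (⌊B⌋₊ : ℤ) := by
    rw [← Int.le_floor, Int.natCast_floor_eq_floor hB]
  rw [h1, ciSup_le_iff (Set.finite_range _).bddAbove]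

/-- The primitive integer vectors whose point in `ℙ³(ℚ)` satisfies `E`. -/
def primitiveVectors (E : ℙ ℚ (Fin 4 → ℚ) → Prop) : Set (Fin 4 → ℤ) :=
  {a | ∃ ha : Finset.univ.gcd a = 1, E (Projectivization.mk ℚ _ (intVec_cast_ne_zero ha))}

open Classical in
-- Every point has exactly two primitive integer representatives, `a` and `-a`, and its height is
-- their largest absolute entry.
theorem two_mul_ncard_mulHeight_le (E : ℙ ℚ (Fin 4 → ℚ) → Prop) {B : ℝ} (hB : 0 ≤ B) :
    2 * {P : ℙ ℚ (Fin 4 → ℚ) | P.mulHeight ≤ B ∧ E P}.ncard =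
      ((intBox ⌊B⌋₊).filter (· ∈ primitiveVectors E)).card := by
  set F := (intBox ⌊B⌋₊).filter (· ∈ primitiveVectors E) with hF
  -- The default point for vectors that are not primitive plays no role, since `F` consists of
  -- primitive ones.
  let f : (Fin 4 → ℤ) → ℙ ℚ (Fin 4 → ℚ) := fun a =>
    if ha : Finset.univ.gcd a = 1 then Projectivization.mk ℚ _ (intVec_cast_ne_zero ha)
    else Projectivization.mk ℚ 1 one_ne_zero
  have himg : {P : ℙ ℚ (Fin 4 → ℚ) | P.mulHeight ≤ B ∧ E P} = (F.image f : Finset _) := by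
    ext P
    simp only [Set.mem_ofPred_eq, Finset.coe_image, Set.mem_image, Finset.mem_coe, hF,
      Finset.mem_filter, f]
    constructor
    · rintro ⟨h1, h2⟩
      obtain ⟨a, ha, rfl⟩ := exists_primitive_mk_eq P
      exact ⟨a, ⟨(mulHeight_mk_le_iff ha hB).1 h1, ha, h2⟩, dif_pos ha⟩
    · rintro ⟨a, ⟨h1, ha, h2⟩, rfl⟩
      rw [dif_pos ha]
      exact ⟨(mulHeight_mk_le_iff ha hB).2 h1, h2⟩
  rw [himg, Set.ncard_coe_finset, Finset.card_eq_sum_card_image f F]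
  rw [Finset.sum_congr rfl (g := fun _ => 2), Finset.sum_const, smul_eq_mul, mul_comm]
  intro P hP
  obtain ⟨a, haF, rfl⟩ := Finset.mem_image.1 hP
  obtain ⟨h1, ha, h2⟩ := Finset.mem_filter.1 haF
  have hgneg : Finset.univ.gcd (-a) = 1 := by
    have := Finset.gcd_mul_left (s := Finset.univ) (f := a) (a := (-1 : ℤ))
    rw [ha, mul_one] at this
    have h1 : normalize (-1 : ℤ) = 1 := by simp [← Int.abs_eq_normalize]
    rw [h1] at this
    rw [← this]
    congr 1
    ext i
    simp
  have hmk : Projectivization.mk ℚ _ (intVec_cast_ne_zero hgneg) =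
      Projectivization.mk ℚ _ (intVec_cast_ne_zero ha) :=
    ((mk_eq_mk_iff_of_gcd_eq_one ha hgneg).2 (Or.inr rfl)).symm
  have hfib : F.filter (fun b => f b = f a) = {a, -a} := by
    ext b
    simp only [Finset.mem_filter, Finset.mem_insert, Finset.mem_singleton]
    constructor
    · rintro ⟨hbF, hb⟩
      obtain ⟨-, hb1, -⟩ := Finset.mem_filter.1 hbF
      simp only [f, dif_pos ha, dif_pos hb1] at hb
      exact (mk_eq_mk_iff_of_gcd_eq_one ha hb1).1 hb.symm
    · rintro (rfl | rfl)
      · exact ⟨haF, rfl⟩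
      · refine ⟨Finset.mem_filter.2 ⟨?_, hgneg, by rw [hmk]; exact h2⟩, ?_⟩
        · rw [mem_intBox] at h1 ⊢
          simpa using h1
        · simp only [f, dif_pos ha, dif_pos hgneg, hmk]
  rw [hfib, Finset.card_pair]
  intro h
  refine intVec_cast_ne_zero ha (funext fun i => ?_)
  have := congrFun h i
  rw [Pi.neg_apply] at this
  have : a i = 0 := by omega
  simp [this]

theorem solubleProportion_eq {B : ℝ} (hB : 0 ≤ B) :
    solubleProportion B = boxDensity (primitiveVectors EverywhereLocallySoluble) ⌊B⌋₊ /
      boxDensity (primitiveVectors fun _ => True) ⌊B⌋₊ := by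
  classical
  have h1 := two_mul_ncard_mulHeight_le EverywhereLocallySoluble hB
  have h2 := two_mul_ncard_mulHeight_le (fun _ => True) hB
  simp only [and_true] at h2
  have hpos : (0 : ℝ) < (2 * (⌊B⌋₊ : ℝ) + 1) ^ 4 := by positivity
  rw [boxDensity, boxDensity, div_div_div_cancel_right₀ hpos.ne', ← h1, ← h2, solubleProportion]
  push_cast
  rw [mul_div_mul_left _ _ two_ne_zero]

theorem primitiveVectors_true :
    primitiveVectors (fun _ => True) =
      {a | ∀ p : Nat.Primes, (fun i => (a i : ℤ_[(p : ℕ)])) ∈ primitiveSet p} := by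
  have hdvd : ∀ (p : Nat.Primes) (n : ℤ), ((p : ℕ) : ℤ_[(p : ℕ)]) ∣ n ↔ ((p : ℕ) : ℤ) ∣ n := by
    intro p n
    simpa using PadicInt.pow_p_dvd_int_iff (p := p) 1 n
  ext a
  simp only [primitiveVectors, primitiveSet, Set.mem_ofPred_eq, exists_prop, and_true, hdvd]
  constructor
  · intro ha p hp
    have := Finset.dvd_gcd (s := Finset.univ) fun i _ => hp i
    rw [ha] at this
    exact p.2.one_lt.ne' (by exact_mod_cast Int.eq_one_of_dvd_one (by positivity) this)
  · intro h
    by_contra hne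
    have hn : (Finset.univ.gcd a).natAbs ≠ 1 := by
      intro h1
      refine hne ?_
      rw [← Finset.normalize_gcd, ← Int.abs_eq_normalize, Int.abs_eq_natAbs, h1, Nat.cast_one]
    obtain ⟨p, hp, hpd⟩ := Nat.exists_prime_and_dvd hn
    refine h ⟨p, hp⟩ fun i => ?_
    exact (Int.natCast_dvd.2 hpd).trans (Finset.gcd_dvd (Finset.mem_univ i))

theorem primitiveVectors_everywhereLocallySoluble :
    primitiveVectors EverywhereLocallySoluble =
      {a | ∀ p : Nat.Primes, (fun i => (a i : ℤ_[(p : ℕ)])) ∈ primitiveSet p ∩ solubleSet p} := by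
  have h0 := Set.ext_iff.1 primitiveVectors_true
  ext a
  have h0 := h0 a
  simp only [primitiveVectors, Set.mem_ofPred_eq, exists_prop, and_true] at h0
  simp only [primitiveVectors, Set.mem_ofPred_eq, Set.mem_inter_iff, forall_and, ← h0]
  rw [exists_prop_congr (fun ha => everywhereLocallySoluble_mk_iff _ (intVec_cast_ne_zero ha)) Iff.rfl,
    exists_prop]
  refine and_congr_right fun _ => ?_
  constructor
  · rintro ⟨-, h⟩ p
    simpa [solubleSet] using h p
  · intro h
    refine ⟨diagonalCubic_real_nonempty _, fun p hp => ?_⟩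
    simpa [solubleSet] using h ⟨p, hp.out⟩

/-! ### Euler products and the limit -/

/-- The partial products decrease along finite sets and are bounded below by zero. Nothing is
claimed about positivity of the limit. -/
theorem hasProd_iInf_of_le_one {ι : Type*} {f : ι → ℝ} (h0 : ∀ i, 0 ≤ f i) (h1 : ∀ i, f i ≤ 1) :
    HasProd f (⨅ s : Finset ι, ∏ i ∈ s, f i) := by
  refine tendsto_atTop_ciInf (Finset.prod_anti_set_of_le_one h0 h1) ⟨0, ?_⟩
  rintro _ ⟨s, rfl⟩
  exact Finset.prod_nonneg fun i _ => h0 i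

theorem HasProd.tendsto_primesUpTo {f : Nat.Primes → ℝ} {x : ℝ} (h : HasProd f x) :
    Tendsto (fun M => ∏ p ∈ primesUpTo M, f p) atTop (𝓝 x) := by
  refine Tendsto.comp (g := fun s => ∏ p ∈ s, f p) h
    (tendsto_atTop_finset_of_monotone (fun M N hMN p hp => ?_) fun p => ⟨p, ?_⟩)
  · exact mem_primesUpTo.2 ((mem_primesUpTo.1 hp).trans hMN)
  · exact mem_primesUpTo.2 le_rfl

theorem padicDensity_nonneg (p : ℕ) [Fact p.Prime] : 0 ≤ padicDensity p := measureReal_nonneg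

theorem padicDensity_le_one (p : ℕ) [Fact p.Prime] : padicDensity p ≤ 1 := by
  rw [padicDensity_eq]
  exact measureReal_le_one

/-- The product of the local densities over the primes congruent to `1` modulo `3`. -/
noncomputable def padicDensityProd : ℝ :=
  ⨅ s : Finset {p : Nat.Primes // (p : ℕ) % 3 = 1}, ∏ p ∈ s, padicDensity ((p : Nat.Primes) : ℕ)

theorem hasProd_padicDensityProd :
    HasProd (fun p : {p : Nat.Primes // (p : ℕ) % 3 = 1} => padicDensity ((p : Nat.Primes) : ℕ))
      padicDensityProd :=
  hasProd_iInf_of_le_one (fun _ => padicDensity_nonneg _) fun _ => padicDensity_le_one _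

theorem hasProd_padicDensity :
    HasProd (fun p : Nat.Primes => padicDensity (p : ℕ)) (padicDensity 3 * padicDensityProd) := by
  classical
  let p₃ : Nat.Primes := ⟨3, Nat.prime_three⟩
  have h1 : HasProd (fun p : Nat.Primes => if p = p₃ then padicDensity (p₃ : ℕ) else 1)
      (padicDensity (p₃ : ℕ)) := hasProd_ite_eq p₃ _
  have h2 := (hasProd_subtype_iff_mulIndicator
    (s := {p : Nat.Primes | (p : ℕ) % 3 = 1}) (f := fun p : Nat.Primes => padicDensity (p : ℕ))).1
    hasProd_padicDensityProd
  convert h1.mul h2 using 1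
  funext p
  by_cases hp3 : p = p₃
  · rw [if_pos hp3, Set.mulIndicator_of_notMem, hp3, mul_one]
    rw [hp3]
    exact (by decide : ¬ 3 % 3 = 1)
  rw [if_neg hp3, one_mul]
  by_cases hp1 : (p : ℕ) % 3 = 1
  · exact (Set.mulIndicator_of_mem (s := {p : Nat.Primes | (p : ℕ) % 3 = 1}) hp1
      fun p : Nat.Primes => padicDensity (p : ℕ)).symm
  · refine Eq.trans ?_ (Set.mulIndicator_of_notMem (s := {p : Nat.Primes | (p : ℕ) % 3 = 1}) hp1
      fun p : Nat.Primes => padicDensity (p : ℕ)).symm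
    refine padicDensity_of_mod_three_eq_two ?_
    have : (p : ℕ) % 3 ≠ 0 := fun h => hp3 <| Subtype.ext
      ((Nat.prime_dvd_prime_iff_eq Nat.prime_three p.2).1 (Nat.dvd_of_mod_eq_zero h)).symm
    omega

/-- The value `1/ζ(4)` is the density of the primitive vectors, the denominator of the proportion;
hence the need for `δ ≠ 0`. -/
theorem hasProd_one_sub_inv_pow_four : ∃ δ : ℝ, δ ≠ 0 ∧
    HasProd (fun p : Nat.Primes => 1 - 1 / (p : ℝ) ^ 4) δ := by
  have hs : Summable fun p : Nat.Primes => ‖-(1 / ((p : ℕ) : ℝ) ^ 4)‖ := by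
    have := (Real.summable_one_div_nat_pow (p := 4)).2 (by norm_num)
    simp only [norm_neg, norm_div, norm_one, norm_pow, Real.norm_natCast]
    exact this.comp_injective Nat.Primes.coe_nat_injective
  refine ⟨∏' p : Nat.Primes, (1 + -(1 / ((p : ℕ) : ℝ) ^ 4)),
    tprod_one_add_ne_zero_of_summable (fun p => ?_) hs, ?_⟩
  · have h2 : (2 : ℝ) ≤ (p : ℕ) := by exact_mod_cast p.2.two_le
    have : 1 / ((p : ℕ) : ℝ) ^ 4 < 1 := by
      rw [div_lt_one (by positivity)]
      exact one_lt_pow₀ (by linarith) (by norm_num)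
    linarith
  · simpa only [sub_eq_add_neg] using (multipliable_one_add_of_summable hs).hasProd

/-- The sieve is applied to the primitive vectors and to the primitive soluble ones. A vector that
is not primitive at `p` has all entries divisible by `p`, so the tail hypothesis holds in both
cases; `δ` cancels in the quotient. -/
theorem tendsto_solubleProportion :
    Tendsto solubleProportion atTop (𝓝 (padicDensity 3 * padicDensityProd)) := by
  obtain ⟨δ, hδ0, hδ⟩ := hasProd_one_sub_inv_pow_four
  have hdvd : ∀ (p : Nat.Primes) (n : ℤ), ((p : ℕ) : ℤ_[(p : ℕ)]) ∣ n ↔ ((p : ℕ) : ℤ) ∣ n := by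
    intro p n
    simpa using PadicInt.pow_p_dvd_int_iff (p := p) 1 n
  have htail : ∀ (p : Nat.Primes) (a : Fin 4 → ℤ),
      (fun i => (a i : ℤ_[(p : ℕ)])) ∉ primitiveSet (p : ℕ) →
      ∃ i j, i ≠ j ∧ ((p : ℕ) : ℤ) ∣ a i ∧ ((p : ℕ) : ℤ) ∣ a j := by
    intro p a ha
    simp only [primitiveSet, Set.mem_ofPred_eq, not_not, hdvd] at ha
    exact ⟨0, 1, by decide, ha 0, ha 1⟩
  have h1 : Tendsto (boxDensity (primitiveVectors fun _ => True)) atTop (𝓝 δ) := by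
    rw [primitiveVectors_true]
    refine tendsto_boxDensity_sieve (fun p => primitiveSet (p : ℕ))
      (fun p => padicVecHaar_frontier_primitiveSet) (fun p _ a _ => htail p a) ?_
    simp only [padicVecHaar_real_primitiveSet]
    exact hδ.tendsto_primesUpTo
  have h2 : Tendsto (boxDensity (primitiveVectors EverywhereLocallySoluble)) atTop
      (𝓝 (δ * (padicDensity 3 * padicDensityProd))) := by
    rw [primitiveVectors_everywhereLocallySoluble]
    refine tendsto_boxDensity_sieve (fun p => primitiveSet (p : ℕ) ∩ solubleSet (p : ℕ))
      (fun p => padicVecHaar_frontier_primitiveSet_inter_solubleSet) (fun p hp a ha hT => ?_) ?_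
    · by_cases hprim : (fun i => (a i : ℤ_[(p : ℕ)])) ∈ primitiveSet (p : ℕ)
      · obtain ⟨i, j, hij, hi, hj⟩ := exists_dvd_dvd_of_notMem_solubleSet hp _
          (fun i => by exact_mod_cast ha i) fun h => hT ⟨hprim, h⟩
        exact ⟨i, j, hij, (hdvd p _).1 hi, (hdvd p _).1 hj⟩
      · exact htail p a hprim
    · simp only [padicVecHaar_real_primitiveSet_inter_solubleSet]
      exact (hδ.mul hasProd_padicDensity).tendsto_primesUpTo
  have h3 := (h2.div h1 hδ0).comp (tendsto_nat_floor_atTop (α := ℝ))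
  rw [mul_div_cancel_left₀ _ hδ0] at h3
  refine h3.congr' ?_
  filter_upwards [eventually_ge_atTop 0] with B hB
  exact (solubleProportion_eq hB).symm

/-! ### Numerical evaluation of the product -/

/-- The numerator of the local density at a prime `n ≡ 1 mod 3`. -/
def densityNum (n : ℕ) : ℕ := (n ^ 2 - n + 1) * (3 * n ^ 2 + 3 * n + 1) * (n ^ 2 + 3 * n + 3)

/-- The denominator of the local density at a prime `n ≡ 1 mod 3`. -/
def densityDen (n : ℕ) : ℕ := 3 * (n ^ 2 + n + 1) ^ 3

/-- The factor at `6 k + 7` in the product of the local densities over the primes congruent to `1`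
modulo `3`. -/
noncomputable def densityFactor (k : ℕ) : ℝ :=
  if (6 * k + 7).Prime then (densityNum (6 * k + 7) : ℝ) / densityDen (6 * k + 7) else 1

theorem densityDen_pos (n : ℕ) : (0 : ℝ) < densityDen n := by
  unfold densityDen
  positivity

theorem densityNum_cast (n : ℕ) : (densityNum n : ℝ) =
    (n ^ 2 - n + 1) * (3 * n ^ 2 + 3 * n + 1) * (n ^ 2 + 3 * n + 3) := by
  have h : n ≤ n ^ 2 := Nat.le_self_pow (by norm_num) n
  rw [densityNum]
  push_cast [Nat.cast_sub h]
  ring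

theorem padicDensity_eq_num_div_den {p : ℕ} [Fact p.Prime] (hp : p % 3 = 1) :
    padicDensity p = (densityNum p : ℝ) / densityDen p := by
  have h2 : (2 : ℝ) ≤ p := by exact_mod_cast (Fact.out : p.Prime).two_le
  rw [padicDensity_of_mod_three_eq_one hp, densityNum_cast, densityDen]
  have h1 : (1 - 1 / (p : ℝ) ^ 3) = (1 - 1 / p) * ((p ^ 2 + p + 1) / p ^ 2) := by
    field_simp
    ring
  have h0 : (p : ℝ) - 1 ≠ 0 := by linarith
  have h3 : (1 - 1 / (p : ℝ)) ≠ 0 := by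
    rw [one_sub_div (by positivity)]
    positivity
  rw [h1, mul_pow]
  push_cast
  have h4 : (p : ℝ) ^ 2 + p + 1 ≠ 0 := by positivity
  field_simp

theorem hasProd_densityFactor : HasProd densityFactor padicDensityProd := by
  -- Primes `≡ 1 mod 3` are odd, hence of the form `6k + 7`; at the remaining `k` the factor is `1`,
  -- so the product may be indexed by `ℕ`.
  let e : {p : Nat.Primes // (p : ℕ) % 3 = 1} → ℕ := fun p => ((p : Nat.Primes) - 7) / 6
  have hmod : ∀ p : {p : Nat.Primes // (p : ℕ) % 3 = 1}, 6 * e p + 7 = ((p : Nat.Primes) : ℕ) := by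
    rintro ⟨⟨p, hp⟩, hp3⟩
    change 6 * ((p - 7) / 6) + 7 = p
    change p % 3 = 1 at hp3
    have h2 := hp.two_le
    rcases hp.eq_two_or_odd with h | h
    · omega
    · omega
  have he : Function.Injective e := by
    intro p q h
    have h1 := hmod p
    rw [h, hmod q] at h1
    exact Subtype.ext (Subtype.ext h1.symm)
  rw [← he.hasProd_iff]
  · convert hasProd_padicDensityProd using 2 with p
    rw [Function.comp_apply, densityFactor, hmod p, if_pos p.1.2, padicDensity_eq_num_div_den p.2]
  · intro k hk
    rw [densityFactor, if_neg]
    intro hp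
    refine hk ⟨⟨⟨6 * k + 7, hp⟩, ?_⟩, ?_⟩
    · change (6 * k + 7) % 3 = 1
      omega
    · change (6 * k + 7 - 7) / 6 = k
      omega

theorem densityFactor_nonneg (k : ℕ) : 0 ≤ densityFactor k := by
  unfold densityFactor
  split_ifs <;> positivity

theorem densityFactor_le_one (k : ℕ) : densityFactor k ≤ 1 := by
  unfold densityFactor
  split_ifs
  · rw [div_le_one (densityDen_pos _), densityNum_cast, densityDen]
    push_cast
    have : (0 : ℝ) ≤ k := k.cast_nonneg
    rw [← sub_nonneg]
    ring_nf
    positivity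
  · exact le_rfl

/-- The leading term of `1 - σ_p` is `216/81 · p⁻² = 8/3 · p⁻²`, and `p ≥ 6k` turns it into `2/27 ·
k⁻²`, so the constant is asymptotically sharp. The right side is shaped to telescope. -/
theorem one_sub_densityFactor_le {k : ℕ} (hk : 0 < k) :
    1 - densityFactor k ≤ 2 / 27 * (1 / (k : ℝ) - 1 / ((k + 1 : ℕ) : ℝ)) := by
  have hk' : (0 : ℝ) < k := by exact_mod_cast hk
  have h1 : 2 / 27 * (1 / (k : ℝ) - 1 / ((k + 1 : ℕ) : ℝ)) = 2 / 27 / (k * (k + 1)) := by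
    push_cast
    field_simp
    ring
  rw [h1]
  unfold densityFactor
  split_ifs
  · rw [one_sub_div (densityDen_pos _).ne', div_le_div_iff₀ (densityDen_pos _) (by positivity),
      densityNum_cast, densityDen]
    push_cast
    rw [← sub_nonneg]
    ring_nf
    positivity
  · rw [sub_self]
    positivity

/-- All later partial products are at most `P`, so the factor at `k` costs at most `P (1 -
densityFactor k)`, and these losses telescope. -/
theorem le_prod_densityFactor {K N : ℕ} (hK : 0 < K) (hKN : K ≤ N) :
    (∏ k ∈ Finset.range K, densityFactor k) * (1 - 2 / 27 * (1 / (K : ℝ) - 1 / (N : ℝ))) ≤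
      ∏ k ∈ Finset.range N, densityFactor k := by
  set P := ∏ k ∈ Finset.range K, densityFactor k
  have hP : 0 ≤ P := Finset.prod_nonneg fun k _ => densityFactor_nonneg k
  induction N, hKN using Nat.le_induction with
  | base => simp [P]
  | succ N hN ih =>
    have h1 := one_sub_densityFactor_le (hK.trans_le hN)
    have h2 : ∏ k ∈ Finset.range N, densityFactor k ≤ P := by
      exact Finset.prod_anti_set_of_le_one densityFactor_nonneg densityFactor_le_one
        (Finset.range_mono hN)
    have h3 : 0 ≤ 1 - densityFactor N := sub_nonneg.2 (densityFactor_le_one N)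
    rw [Finset.prod_range_succ]
    have h4 := mul_le_mul_of_nonneg_right h2 h3
    have h5 := mul_le_mul_of_nonneg_left h1 hP
    linarith

theorem padicDensityProd_bounds {K : ℕ} (hK : 0 < K) :
    (∏ k ∈ Finset.range K, densityFactor k) * (1 - 2 / 27 * (1 / (K : ℝ))) ≤ padicDensityProd ∧
      padicDensityProd ≤ ∏ k ∈ Finset.range K, densityFactor k := by
  have h := hasProd_densityFactor.tendsto_prod_nat
  have hP : 0 ≤ ∏ k ∈ Finset.range K, densityFactor k :=
    Finset.prod_nonneg fun k _ => densityFactor_nonneg k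
  constructor
  · refine ge_of_tendsto h ?_
    filter_upwards [eventually_ge_atTop K] with N hN
    refine le_trans (mul_le_mul_of_nonneg_left ?_ hP) (le_prod_densityFactor hK hN)
    have : 0 ≤ 1 / (N : ℝ) := by positivity
    linarith
  · refine le_of_tendsto h ?_
    filter_upwards [eventually_ge_atTop K] with N hN
    exact Finset.prod_anti_set_of_le_one densityFactor_nonneg densityFactor_le_one
      (Finset.range_mono hN)

/-- The primes up to `121` congruent to `1` modulo `6`. -/
def smallPrimes : List ℕ := [7, 13, 19, 31, 37, 43, 61, 67, 73, 79, 97, 103, 109]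

/-- A primality test for numbers `n < 122²` congruent to `1` modulo `6`, where `F` is meant to be
`121!`. -/
def primeTest (F n : ℕ) : Bool := Nat.gcd F n == 1 || smallPrimes.elem n

theorem prime_iff_primeTest {n : ℕ} (h1 : n % 6 = 1) (h2 : 1 < n) (hn : n < 122 ^ 2) :
    n.Prime ↔ primeTest (Nat.factorial 121) n = true := by
  rw [primeTest, Bool.or_eq_true, beq_iff_eq]
  rcases le_or_gt n 121 with hs | hs
  · have hd : n ∣ Nat.factorial 121 := Nat.dvd_factorial (by omega) hs
    rw [Nat.gcd_eq_right hd]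
    have : ∀ n < 122, n % 6 = 1 → 1 < n → (n.Prime ↔ smallPrimes.elem n = true) := by
      decide
    rw [this n (by omega) h1 h2]
    simp [h2.ne']
  · have hl : ¬ smallPrimes.elem n = true := by
      rw [List.elem_eq_mem, decide_eq_true_iff]
      intro h
      have : ∀ m ∈ smallPrimes, m ≤ 121 := by decide
      exact absurd (this n h) (by omega)
    rw [or_iff_left hl]
    constructor
    · intro hp
      refine (Nat.Coprime.symm ?_)
      rw [hp.coprime_iff_not_dvd, hp.dvd_factorial]
      omega
    · intro h
      by_contra hp
      -- A composite number below `122²` has a prime factor at most `121`, which divides its gcd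
      -- with `121!`.
      have hm : n.minFac ^ 2 ≤ n := Nat.minFac_sq_le_self (by omega) hp
      have hm' : n.minFac < 122 := by
        by_contra h'
        have := Nat.pow_le_pow_left (not_lt.1 h') 2
        omega
      have hmp := Nat.minFac_prime (n := n) (by omega)
      have := Nat.dvd_gcd (hmp.dvd_factorial.2 (by omega : n.minFac ≤ 121)) n.minFac_dvd
      rw [h] at this
      exact hmp.one_lt.ne' (Nat.dvd_one.1 this)

/-- A lower approximation of the product of the first factors, scaled by `10 ^ 12`. -/
def lowerApprox (F : ℕ) : ℕ → ℕ
  | 0 => 10 ^ 12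
  | k + 1 => bif primeTest F (6 * k + 7) then
      lowerApprox F k * densityNum (6 * k + 7) / densityDen (6 * k + 7) else lowerApprox F k

/-- An upper approximation of the product of the first factors, scaled by `10 ^ 12`. -/
def upperApprox (F : ℕ) : ℕ → ℕ
  | 0 => 10 ^ 12
  | k + 1 => bif primeTest F (6 * k + 7) then
      upperApprox F k * densityNum (6 * k + 7) / densityDen (6 * k + 7) + 1 else upperApprox F k

theorem lowerApprox_le {K : ℕ} (hK : K ≤ 2479) :
    (lowerApprox (Nat.factorial 121) K : ℝ) ≤ 10 ^ 12 * ∏ k ∈ Finset.range K, densityFactor k := by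
  induction K with
  | zero => norm_num [lowerApprox]
  | succ k ih =>
    have ih := ih (by omega)
    have hp := prime_iff_primeTest (n := 6 * k + 7) (by omega) (by omega) (by omega)
    rw [Finset.prod_range_succ, densityFactor, lowerApprox, ← mul_assoc]
    by_cases h : (6 * k + 7).Prime
    · rw [if_pos h, hp.1 h, cond_true]
      refine Nat.cast_div_le.trans ?_
      rw [← mul_div_assoc]
      push_cast
      gcongr
    · rw [if_neg h, Bool.eq_false_iff.2 (mt hp.2 h), cond_false, mul_one]
      exact ih

theorem le_upperApprox {K : ℕ} (hK : K ≤ 2479) :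
    10 ^ 12 * ∏ k ∈ Finset.range K, densityFactor k ≤ (upperApprox (Nat.factorial 121) K : ℝ) := by
  induction K with
  | zero => norm_num [upperApprox]
  | succ k ih =>
    have ih := ih (by omega)
    have hp := prime_iff_primeTest (n := 6 * k + 7) (by omega) (by omega) (by omega)
    rw [Finset.prod_range_succ, densityFactor, upperApprox, ← mul_assoc]
    by_cases h : (6 * k + 7).Prime
    · rw [if_pos h, hp.1 h, cond_true, ← mul_div_assoc]
      -- The `+ 1` in `upperApprox` makes up for the truncation in natural division.
      have h1 := Nat.lt_floor_add_one ((upperApprox (Nat.factorial 121) k *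
        densityNum (6 * k + 7) : ℕ) / (densityDen (6 * k + 7) : ℝ))
      rw [Nat.floor_div_eq_div] at h1
      push_cast at h1 ⊢
      refine le_trans ?_ h1.le
      gcongr
    · rw [if_neg h, Bool.eq_false_iff.2 (mt hp.2 h), cond_false, mul_one]
      exact ih

theorem lowerApprox_numeric : 924535626000 ≤ lowerApprox (Nat.factorial 121) 2479 := by
  decide +kernel

theorem upperApprox_numeric : upperApprox (Nat.factorial 121) 2479 ≤ 924535628000 := by
  decide +kernel

theorem abs_padicDensity_three_mul_padicDensityProd_sub_lt :
    |padicDensity 3 * padicDensityProd - 0.8965| < 0.00005 := by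
  -- With this cut-off the relative tail error is `2 / (27 · 2479) < 3 · 10⁻⁵`, and all numbers `6k
  -- + 7` tested lie below `122²`. The resulting interval is about `(0.896453, 0.896482)`, so the
  -- lower end `0.89645` is the tight one.
  obtain ⟨h1, h2⟩ := padicDensityProd_bounds (K := 2479) (by norm_num)
  have h3 := lowerApprox_le (K := 2479) le_rfl
  have h4 := le_upperApprox (K := 2479) le_rfl
  have h5 : (924535626000 : ℝ) ≤ _ := (Nat.cast_le.2 lowerApprox_numeric).trans h3
  have h6 := h4.trans (Nat.cast_le (α := ℝ).2 upperApprox_numeric)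
  have h7 : (0.96965559 : ℝ) ≤ padicDensity 3 := by
    rw [padicDensity_three]
    norm_num
  have h8 : padicDensity 3 ≤ 0.969655591 := by
    rw [padicDensity_three]
    norm_num
  push_cast at h5 h6 h1
  have h9 : (0.924507 : ℝ) ≤ padicDensityProd := by
    refine le_trans ?_ h1
    refine le_trans ?_ (mul_le_mul_of_nonneg_right (by linarith : (0.924535626 : ℝ) ≤ _)
      (by norm_num))
    norm_num
  have h10 : padicDensityProd ≤ 0.924535628 := by linarith
  rw [abs_lt]
  constructor
  · have := mul_le_mul h7 h9 (by norm_num) (by linarith)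
    norm_num at this ⊢
    linarith
  · have := mul_le_mul h8 h10 (by linarith) (by norm_num)
    norm_num at this ⊢
    linarith

theorem mainTheorem5 :
    realDensity = 1 ∧
    (∀ (p : ℕ) [Fact p.Prime], p % 3 = 2 → padicDensity p = 1) ∧
    (∀ (p : ℕ) [Fact p.Prime], p % 3 = 1 →
      padicDensity p =
        (1 - 1 / (p : ℝ)) ^ 3 / (1 - 1 / (p : ℝ) ^ 3) ^ 3
          * (1 - 1 / (p : ℝ) + 1 / (p : ℝ) ^ 2)
          * (1 + 1 / (p : ℝ) + 1 / (3 * (p : ℝ) ^ 2))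
          * (1 + 3 / (p : ℝ) + 3 / (p : ℝ) ^ 2)) ∧
    padicDensity 3 =
      (1 - 1 / (3 : ℝ)) ^ 3 / (1 - 1 / (3 : ℝ) ^ 3) ^ 3
        * (1 + 3 / (3 : ℝ) + 46 / (9 * (3 : ℝ) ^ 2) + 7 / (3 : ℝ) ^ 3
          + 62 / (9 * (3 : ℝ) ^ 4) + 19 / (9 * (3 : ℝ) ^ 5) + 1 / (3 : ℝ) ^ 6) ∧
    ∃ σ τ : ℝ,
      Tendsto solubleProportion atTop (𝓝 σ) ∧
      HasProd (fun p : {p : Nat.Primes // (p : ℕ) % 3 = 1} =>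
        haveI : Fact ((p : Nat.Primes) : ℕ).Prime := ⟨p.1.2⟩
        padicDensity ((p : Nat.Primes) : ℕ)) τ ∧
      σ = padicDensity 3 * τ ∧
      |σ - 0.8965| < 0.00005 := by
  refine ⟨realDensity_eq_one, fun p _ => padicDensity_of_mod_three_eq_two,
    fun p _ => padicDensity_of_mod_three_eq_one, padicDensity_three, padicDensity 3 * padicDensityProd,
    padicDensityProd, tendsto_solubleProportion, hasProd_padicDensityProd, rfl,
    abs_padicDensity_three_mul_padicDensityProd_sub_lt⟩
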